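/- Let $(M,g)$ be a closed (compact, without boundary) smooth Riemannian manifold of dimension $n$ with a fixed spin structure, and let $\Sigma_gM\to M$ be its complex spinor bundle, of complex rank $2^{\lfloor n/2\rfloor}$, regarded as a real vector bundle with its fibrewise Euclidean inner product and its spin connection. Let $\nabla^g$ be the induced connection on the bundle $\mathrm{End}(\Sigma_gM)$ of real endomorphisms. For $n<p<\infty$ (and $p\ge 1$) let $W^{1,p}(M,\mathrm{End}(\Sigma_gM))$ be the space of sections $F\in L^p$ whose weak covariant derivative $\nabla^gF$ lies in $L^p$, with the norm $\|F\|_{L^p}+\|\nabla^gF\|_{L^p}$. For $0<\Lambda_1\le\Lambda_2$ let $\mathcal P_{\Lambda_1,\Lambda_2}$ be the set of all $A\in W^{1,p}(M,\mathrm{End}(\Sigma_gM))$ such that, for almost every $x\in M$, $A(x)=A(x)^*$ and $\Lambda_1\mathrm{Id}\le A(x)\le\Lambda_2\mathrm{Id}$. Let $I\subset\mathbb R$ be an interval and let $I\ni t\mapsto A_t\in\mathcal P_{\Lambda_1,\Lambda_2}$ be of class $C^1$ as a map into $W^{1,p}(M,\mathrm{End}(\Sigma_gM))$, with derivative $\dot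 A_t$. Let $S_t=A_t^{1/2}$ be the fibrewise positive square root and $Q_t=A_t^{-1/2}=S_t^{-1}$. Then $S_t$ and $Q_t$ belong to $W^{1,p}(M,\mathrm{End}(\Sigma_gM))$, and the maps $t\mapsto S_t$ and $t\mapsto Q_t$ are of class $C^1$ as maps $I\to W^{1,p}(M,\mathrm{End}(\Sigma_gM))$. For every $t\in I$ and almost every $x\in M$, $\dot S_t(x)$ is the unique endomorphism $X$ of the fibre of $\Sigma_gM$ at $x$ that solves the Sylvester equation $$S_t(x)\,X+X\,S_t(x)=\dot A_t(x),$$ and $\dot Q_t(x)=-Q_t(x)\,\dot S_t(x)\,Q_t(x)$. -/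

import Mathlib

set_option maxSynthPendingDepth 3

open Set Filter MeasureTheory Bundle Topology
open scoped Manifold ContDiff ENNReal

-- Without this, instance search endows `EuclideanSpace ℝ (Fin n)` with a charted space structure
-- obtained by unfolding it as an object of `TopCat`.
attribute [instance 2000] chartedSpaceSelf

namespace SpinGeom

/-! ### Clifford algebra and spinor representation -/

/-- Euclidean `n`-space. -/
abbrev E (n : ℕ) : Type := EuclideanSpace ℝ (Fin n)

/-- Endomorphisms of the space `V` of spinors regarded as a real Euclidean space, with the operator
norm. -/
abbrev EndSpinor (V : Type*) [NormedAddCommGroup V] [InnerProductSpace ℝ V] : Type _ := V →L[ℝ] V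

/-- The form `v ↦ -|v|²`, so that `v² = -|v|²` in its Clifford algebra. -/
noncomputable def cliffordForm (n : ℕ) : QuadraticForm ℝ (E n) :=
  -LinearMap.BilinMap.toQuadraticMap (innerₗ (E n))

/-- A complex spinor representation of the Clifford algebra of `ℝⁿ`: a Hermitian space of complex
dimension `2^⌊n/2⌋` on which vectors act by skew-adjoint complex linear maps (the representation is
irreducible by its dimension). The Hermitian space is given as the underlying real Euclidean space
`V` with its orthogonal complex structure `J`. -/
structure SpinorRep (n : ℕ) (V : Type*) [NormedAddCommGroup V] [InnerProductSpace ℝ V] where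
  finrank_eq : Module.finrank ℝ V = 2 * 2 ^ (n / 2)
  J : EndSpinor V
  J_sq : J * J = -1
  J_skew : ∀ ψ φ : V, inner ℝ (J ψ) φ = -inner ℝ ψ (J φ)
  γ : E n →ₗ[ℝ] EndSpinor V
  sq : ∀ v, γ v * γ v = algebraMap ℝ (EndSpinor V) (cliffordForm n v)
  comm_J : ∀ v, γ v * J = J * γ v
  skew : ∀ v (ψ φ : V), inner ℝ (γ v ψ) φ = -inner ℝ ψ (γ v φ)

/-- The action of the whole Clifford algebra on spinors. -/
noncomputable def SpinorRep.ρ {n : ℕ} {V : Type*} [NormedAddCommGroup V] [InnerProductSpace ℝ V]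
    (κ : SpinorRep n V) : CliffordAlgebra (cliffordForm n) →ₐ[ℝ] EndSpinor V :=
  CliffordAlgebra.lift (cliffordForm n) ⟨κ.γ, κ.sq⟩

/-- Smooth Riemannian metrics on `M`. -/
abbrev RMetric (n : ℕ) (M : Type*) [TopologicalSpace M] [ChartedSpace (E n) M]
    [IsManifold (𝓡 n) ∞ M] : Type _ :=
  ContMDiffRiemannianMetric (𝓡 n) ∞ (E n) (fun x : M => TangentSpace (𝓡 n) x)

/-- A spin structure on `(M, g)`, given by a countable open cover with smooth orthonormal frames
whose transition functions come with a cocycle of smooth lifts to `Spin(n)`. If `ẽᵢ` is the lift of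
the frame `eᵢ`, then `ẽⱼ = ẽᵢ · lift i j`. (An orientation is part of the data, as `Spin(n)` acts
through `SO(n)`.) -/
structure SpinStructure {n : ℕ} {M : Type*} [TopologicalSpace M] [ChartedSpace (E n) M]
    [IsManifold (𝓡 n) ∞ M] (g : RMetric n M) where
  U : ℕ → Set M
  isOpen_U : ∀ i, IsOpen (U i)
  cover : ∀ x, ∃ i, x ∈ U i
  frame : ℕ → Fin n → (x : M) → TangentSpace (𝓡 n) x
  smooth_frame : ∀ i a, ContMDiffOn (𝓡 n) (𝓡 n).tangent ∞
    (fun x => (⟨x, frame i a x⟩ : TangentBundle (𝓡 n) M)) (U i)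
  orthonormal : ∀ i, ∀ x ∈ U i, ∀ a b,
    g.inner x (frame i a x) (frame i b x) = if a = b then 1 else 0
  lift : ℕ → ℕ → M → spinGroup (cliffordForm n)
  smooth_lift : ∀ i j (l : CliffordAlgebra (cliffordForm n) →ₗ[ℝ] ℝ),
    ContMDiffOn (𝓡 n) 𝓘(ℝ, ℝ) ∞
      (fun x => l (lift i j x : CliffordAlgebra (cliffordForm n))) (U i ∩ U j)
  cocycle : ∀ i j k, ∀ x ∈ U i ∩ U j ∩ U k, lift i j x * lift j k x = lift i k x
  /-- `lift i j` acts on `ℝⁿ` by conjugation as the matrix of the frame `eⱼ` in the frame `eᵢ`. -/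
  lift_frame : ∀ i j, ∀ x ∈ U i ∩ U j, ∀ b : Fin n,
    (lift i j x : CliffordAlgebra (cliffordForm n)) *
        CliffordAlgebra.ι (cliffordForm n) (EuclideanSpace.single b 1) =
      CliffordAlgebra.ι (cliffordForm n)
          (WithLp.toLp 2 fun a => g.inner x (frame i a x) (frame j b x)) *
        (lift i j x : CliffordAlgebra (cliffordForm n))

section

variable {n : ℕ} {M : Type*} [TopologicalSpace M] [ChartedSpace (E n) M]
  [IsManifold (𝓡 n) ∞ M]

/-! ### Riemannian volume -/

/-- The derivative at `y` of the inverse of the chart `φ`; it maps the `k`-th basis vector to the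
coordinate field `∂ₖ`. -/
noncomputable def coordVec (φ : OpenPartialHomeomorph M (E n)) (y v : E n) :
    TangentSpace (𝓡 n) (φ.symm y) :=
  mfderiv (𝓡 n) (𝓡 n) φ.symm y v

/-- The density `√det(g(∂ₐ, ∂_b))` in the chart `φ`. -/
noncomputable def volDensity (g : RMetric n M) (φ : OpenPartialHomeomorph M (E n)) (y : E n) : ℝ :=
  √(Matrix.det (Matrix.of fun a b : Fin n =>
    g.inner (φ.symm y) (coordVec φ y (EuclideanSpace.single a 1))
      (coordVec φ y (EuclideanSpace.single b 1))))

/-- The Riemannian volume measure: the least measure dominating, for every chart `φ`, the measure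
which is `√det g dy` in `φ`. All of the latter are restrictions of one measure to chart domains, so
that this is the measure given by `√det g dy` in every chart. -/
noncomputable def vol [MeasurableSpace M] (g : RMetric n M) : Measure M :=
  ⨆ φ ∈ atlas (E n) M, Measure.map φ.symm
    ((volume.restrict φ.target).withDensity fun y => ENNReal.ofReal (volDensity g φ y))

theorem continuousOn_gram (g : RMetric n M) {φ : OpenPartialHomeomorph M (E n)}
    (hφ : φ ∈ atlas (E n) M) (v w : E n) :
    ContinuousOn (fun y => g.inner (φ.symm y) (coordVec φ y v) (coordVec φ y w)) φ.target := by
  let : RiemannianBundle (fun x : M => TangentSpace (𝓡 n) x) := ⟨g.toRiemannianMetric⟩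
  have hs : ContMDiffOn (𝓡 n) (𝓡 n) ∞ φ.symm φ.target :=
    contMDiffOn_symm_of_mem_maximalAtlas (IsManifold.subset_maximalAtlas hφ)
  have ht : ∀ u : E n, ContMDiffOn (𝓡 n) (𝓡 n).tangent 0
      (fun y => (⟨φ.symm y, coordVec φ y u⟩ : TangentBundle (𝓡 n) M)) φ.target := by
    intro u
    have h1 := hs.contMDiffOn_tangentMapWithin (m := 0) (by simp)
      φ.open_target.uniqueMDiffOn
    have h2 : ContMDiff (𝓡 n) (𝓡 n).tangent 0
        (fun y : E n => (⟨y, u⟩ : TangentBundle (𝓡 n) (E n))) :=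
      (contMDiff_vectorSpace_iff_contDiff (V := fun _ : E n => u)).2 contDiff_const
    refine (h1.comp h2.contMDiffOn (fun y hy => hy)).congr ?_
    intro y hy
    simp only [Function.comp_apply, tangentMapWithin, coordVec]
    rw [mfderivWithin_of_isOpen φ.open_target hy]
  exact ((ht v).inner_bundle (ht w)).continuousOn

theorem volDensity_pos (g : RMetric n M) {φ : OpenPartialHomeomorph M (E n)}
    (hφ : φ ∈ atlas (E n) M) {y : E n} (hy : y ∈ φ.target) : 0 < volDensity g φ y := by
  have hinj : Function.Injective (mfderiv (𝓡 n) (𝓡 n) φ.symm y) :=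
    (mdifferentiable_of_mem_atlas (I := 𝓡 n) hφ).symm.mfderiv_injective hy
  refine Real.sqrt_pos.2 (Matrix.PosDef.det_pos (Matrix.PosDef.of_dotProduct_mulVec_pos ?_ ?_))
  · ext a b
    simp [Matrix.conjTranspose_apply, g.symm]
  · intro c hc
    have hne : coordVec φ y (WithLp.toLp 2 c) ≠ 0 := by
      intro h0
      apply hc
      have h1 : (WithLp.toLp 2 c : E n) = 0 := hinj (h0.trans (map_zero _).symm)
      simpa using congrArg (WithLp.ofLp) h1
    have hexp : coordVec φ y (WithLp.toLp 2 c) =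
        ∑ a, c a • coordVec φ y (EuclideanSpace.single a 1) := by
      have h2 : (WithLp.toLp 2 c : E n) = ∑ a, c a • EuclideanSpace.single a (1 : ℝ) := by
        ext b
        simp [Finset.sum_apply, Pi.single_apply]
      rw [h2]
      exact (map_sum (mfderiv (𝓡 n) (𝓡 n) φ.symm y) _ _).trans
        (Finset.sum_congr rfl fun a _ => map_smul (mfderiv (𝓡 n) (𝓡 n) φ.symm y) _ _)
    have hp := g.pos _ _ hne
    rw [hexp] at hp
    simp only [map_sum, map_smul, sum_apply, smul_apply,
      smul_eq_mul] at hp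
    simp only [dotProduct, Matrix.mulVec, Matrix.of_apply, star_trivial]
    refine lt_of_lt_of_eq hp (Finset.sum_congr rfl fun a _ => ?_)
    congr 1
    refine Finset.sum_congr rfl fun b _ => ?_
    rw [mul_comm, g.symm]

theorem ae_chart_of_ae_vol [MeasurableSpace M] [BorelSpace M] (g : RMetric n M)
    {φ : OpenPartialHomeomorph M (E n)} (hφ : φ ∈ atlas (E n) M) {P : M → Prop}
    (hP : ∀ᵐ x ∂vol g, P x) : ∀ᵐ y ∂(volume.restrict φ.target), P (φ.symm y) := by
  have hms : MeasurableSet φ.target := φ.open_target.measurableSet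
  have hd : ContinuousOn (volDensity g φ) φ.target := by
    refine Real.continuous_sqrt.comp_continuousOn ?_
    have hc : ContinuousOn (fun y => (Matrix.of fun a b : Fin n =>
        g.inner (φ.symm y) (coordVec φ y (EuclideanSpace.single a 1))
          (coordVec φ y (EuclideanSpace.single b 1)))) φ.target :=
      continuousOn_pi.2 fun a => continuousOn_pi.2 fun b => continuousOn_gram g hφ _ _
    exact (Continuous.matrix_det continuous_id).comp_continuousOn hc
  have h1 : ∀ᵐ y ∂((volume.restrict φ.target).withDensity
      fun y => ENNReal.ofReal (volDensity g φ y)), P (φ.symm y) := by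
    refine ae_of_ae_map ?_ (ae_mono ?_ hP)
    · exact (φ.symm.continuousOn.aemeasurable hms).mono_ac
        (withDensity_absolutelyContinuous _ _)
    · exact le_iSup₂ (f := fun (φ : OpenPartialHomeomorph M (E n)) (_ : φ ∈ atlas (E n) M) =>
        Measure.map φ.symm ((volume.restrict φ.target).withDensity
          fun y => ENNReal.ofReal (volDensity g φ y))) φ hφ
  refine (withDensity_absolutelyContinuous' ?_ ?_).ae_le h1
  · exact (hd.aemeasurable hms).ennreal_ofReal
  · refine (ae_restrict_iff' hms).2 (Eventually.of_forall fun y hy => ?_)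
    simpa using volDensity_pos g hφ hy

/-! ### The spinor bundle and its connection -/

namespace SpinStructure

variable {g : RMetric n M} (σ : SpinStructure g) {V : Type*} [NormedAddCommGroup V]
  [InnerProductSpace ℝ V] (κ : SpinorRep n V)

/-- The first index `i` with `x ∈ U i`. -/
noncomputable def indexAt (x : M) : ℕ := by
  classical exact Nat.find (σ.cover x)

theorem mem_U_indexAt (x : M) : x ∈ σ.U (σ.indexAt x) := by
  classical
  unfold indexAt
  exact Nat.find_spec (σ.cover x)

theorem lift_self (i : ℕ) (x : M) (hx : x ∈ σ.U i) : σ.lift i i x = 1 := by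
  have h := σ.cocycle i i i x ⟨⟨hx, hx⟩, hx⟩
  exact mul_left_cancel (h.trans (mul_one _).symm)

theorem continuousOn_rho_lift (i j : ℕ) :
    ContinuousOn (fun x => κ.ρ (σ.lift i j x : CliffordAlgebra (cliffordForm n)))
      (σ.U i ∩ σ.U j) := by
  have : FiniteDimensional ℝ V :=
    Module.finite_of_finrank_pos (by rw [κ.finrank_eq]; positivity)
  let b := Module.finBasis ℝ (EndSpinor V)
  have h : ∀ x, κ.ρ (σ.lift i j x : CliffordAlgebra (cliffordForm n)) =
      ∑ k, (b.coord k ∘ₗ κ.ρ.toLinearMap)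
        (σ.lift i j x : CliffordAlgebra (cliffordForm n)) • b k := by
    intro x
    conv_lhs => rw [← b.sum_repr (κ.ρ (σ.lift i j x : CliffordAlgebra (cliffordForm n)))]
    rfl
  simp_rw [h]
  exact continuousOn_finsetSum _ fun k _ =>
    ((σ.smooth_lift i j (b.coord k ∘ₗ κ.ρ.toLinearMap)).continuousOn).smul continuousOn_const

/-- The spinor bundle `Σ_g M`: the bundle with fibre `V` associated to the spin structure. A spinor
has components `ψᵢ` in the frame `i`, related by `ψⱼ = ρ(lift j i) ψᵢ`. The fibre at `x` is a copy
of `V`, by means of the components in the frame of index `indexAt x`. -/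
noncomputable def spinorBundle : VectorBundleCore ℝ M V ℕ where
  baseSet := σ.U
  isOpen_baseSet := σ.isOpen_U
  indexAt := σ.indexAt
  mem_baseSet_at := σ.mem_U_indexAt
  coordChange i j x := κ.ρ (σ.lift j i x : CliffordAlgebra (cliffordForm n))
  coordChange_self i x hx v := by simp [σ.lift_self i x hx]
  continuousOn_coordChange i j := by
    rw [inter_comm]
    exact σ.continuousOn_rho_lift κ j i
  coordChange_comp i j k x hx v := by
    have h := σ.cocycle k j i x ⟨⟨hx.2, hx.1.2⟩, hx.1.1⟩
    rw [← h, Submonoid.coe_mul, map_mul]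
    rfl

/-- The matrix in the frame `i` of an endomorphism of the fibre `(Σ_g M)ₓ`. -/
noncomputable def endRep (i : ℕ) (x : M) (B : EndSpinor V) : EndSpinor V :=
  (σ.spinorBundle κ).coordChange (σ.indexAt x) i x * B *
    (σ.spinorBundle κ).coordChange i (σ.indexAt x) x

/-- The coordinates of a tangent vector in the orthonormal frame `i`. -/
noncomputable def coord (i : ℕ) (x : M) (X : TangentSpace (𝓡 n) x) : E n :=
  WithLp.toLp 2 fun a => g.inner x (σ.frame i a x) X

/-- The Levi-Civita coefficients `g(∇_{e_c} e_a, e_b)` of the orthonormal frame `i`, by the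
Koszul formula. -/
noncomputable def leviCivita (i : ℕ) (x : M) (c a b : Fin n) : ℝ :=
  (1 / 2) *
    (g.inner x (VectorField.mlieBracket (𝓡 n) (σ.frame i c) (σ.frame i a) x) (σ.frame i b x)
      - g.inner x (VectorField.mlieBracket (𝓡 n) (σ.frame i a) (σ.frame i b) x) (σ.frame i c x)
      + g.inner x (VectorField.mlieBracket (𝓡 n) (σ.frame i b) (σ.frame i c) x) (σ.frame i a x))

/-- The spin connection form in the frame `i`: the spin connection is
`(∇_X ψ)ᵢ = X(ψᵢ) + (1/4) ∑_{a,b} g(∇_X e_a, e_b) γ(e_a) γ(e_b) ψᵢ`. -/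
noncomputable def connForm (i : ℕ) (x : M) (X : TangentSpace (𝓡 n) x) : EndSpinor V :=
  (1 / 4 : ℝ) • ∑ a, ∑ b, (∑ c, σ.coord i x X c * σ.leviCivita i x c a b) •
    (κ.γ (EuclideanSpace.single a 1) * κ.γ (EuclideanSpace.single b 1))

/-! ### Sobolev sections of the endomorphism bundle

A (measurable) section of `End(Σ_g M)` is represented by `F : M → EndSpinor V`, where `F x` is an
endomorphism of the fibre at `x`. A section of `T*M ⊗ End(Σ_g M)` is represented by
`G : M → (E n →L[ℝ] EndSpinor V)`, where `G x v` is its value at the tangent vector with coordinates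
`v` in the orthonormal frame of index `indexAt x`. As the frames are orthonormal and their
lifts act isometrically, the norms `‖F x‖` and `‖G x‖` are the pointwise operator norms defined by
the metrics of `TM` and `Σ_g M`. -/

/-- The matrix in the frame `i`, read in the chart `φ`, of the section `F`. -/
noncomputable def localSec (i : ℕ) (φ : OpenPartialHomeomorph M (E n)) (F : M → EndSpinor V)
    (y : E n) : EndSpinor V :=
  σ.endRep κ i (φ.symm y) (F (φ.symm y))

/-- What `∂_v` of `localSec i φ F` has to be if `∇F = G`: as `(∇_X F)ᵢ = X(Fᵢ) + [ωᵢ(X), Fᵢ]`, it is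
`Gᵢ(∂_v) - [ωᵢ(∂_v), Fᵢ]`. -/
noncomputable def localDeriv (i : ℕ) (φ : OpenPartialHomeomorph M (E n)) (v : E n)
    (F : M → EndSpinor V) (G : M → (E n →L[ℝ] EndSpinor V)) (y : E n) : EndSpinor V :=
  σ.endRep κ i (φ.symm y)
      (G (φ.symm y) (σ.coord (σ.indexAt (φ.symm y)) (φ.symm y) (coordVec φ y v)))
    - (σ.connForm κ i (φ.symm y) (coordVec φ y v) * σ.localSec κ i φ F y
        - σ.localSec κ i φ F y * σ.connForm κ i (φ.symm y) (coordVec φ y v))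

/-- The domain in `ℝⁿ` on which the frame `i` is read in the chart `φ`. -/
def localDom (i : ℕ) (φ : OpenPartialHomeomorph M (E n)) : Set (E n) :=
  φ.target ∩ φ.symm ⁻¹' σ.U i

/-- `G` is the weak covariant derivative of `F`: in each chart and frame, the local expressions
are locally integrable and satisfy the integration by parts formula against all test functions. -/
def HasWeakCovDeriv (F : M → EndSpinor V) (G : M → (E n →L[ℝ] EndSpinor V)) : Prop :=
  ∀ (i : ℕ), ∀ φ ∈ atlas (E n) M, ∀ v : E n,
    LocallyIntegrableOn (σ.localSec κ i φ F) (σ.localDom i φ) ∧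
    LocallyIntegrableOn (σ.localDeriv κ i φ v F G) (σ.localDom i φ) ∧
    ∀ η : E n → ℝ, ContDiff ℝ ∞ η → HasCompactSupport η → tsupport η ⊆ σ.localDom i φ →
      ∫ y in σ.localDom i φ, fderiv ℝ η y v • σ.localSec κ i φ F y =
        -∫ y in σ.localDom i φ, η y • σ.localDeriv κ i φ v F G y

theorem endRep_add (i : ℕ) (x : M) (B C : EndSpinor V) :
    σ.endRep κ i x (B + C) = σ.endRep κ i x B + σ.endRep κ i x C := by
  simp only [endRep, mul_add, add_mul]

theorem endRep_smul (i : ℕ) (x : M) (c : ℝ) (B : EndSpinor V) :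
    σ.endRep κ i x (c • B) = c • σ.endRep κ i x B := by
  simp only [endRep, mul_smul_comm, smul_mul_assoc]

theorem isOpen_localDom (i : ℕ) (φ : OpenPartialHomeomorph M (E n)) :
    IsOpen (σ.localDom i φ) :=
  φ.symm.isOpen_inter_preimage (σ.isOpen_U i)

theorem hasWeakCovDeriv_zero : σ.HasWeakCovDeriv κ (fun _ => 0) (fun _ => 0) := by
  intro i φ _ v
  have h0 : ∀ x, σ.endRep κ i x 0 = 0 := fun x => by simp [endRep]
  have h1 : σ.localSec κ i φ (fun _ => 0) = fun _ => 0 := by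
    funext y
    simp [localSec, h0]
  have h2 : σ.localDeriv κ i φ v (fun _ => 0) (fun _ => 0) = fun _ => 0 := by
    funext y
    simp [localDeriv, h1, h0]
  rw [h1, h2]
  exact ⟨locallyIntegrableOn_zero, locallyIntegrableOn_zero, fun η _ _ _ => by simp⟩

theorem integrable_test_smul {Ω : Set (E n)} {f : E n → EndSpinor V}
    (hf : LocallyIntegrableOn f Ω) {η : E n → ℝ} (hη : Continuous η) (hc : HasCompactSupport η)
    (hs : tsupport η ⊆ Ω) : IntegrableOn (fun y => η y • f y) Ω := by
  have hK : IntegrableOn f (tsupport η) := hf.integrableOn_compact_subset hs hc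
  have h1 : IntegrableOn (fun y => η y • f y) (tsupport η) :=
    hK.continuousOn_smul hη.continuousOn hc
  refine Integrable.integrableOn ((integrableOn_iff_integrable_of_support_subset ?_).1 h1)
  intro y hy
  refine subset_tsupport η fun h => hy ?_
  simp [h]

variable {σ κ}

theorem HasWeakCovDeriv.add {F F' : M → EndSpinor V} {G G' : M → (E n →L[ℝ] EndSpinor V)}
    (h : σ.HasWeakCovDeriv κ F G) (h' : σ.HasWeakCovDeriv κ F' G') :
    σ.HasWeakCovDeriv κ (F + F') (G + G') := by
  intro i φ hφ v
  obtain ⟨a, b, c⟩ := h i φ hφ v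
  obtain ⟨a', b', c'⟩ := h' i φ hφ v
  have h1 : σ.localSec κ i φ (F + F') = σ.localSec κ i φ F + σ.localSec κ i φ F' := by
    funext y
    simp [localSec, endRep_add]
  have h2 : σ.localDeriv κ i φ v (F + F') (G + G') =
      σ.localDeriv κ i φ v F G + σ.localDeriv κ i φ v F' G' := by
    funext y
    simp only [localDeriv, h1, Pi.add_apply, add_apply, endRep_add, mul_add, add_mul]
    abel
  rw [h1, h2]
  refine ⟨a.add a', b.add b', fun η hη hc hs => ?_⟩
  have hd : Continuous fun y => fderiv ℝ η y v :=
    (hη.continuous_fderiv (by simp)).clm_apply continuous_const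
  have hdc : HasCompactSupport fun y => fderiv ℝ η y v := hc.fderiv_apply (𝕜 := ℝ) v
  have hds : tsupport (fun y => fderiv ℝ η y v) ⊆ σ.localDom i φ :=
    (tsupport_fderiv_apply_subset ℝ v).trans hs
  simp only [Pi.add_apply, smul_add]
  rw [integral_add (integrable_test_smul a hd hdc hds) (integrable_test_smul a' hd hdc hds),
    integral_add (integrable_test_smul b hη.continuous hc hs)
      (integrable_test_smul b' hη.continuous hc hs), c η hη hc hs, c' η hη hc hs]
  abel

theorem HasWeakCovDeriv.smul {F : M → EndSpinor V} {G : M → (E n →L[ℝ] EndSpinor V)}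
    (h : σ.HasWeakCovDeriv κ F G) (r : ℝ) : σ.HasWeakCovDeriv κ (r • F) (r • G) := by
  intro i φ hφ v
  obtain ⟨a, b, c⟩ := h i φ hφ v
  have h1 : σ.localSec κ i φ (r • F) = r • σ.localSec κ i φ F := by
    funext y
    simp [localSec, endRep_smul]
  have h2 : σ.localDeriv κ i φ v (r • F) (r • G) = r • σ.localDeriv κ i φ v F G := by
    funext y
    simp only [localDeriv, h1, Pi.smul_apply, smul_apply, endRep_smul, mul_smul_comm,
      smul_mul_assoc, smul_sub]
  rw [h1, h2]
  refine ⟨a.smul r, b.smul r, fun η hη hc hs => ?_⟩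
  simp only [Pi.smul_apply, smul_comm _ r]
  rw [integral_smul, integral_smul, c η hη hc hs, smul_neg]

theorem HasWeakCovDeriv.congr [MeasurableSpace M] [BorelSpace M] {F F' : M → EndSpinor V}
    {G G' : M → (E n →L[ℝ] EndSpinor V)} (h : σ.HasWeakCovDeriv κ F G)
    (hF : F =ᵐ[vol g] F') (hG : G =ᵐ[vol g] G') : σ.HasWeakCovDeriv κ F' G' := by
  intro i φ hφ v
  obtain ⟨a, b, c⟩ := h i φ hφ v
  have hae : ∀ᵐ y ∂(volume.restrict (σ.localDom i φ)),
      F (φ.symm y) = F' (φ.symm y) ∧ G (φ.symm y) = G' (φ.symm y) :=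
    ae_restrict_of_ae_restrict_of_subset inter_subset_left
      (ae_chart_of_ae_vol g hφ (hF.and hG))
  have h1 : σ.localSec κ i φ F =ᵐ[volume.restrict (σ.localDom i φ)] σ.localSec κ i φ F' := by
    filter_upwards [hae] with y hy
    simp only [localSec, hy.1]
  have h2 : σ.localDeriv κ i φ v F G =ᵐ[volume.restrict (σ.localDom i φ)]
      σ.localDeriv κ i φ v F' G' := by
    filter_upwards [hae] with y hy
    simp only [localDeriv, localSec, hy.1, hy.2]
  refine ⟨a.congr h1, b.congr h2, fun η hη hc hs => ?_⟩
  have e := c η hη hc hs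
  have e1 : (fun y => fderiv ℝ η y v • σ.localSec κ i φ F y)
      =ᵐ[volume.restrict (σ.localDom i φ)] fun y => fderiv ℝ η y v • σ.localSec κ i φ F' y := by
    filter_upwards [h1] with y hy
    rw [hy]
  have e2 : (fun y => η y • σ.localDeriv κ i φ v F G y)
      =ᵐ[volume.restrict (σ.localDom i φ)] fun y => η y • σ.localDeriv κ i φ v F' G' y := by
    filter_upwards [h2] with y hy
    rw [hy]
  rwa [integral_congr_ae e1, integral_congr_ae e2] at e

variable (σ κ)
variable [MeasurableSpace M] [BorelSpace M] (p : ℝ≥0∞) [Fact (1 ≤ p)]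

/-- The Sobolev space `W^{1,p}(M, End(Σ_g M))`: the pairs `(F, ∇F)` with `F ∈ L^p` and weak covariant
derivative `∇F ∈ L^p`, with the norm `‖F‖_{L^p} + ‖∇F‖_{L^p}` (the pair is determined by `F`). -/
noncomputable def W1p : Submodule ℝ (WithLp 1
    (Lp (EndSpinor V) p (vol g) × Lp (E n →L[ℝ] EndSpinor V) p (vol g))) where
  carrier := {u | σ.HasWeakCovDeriv κ (u.fst : M → EndSpinor V)
    (u.snd : M → (E n →L[ℝ] EndSpinor V))}
  zero_mem' := (σ.hasWeakCovDeriv_zero κ).congr (Lp.coeFn_zero _ _ _).symm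
    (Lp.coeFn_zero _ _ _).symm
  add_mem' hu hv := (hu.add hv).congr (Lp.coeFn_add _ _).symm (Lp.coeFn_add _ _).symm
  smul_mem' r _ hu := (hu.smul r).congr (Lp.coeFn_smul _ _).symm (Lp.coeFn_smul _ _).symm

variable {σ κ p}

/-- The section underlying an element of `W^{1,p}` (defined almost everywhere). -/
noncomputable def sec (u : σ.W1p κ p) : M → EndSpinor V := u.1.fst

variable (σ κ p)

/-- The admissible weights `𝒫_{Λ₁,Λ₂}`. -/
def admissible (Λ₁ Λ₂ : ℝ) : Set (σ.W1p κ p) :=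
  {A | ∀ᵐ x ∂vol g, (sec A x).IsSymmetric ∧
    Λ₁ • (1 : EndSpinor V) ≤ sec A x ∧ sec A x ≤ Λ₂ • (1 : EndSpinor V)}

variable {σ κ p}

/-- `S = A^{1/2}`: almost everywhere, `S x` is the positive square root of `A x`. -/
def IsSqrt (S A : σ.W1p κ p) : Prop :=
  ∀ᵐ x ∂vol g, (sec S x).IsPositive ∧ sec S x * sec S x = sec A x

/-- `Q = S⁻¹`: almost everywhere, `Q x` is the inverse of `S x`. -/
def IsInv (Q S : σ.W1p κ p) : Prop :=
  ∀ᵐ x ∂vol g, sec Q x * sec S x = 1 ∧ sec S x * sec Q x = 1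

end SpinStructure

end

end SpinGeom

/-! For `p > n`, Morrey's inequality embeds `W^{1,p}` into `L^∞`, and the Leibniz rule then makes
`W^{1,p}` a Banach space closed under a continuous pointwise product. The square root is obtained
from a power series in this algebra rather than fibre by fibre, so that Sobolev regularity and `C¹`
dependence on `t` come together.

Write `A = Λ₂ (1 + b)`. Pointwise `‖b‖ ≤ q := 1 - Λ₁/Λ₂ < 1`, but the `W^{1,p}` norm of `b` may be
large. Multiplication by `b`, an operator `T` on `W^{1,p}`, nevertheless satisfies `‖Tu‖_∞ ≤ q
‖u‖_∞` and `‖Tu‖ ≤ q ‖u‖ + K ‖u‖_∞`: the derivative that falls on `b` costs only the sup norm of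
`u`. Hence `T` is a contraction for the equivalent norm `max(‖u‖_∞, δ ‖u‖)` with small `δ`, and the
binomial series `(1 + T)^a` converges and is analytic near `T` (`contDiffAt_binom_of_contraction`).
Applied to `A` itself it gives `S = Λ₂^{-1/2} (1 + T)^{-1/2} A` and `Q = Λ₂^{-3/2} (1 + T)^{-3/2}
A`. These are `C¹` in `t` by the chain rule, and `ae_binom` and `sqrt_binom_properties` identify
them pointwise with `A^{1/2}` and `A^{-1/2}`.

Differentiating `S S = A` gives the Sylvester equation. Its solution is unique: if `S Y = -Y S`,
then `Y` commutes with `S² = A`, hence with the series `S`, so `2 S Y = 0` and `Y = 0`.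
Differentiating `Q A = S` gives the formula for the derivative of `Q`.

The analytic input is the Leibniz rule for bounded weakly differentiable functions
(`HasWeakDeriv.mul`, by mollification), Morrey's inequality (`exists_morrey_bound`,
`exists_norm_sec_le`) and completeness of `W^{1,p}` (`isClosed_W1p`). -/

namespace SpinGeom

/-! ### Weak derivatives and the Leibniz rule by mollification. -/

section WeakDerivative

open Convolution

variable {n : ℕ} {X : Type*} [NormedAddCommGroup X] [NormedSpace ℝ X]

/-- The function `u'` is the weak derivative of `u` in the direction `v` on the open set `Ω`. -/
structure HasWeakDeriv (Ω : Set (E n)) (v : E n) (u u' : E n → X) : Prop where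
  locallyIntegrableOn : LocallyIntegrableOn u Ω
  locallyIntegrableOn_deriv : LocallyIntegrableOn u' Ω
  integral_eq : ∀ η : E n → ℝ, ContDiff ℝ ∞ η → HasCompactSupport η → tsupport η ⊆ Ω →
    ∫ y in Ω, fderiv ℝ η y v • u y = -∫ y in Ω, η y • u' y

theorem integrable_bdd_smul {c : E n → ℝ} (hc : Continuous c) {C : ℝ} (hC : ∀ z, ‖c z‖ ≤ C)
    {f : E n → X} (hf : Integrable f) : Integrable fun x => c x • f x :=
  hf.bdd_smul C hc.aestronglyMeasurable (Eventually.of_forall hC)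

variable {𝔸 : Type*} [NormedRing 𝔸] [NormedAlgebra ℝ 𝔸]

/-- Moving a convolution kernel from one factor of an integral to the other. -/
theorem integral_convolution_mul_comm [CompleteSpace 𝔸] {c : E n → ℝ} (hc : Continuous c) {C : ℝ}
    (hC : ∀ z, ‖c z‖ ≤ C) {f h : E n → 𝔸} (hf : Integrable f) (hh : Integrable h) :
    ∫ y, (∫ x, c (x - y) • f x) * h y = ∫ x, f x * ∫ y, c (x - y) • h y := by
  have hint : Integrable (fun z : E n × E n => c (z.1 - z.2) • (f z.1 * h z.2))
      (volume.prod volume) := by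
    refine (hf.mul_prod hh).bdd_smul C ?_ (Eventually.of_forall fun z => hC _)
    exact (hc.comp (continuous_fst.sub continuous_snd)).aestronglyMeasurable
  have e1 : ∀ y, (∫ x, c (x - y) • f x) * h y = ∫ x, c (x - y) • (f x * h y) := by
    intro y
    rw [← integral_mul_const_of_integrable
      (integrable_bdd_smul (c := fun x => c (x - y)) (by fun_prop) (fun z => hC _) hf)]
    simp only [smul_mul_assoc]
  have e2 : ∀ x, f x * (∫ y, c (x - y) • h y) = ∫ y, c (x - y) • (f x * h y) := by
    intro x
    rw [← integral_const_mul_of_integrable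
      (integrable_bdd_smul (c := fun y => c (x - y)) (by fun_prop) (fun z => hC _) hh)]
    simp only [mul_smul_comm]
  simp_rw [e1, e2]
  exact (integral_integral_swap hint).symm

/-- Averaging against a probability density cannot increase an essential bound. This is the
domination, uniform in the mollifier, used in the limits below. -/
theorem norm_convolution_normed_le (φ : ContDiffBump (0 : E n)) {g : E n → X} {C : ℝ}
    (hC : ∀ᵐ y, ‖g y‖ ≤ C) (x : E n) : ‖∫ y, φ.normed volume (x - y) • g y‖ ≤ C := by
  have hi : Integrable fun y => φ.normed volume (x - y) :=
    φ.integrable_normed.comp_sub_left x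
  calc ‖∫ y, φ.normed volume (x - y) • g y‖
      ≤ ∫ y, φ.normed volume (x - y) * C := by
        refine norm_integral_le_of_norm_le (hi.mul_const C) ?_
        filter_upwards [hC] with y hy
        rw [norm_smul, Real.norm_of_nonneg (φ.nonneg_normed _)]
        exact mul_le_mul_of_nonneg_left hy (φ.nonneg_normed _)
    _ = C := by
        rw [integral_mul_const, integral_sub_left_eq_self (φ.normed volume) volume x,
          φ.integral_normed, one_mul]

/-- A sequence of bump functions with radii tending to zero. -/
noncomputable def shrinkingBump (n : ℕ) (d : ℝ) (hd : 0 < d) (j : ℕ) : ContDiffBump (0 : E n) where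
  rIn := d / (2 * (j + 1))
  rOut := d / (j + 1)
  rIn_pos := by positivity
  rIn_lt_rOut := by
    have : (0 : ℝ) < j + 1 := by positivity
    exact div_lt_div_of_pos_left hd this (by linarith)

theorem shrinkingBump_rOut_le (n : ℕ) {d : ℝ} (hd : 0 < d) (j : ℕ) :
    (shrinkingBump n d hd j).rOut ≤ d :=
  div_le_self hd.le (by simp)

theorem ae_tendsto_convolution_shrinkingBump [CompleteSpace X] {d : ℝ} (hd : 0 < d) {g : E n → X}
    (hg : Integrable g) : ∀ᵐ x, Tendsto (fun j : ℕ =>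
      ∫ y, (shrinkingBump n d hd j).normed volume (x - y) • g y) atTop (𝓝 (g x)) := by
  have h := ContDiffBump.ae_convolution_tendsto_right_of_locallyIntegrable (μ := volume)
    (φ := shrinkingBump n d hd) (l := atTop) (K := 2) (g := g) ?_ ?_ hg.locallyIntegrable
  · simpa only [convolution_eq_swap, ContinuousLinearMap.lsmul_apply] using h
  · have := tendsto_one_div_add_atTop_nhds_zero_nat (𝕜 := ℝ)
    have h2 := this.const_mul d
    simpa [shrinkingBump, div_eq_mul_inv] using h2
  -- The ratio `rOut / rIn` is constantly 2, which is the comparability of radii required for almost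
  -- everywhere convergence.
  · refine Eventually.of_forall fun j => le_of_eq ?_
    simp only [shrinkingBump]
    field_simp

theorem aestronglyMeasurable_convolution_normed (φ : ContDiffBump (0 : E n)) {g : E n → X}
    (hg : Integrable g) :
    AEStronglyMeasurable (fun x => ∫ y, φ.normed volume (x - y) • g y) volume := by
  have h := (φ.hasCompactSupport_normed (μ := volume)).continuous_convolution_left
    (ContinuousLinearMap.lsmul ℝ ℝ) (φ.continuous_normed (μ := volume)) hg.locallyIntegrable
  refine (h.aestronglyMeasurable (μ := volume)).congr (Eventually.of_forall fun x => ?_)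
  simp only [convolution_eq_swap, ContinuousLinearMap.lsmul_apply]

/-- Dominated convergence: the mollifications of `g` converge almost everywhere and inherit its
bound. As `𝔸` need not be commutative, the mirror image is needed too. -/
theorem tendsto_integral_mul_convolution [CompleteSpace 𝔸] {d : ℝ} (hd : 0 < d) {f g : E n → 𝔸}
    (hf : Integrable f) (hg : Integrable g) {C : ℝ} (hC : ∀ᵐ y, ‖g y‖ ≤ C) :
    Tendsto (fun j : ℕ => ∫ x, f x * ∫ y, (shrinkingBump n d hd j).normed volume (x - y) • g y)
      atTop (𝓝 (∫ x, f x * g x)) := by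
  refine tendsto_integral_of_dominated_convergence (fun x => ‖f x‖ * C)
    (fun j => hf.aestronglyMeasurable.mul (aestronglyMeasurable_convolution_normed _ hg))
    (hf.norm.mul_const C) (fun j => Eventually.of_forall fun x => ?_) ?_
  · exact (norm_mul_le _ _).trans
      (mul_le_mul_of_nonneg_left (norm_convolution_normed_le _ hC x) (norm_nonneg _))
  · filter_upwards [ae_tendsto_convolution_shrinkingBump hd hg] with x hx
    exact hx.const_mul _

theorem tendsto_integral_convolution_mul [CompleteSpace 𝔸] {d : ℝ} (hd : 0 < d) {f g : E n → 𝔸}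
    (hf : Integrable f) (hg : Integrable g) {C : ℝ} (hC : ∀ᵐ y, ‖g y‖ ≤ C) :
    Tendsto (fun j : ℕ => ∫ x, (∫ y, (shrinkingBump n d hd j).normed volume (x - y) • g y) * f x)
      atTop (𝓝 (∫ x, g x * f x)) := by
  refine tendsto_integral_of_dominated_convergence (fun x => C * ‖f x‖)
    (fun j => (aestronglyMeasurable_convolution_normed _ hg).mul hf.aestronglyMeasurable)
    (hf.norm.const_mul C) (fun j => Eventually.of_forall fun x => ?_) ?_
  · exact (norm_mul_le _ _).trans
      (mul_le_mul_of_nonneg_right (norm_convolution_normed_le _ hC x) (norm_nonneg _))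
  · filter_upwards [ae_tendsto_convolution_shrinkingBump hd hg] with x hx
    exact hx.mul_const _

theorem setIntegral_smul_eq_integral_indicator {Ω K : Set (E n)} (hK : K ⊆ Ω) {ζ : E n → ℝ}
    (hζ : tsupport ζ ⊆ K) (u : E n → X) :
    ∫ y in Ω, ζ y • u y = ∫ y, ζ y • K.indicator u y := by
  have h0 : ∀ y, y ∉ K → ζ y = 0 := fun y hy => image_eq_zero_of_notMem_tsupport fun h => hy (hζ h)
  rw [setIntegral_eq_integral_of_forall_compl_eq_zero fun y hy => by
    rw [h0 y fun h => hy (hK h), zero_smul]]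
  refine integral_congr_ae (Eventually.of_forall fun y => ?_)
  by_cases hy : y ∈ K
  · simp [indicator_of_mem hy]
  · simp [h0 y hy]

/-- Cutting off by a compact `K` turns locally integrable functions into integrable ones on all of
`ℝⁿ`, and test functions supported in `K` do not notice the cut. -/
theorem HasWeakDeriv.integral_indicator_eq {Ω K : Set (E n)} {v : E n} {u u' : E n → X}
    (h : HasWeakDeriv Ω v u u') (hK : K ⊆ Ω) {ζ : E n → ℝ} (hζ : ContDiff ℝ ∞ ζ)
    (hc : HasCompactSupport ζ) (hs : tsupport ζ ⊆ K) :
    ∫ y, fderiv ℝ ζ y v • K.indicator u y = -∫ y, ζ y • K.indicator u' y := by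
  rw [← setIntegral_smul_eq_integral_indicator hK ((tsupport_fderiv_apply_subset ℝ v).trans hs),
    ← setIntegral_smul_eq_integral_indicator hK hs]
  exact h.integral_eq ζ hζ hc (hs.trans hK)

/-- The Leibniz identity before the mollifier `k` is removed. `U` is tested with `x ↦ η(x) k(x - y)`
and `W` with `y ↦ k(x - y)`. Integrating each relation over the remaining variable and using Fubini
eliminates the terms that contain the derivative of `k`. -/
theorem integral_fderiv_smul_mul_mollified [CompleteSpace 𝔸] {v : E n} {K : Set (E n)} {d : ℝ}
    {U U' W W' : E n → 𝔸} (iU : Integrable U) (iU' : Integrable U') (iW : Integrable W)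
    (iW' : Integrable W')
    (hU : ∀ ζ : E n → ℝ, ContDiff ℝ ∞ ζ → HasCompactSupport ζ → tsupport ζ ⊆ Metric.cthickening d K →
      ∫ y, fderiv ℝ ζ y v • U y = -∫ y, ζ y • U' y)
    (hW : ∀ ζ : E n → ℝ, ContDiff ℝ ∞ ζ → HasCompactSupport ζ → tsupport ζ ⊆ Metric.cthickening d K →
      ∫ y, fderiv ℝ ζ y v • W y = -∫ y, ζ y • W' y)
    {η : E n → ℝ} (hη : ContDiff ℝ ∞ η) (hc : HasCompactSupport η) (hs : tsupport η ⊆ K)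
    (φ : ContDiffBump (0 : E n)) (hφ : φ.rOut ≤ d) :
    (∫ x, (fderiv ℝ η x v • U x) * ∫ y, φ.normed volume (x - y) • W y) =
      -((∫ x, (η x • U' x) * ∫ y, φ.normed volume (x - y) • W y) +
        ∫ x, (∫ y, φ.normed volume (x - y) • (η y • U y)) * W' x) := by
  set k : E n → ℝ := φ.normed volume with hk
  have hks : ContDiff ℝ ∞ k := φ.contDiff_normed
  have hkc : HasCompactSupport k := φ.hasCompactSupport_normed
  have hkn : ∀ x y, k (x - y) = k (y - x) := fun x y => by
    rw [← neg_sub, hk, φ.normed_neg]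
  set dk : E n → ℝ := fun z => fderiv ℝ k z v with hdk
  have hdkc : Continuous dk := (hks.continuous_fderiv (by simp)).clm_apply continuous_const
  have hdηc : Continuous fun z => fderiv ℝ η z v :=
    (hη.continuous_fderiv (by simp)).clm_apply continuous_const
  obtain ⟨C0, hC0⟩ := hkc.exists_bound_of_continuous hks.continuous
  obtain ⟨C1, hC1⟩ := (hkc.fderiv_apply (𝕜 := ℝ) v).exists_bound_of_continuous hdkc
  obtain ⟨D0, hD0⟩ := hc.exists_bound_of_continuous hη.continuous
  obtain ⟨D1, hD1⟩ := (hc.fderiv_apply (𝕜 := ℝ) v).exists_bound_of_continuous hdηc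
  have i1 : Integrable fun x => fderiv ℝ η x v • U x := integrable_bdd_smul hdηc hD1 iU
  have i2 : Integrable fun x => η x • U x := integrable_bdd_smul hη.continuous hD0 iU
  have i3 : Integrable fun x => η x • U' x := integrable_bdd_smul hη.continuous hD0 iU'
  have hdη : ∀ x, HasFDerivAt η (fderiv ℝ η x) x := fun x =>
    ((hη.differentiable (by simp)) x).hasFDerivAt
  have hdkd : ∀ x, HasFDerivAt k (fderiv ℝ k x) x := fun x =>
    ((hks.differentiable (by simp)) x).hasFDerivAt
  -- The weak derivative of `U`, tested with `η(x) k(x - y)` for fixed `y`.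
  have hx1 : ∀ y, (∫ x, k (x - y) • (fderiv ℝ η x v • U x)) + (∫ x, dk (x - y) • (η x • U x)) =
      -∫ x, k (x - y) • (η x • U' x) := by
    intro y
    have hsub : tsupport (fun x => η x * k (x - y)) ⊆ tsupport η := tsupport_mul_subset_left
    have h := hU (fun x => η x * k (x - y)) (hη.mul (hks.comp (contDiff_id.sub contDiff_const)))
      (hc.mul_right) (hsub.trans (hs.trans (Metric.self_subset_cthickening K)))
    rw [← integral_add
      (integrable_bdd_smul (c := fun x => k (x - y)) (by fun_prop) (fun z => hC0 _) i1)
      (integrable_bdd_smul (c := fun x => dk (x - y)) (by fun_prop) (fun z => hC1 _) i2)]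
    have e1 : ∀ x, fderiv ℝ (fun x => η x * k (x - y)) x v =
        k (x - y) * fderiv ℝ η x v + dk (x - y) * η x := by
      intro x
      have hd := (hdη x).mul ((hdkd (x - y)).comp x ((hasFDerivAt_id x).sub_const y))
      have e : fderiv ℝ (fun x => η x * k (x - y)) x = _ := hd.fderiv
      rw [e]
      simp [hdk]
      ring
    simp_rw [e1] at h
    simp_rw [smul_smul, ← add_smul, h]
    simp_rw [mul_comm]
  -- The weak derivative of `W`, tested with `k(x - y)` for fixed `x`. The factor `η x` restricts to
  -- `x ∈ K`, where the support of this test function stays within distance `d` of `K`.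
  have hy1 : ∀ x, (η x • U x) * (∫ y, dk (x - y) • W y) =
      (η x • U x) * ∫ y, k (x - y) • W' y := by
    intro x
    by_cases hx : x ∈ K
    swap
    · rw [image_eq_zero_of_notMem_tsupport (fun h => hx (hs h))]
      simp
    congr 1
    have hts : tsupport (fun y => k (x - y)) ⊆ Metric.closedBall x φ.rOut := by
      refine closure_minimal (fun y hy => ?_) Metric.isClosed_closedBall
      have : x - y ∈ Function.support k := hy
      rw [hk, φ.support_normed_eq] at this
      rw [mem_ball_zero_iff] at this
      rw [Metric.mem_closedBall, dist_comm, dist_eq_norm]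
      exact this.le
    have h := hW (fun y => k (x - y)) (hks.comp (contDiff_const.sub contDiff_id))
      (HasCompactSupport.of_support_subset_isCompact (isCompact_closedBall x φ.rOut)
        ((subset_tsupport _).trans hts))
      (hts.trans ((Metric.closedBall_subset_closedBall hφ).trans
        (Metric.closedBall_subset_cthickening hx d)))
    have e1 : ∀ y, fderiv ℝ (fun y => k (x - y)) y v = - dk (x - y) := by
      intro y
      have hd := (hdkd (x - y)).comp y ((hasFDerivAt_id y).const_sub x)
      have e : fderiv ℝ (fun y => k (x - y)) y = _ := hd.fderiv
      rw [e]
      simp [hdk]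
    simp_rw [e1, neg_smul, integral_neg] at h
    exact neg_inj.1 h
  have F1 := integral_convolution_mul_comm hks.continuous hC0 i1 iW
  have F2 := integral_convolution_mul_comm hdkc hC1 i2 iW
  have F3 := integral_convolution_mul_comm hks.continuous hC0 i3 iW
  have F4 := integral_convolution_mul_comm hks.continuous hC0 i2 iW'
  have hconvint : ∀ {c : E n → ℝ} (_ : Continuous c) (_ : HasCompactSupport c) {C : ℝ}
      (_ : ∀ z, ‖c z‖ ≤ C) {f : E n → 𝔸} (_ : Integrable f),
      Integrable fun y => (∫ x, c (x - y) • f x) * W y := by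
    intro c hcc hcs C hC f hf
    have hint : Integrable (fun z : E n × E n => c (z.1 - z.2) • (f z.1 * W z.2))
        (volume.prod volume) := by
      refine (hf.mul_prod iW).bdd_smul C ?_ (Eventually.of_forall fun z => hC _)
      exact (hcc.comp (continuous_fst.sub continuous_snd)).aestronglyMeasurable
    refine hint.integral_prod_right.congr (Eventually.of_forall fun y => ?_)
    dsimp only
    rw [← integral_mul_const_of_integrable
      (integrable_bdd_smul (c := fun x => c (x - y)) (by fun_prop) (fun z => hC _) hf)]
    simp only [smul_mul_assoc]
  have key : (∫ y, (∫ x, k (x - y) • (fderiv ℝ η x v • U x)) * W y) +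
      (∫ y, (∫ x, dk (x - y) • (η x • U x)) * W y) =
      -∫ y, (∫ x, k (x - y) • (η x • U' x)) * W y := by
    rw [← integral_add (hconvint hks.continuous hkc hC0 i1)
      (hconvint hdkc (hkc.fderiv_apply (𝕜 := ℝ) v) hC1 i2), ← integral_neg]
    refine integral_congr_ae (Eventually.of_forall fun y => ?_)
    dsimp only
    rw [← add_mul, hx1 y, neg_mul]
  rw [F1, F2, F3] at key
  simp_rw [hy1] at key
  rw [← F4] at key
  -- The kernel is even, so moving it from `W'` to `η U` again produces a mollification.
  have hsymm : ∀ y, (∫ x, k (x - y) • (η x • U x)) = ∫ x, k (y - x) • (η x • U x) := by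
    intro y
    simp_rw [hkn _ y]
  simp_rw [hsymm] at key
  rw [eq_sub_of_add_eq key]
  abel

/-- Leibniz rule for weak derivatives of bounded functions. -/
theorem HasWeakDeriv.mul [CompleteSpace 𝔸] {Ω : Set (E n)} (hΩ : IsOpen Ω) {v : E n}
    {u u' w w' : E n → 𝔸} (hu : HasWeakDeriv Ω v u u') (hw : HasWeakDeriv Ω v w w') {C : ℝ}
    (hC : ∀ᵐ y ∂volume.restrict Ω, ‖u y‖ ≤ C) {D : ℝ} (hD : ∀ᵐ y ∂volume.restrict Ω, ‖w y‖ ≤ D) :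
    HasWeakDeriv Ω v (fun y => u y * w y) (fun y => u' y * w y + u y * w' y) := by
  have hr : ∀ {f g : E n → 𝔸} {B : ℝ}, LocallyIntegrableOn f Ω → LocallyIntegrableOn g Ω →
      (∀ᵐ y ∂volume.restrict Ω, ‖g y‖ ≤ B) →
      LocallyIntegrableOn (fun y => f y * g y) Ω ∧ LocallyIntegrableOn (fun y => g y * f y) Ω := by
    intro f g B hf hg hB
    have aux : ∀ K ⊆ Ω, IsCompact K → IntegrableOn (fun y => f y * g y) K ∧
        IntegrableOn (fun y => g y * f y) K := by
      intro K hK hKc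
      have hgK := hg.integrableOn_compact_subset hK hKc
      have hfK := hf.integrableOn_compact_subset hK hKc
      have hBK := ae_restrict_of_ae_restrict_of_subset hK hB
      exact ⟨Integrable.mul_bdd (c := B) hfK hgK.aestronglyMeasurable hBK,
        Integrable.bdd_mul (c := B) hfK hgK.aestronglyMeasurable hBK⟩
    exact ⟨(locallyIntegrableOn_iff hΩ.isLocallyClosed).2 fun K hK hKc => (aux K hK hKc).1,
      (locallyIntegrableOn_iff hΩ.isLocallyClosed).2 fun K hK hKc => (aux K hK hKc).2⟩
  refine ⟨(hr hu.1 hw.1 hD).1, (hr hu.2 hw.1 hD).1.add (hr hw.2 hu.1 hC).2, fun η hη hc hs => ?_⟩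
  -- A margin `d` around the support of `η`, so that mollifiers of radius at most `d` see only
  -- values inside `Ω`.
  obtain ⟨d, hd, hdΩ⟩ := hc.isCompact.exists_cthickening_subset_open hΩ hs
  set K : Set (E n) := Metric.cthickening d (tsupport η) with hKdef
  have hKc : IsCompact K := hc.isCompact.cthickening
  have hKm : MeasurableSet K := hKc.measurableSet
  have hηK : tsupport η ⊆ K := Metric.self_subset_cthickening _
  have hi : ∀ {f : E n → 𝔸}, LocallyIntegrableOn f Ω → Integrable (K.indicator f) := fun hf =>
    (hf.integrableOn_compact_subset hdΩ hKc).integrable_indicator hKm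
  have hb : ∀ {f : E n → 𝔸} {B : ℝ}, (∀ᵐ y ∂volume.restrict Ω, ‖f y‖ ≤ B) →
      ∀ᵐ y, ‖K.indicator f y‖ ≤ max B 0 := by
    intro f B hB
    have := (ae_restrict_iff' hKm).1 (ae_restrict_of_ae_restrict_of_subset hdΩ hB)
    filter_upwards [this] with y hy
    by_cases h : y ∈ K
    · rw [indicator_of_mem h]
      exact (hy h).trans (le_max_left _ _)
    · simp [indicator_of_notMem h]
  have hUb := hb hC
  have hWb := hb hD
  have hηc : Continuous η := hη.continuous
  have hdηc : Continuous fun z => fderiv ℝ η z v :=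
    (hη.continuous_fderiv (by simp)).clm_apply continuous_const
  obtain ⟨D0, hD0⟩ := hc.exists_bound_of_continuous hηc
  obtain ⟨D1, hD1⟩ := (hc.fderiv_apply (𝕜 := ℝ) v).exists_bound_of_continuous hdηc
  set U := K.indicator u
  set U' := K.indicator u'
  set W := K.indicator w
  set W' := K.indicator w'
  have hηU : ∀ᵐ y, ‖η y • U y‖ ≤ D0 * max C 0 := by
    filter_upwards [hUb] with y hy
    rw [norm_smul]
    exact mul_le_mul (hD0 y) hy (norm_nonneg _) ((norm_nonneg _).trans (hD0 y))
  have L1 := tendsto_integral_mul_convolution hd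
    (integrable_bdd_smul hdηc hD1 (hi hu.1)) (hi hw.1) hWb
  have L2 := tendsto_integral_mul_convolution hd
    (integrable_bdd_smul hηc hD0 (hi hu.2)) (hi hw.1) hWb
  have L3 := tendsto_integral_convolution_mul hd (hi hw.2)
    (integrable_bdd_smul hηc hD0 (hi hu.1)) hηU
  -- Both sides of the mollified identity converge; in the last term it is the bounded function `η
  -- U` that is mollified, against the integrable `W'`.
  have hlim := tendsto_nhds_unique L1 (((L2.add L3).neg).congr fun j =>
    (integral_fderiv_smul_mul_mollified (hi hu.1) (hi hu.2) (hi hw.1) (hi hw.2)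
      (fun ζ h1 h2 h3 => hu.integral_indicator_eq hdΩ h1 h2 h3)
      (fun ζ h1 h2 h3 => hw.integral_indicator_eq hdΩ h1 h2 h3) hη hc subset_rfl
      (shrinkingBump n d hd j) (shrinkingBump_rOut_le n hd j)).symm)
  rw [setIntegral_smul_eq_integral_indicator hdΩ ((tsupport_fderiv_apply_subset ℝ v).trans hηK),
    setIntegral_smul_eq_integral_indicator hdΩ hηK]
  have ind : ∀ (f g : E n → 𝔸) y, K.indicator (fun y => f y * g y) y =
      K.indicator f y * K.indicator g y := fun f g y => by
    by_cases h : y ∈ K <;> simp [h]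
  have e1 : ∀ y, fderiv ℝ η y v • K.indicator (fun y => u y * w y) y =
      (fderiv ℝ η y v • U y) * W y := fun y => by rw [ind, smul_mul_assoc]
  have e2 : ∀ y, η y • K.indicator (fun y => u' y * w y + u y * w' y) y =
      (η y • U' y) * W y + (η y • U y) * W' y := fun y => by
    rw [smul_mul_assoc, smul_mul_assoc, ← smul_add, ← ind, ← ind]
    exact congrArg _ (congrFun (Set.indicator_add K _ _) y)
  simp_rw [e1, e2]
  rw [hlim, integral_add]
  · exact Integrable.mul_bdd (c := max D 0) (integrable_bdd_smul hηc hD0 (hi hu.2))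
      (hi hw.1).aestronglyMeasurable hWb
  · exact Integrable.bdd_mul (c := D0 * max C 0) (hi hw.2)
      (integrable_bdd_smul hηc hD0 (hi hu.1)).aestronglyMeasurable hηU

end WeakDerivative

end SpinGeom

/-! ### Morrey's inequality in Euclidean space. -/

namespace SpinGeom

section Morrey

variable {n : ℕ} {X : Type*} [NormedAddCommGroup X]

/-- Hölder's inequality on a set of finite measure. -/
theorem setIntegral_norm_le_of_eLpNorm_le {p : ℝ≥0∞} (hp : 1 ≤ p) {s : Set (E n)}
    (hs : volume s ≠ ⊤) {f : E n → X} (hf : AEStronglyMeasurable f (volume.restrict s)) {B : ℝ}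
    (hB : 0 ≤ B) (h : eLpNorm f p (volume.restrict s) ≤ ENNReal.ofReal B) :
    ∫ y in s, ‖f y‖ ≤ B * (volume.real s) ^ (1 - 1 / p.toReal) := by
  have hexp : 0 ≤ 1 - 1 / p.toReal := by
    rcases eq_or_ne p ⊤ with rfl | hpt
    · simp
    · have h1 : 1 ≤ p.toReal := by
        simpa using ENNReal.toReal_mono hpt hp
      rw [sub_nonneg]
      exact (div_le_one (by linarith)).2 h1
  have h1 := eLpNorm_le_eLpNorm_mul_rpow_measure_univ hp hf
  rw [eLpNorm_one_eq_lintegral_enorm, Measure.restrict_apply_univ, ENNReal.toReal_one, div_one] at h1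
  have h2 : ∫⁻ y in s, ‖f y‖ₑ ≤ ENNReal.ofReal (B * (volume.real s) ^ (1 - 1 / p.toReal)) := by
    refine h1.trans ?_
    rw [ENNReal.ofReal_mul hB, ← ENNReal.ofReal_rpow_of_nonneg measureReal_nonneg hexp,
      ofReal_measureReal hs]
    gcongr
  rw [integral_norm_eq_lintegral_enorm hf]
  exact ENNReal.toReal_le_of_le_ofReal (by positivity) h2

variable [NormedSpace ℝ X]

/-- The `L¹`-normalized dilation by `r` of a function on `ℝⁿ`. -/
noncomputable def dilate (ρ : E n → ℝ) (r : ℝ) (z : E n) : ℝ := (r⁻¹) ^ n * ρ (r⁻¹ • z)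

/-- Here `nρ + w·∇ρ` is the divergence of `w ρ(w)`. The derivative of the kernel in the scale is
therefore a spatial divergence, which can be integrated by parts against `u`. -/
theorem hasDerivAt_dilate {ρ : E n → ℝ} (hρ : ContDiff ℝ ∞ ρ) {r : ℝ} (hr : r ≠ 0) (z : E n) :
    HasDerivAt (fun r => dilate ρ r z)
      (-(r⁻¹ * dilate (fun w => n * ρ w + fderiv ℝ ρ w w) r z)) r := by
  have h1 : HasDerivAt (fun r : ℝ => r⁻¹) (-(r ^ 2)⁻¹) r := hasDerivAt_inv hr
  have h2 : HasDerivAt (fun r : ℝ => ρ (r⁻¹ • z)) (fderiv ℝ ρ (r⁻¹ • z) (-(r ^ 2)⁻¹ • z)) r :=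
    ((hρ.differentiable (by simp)) (r⁻¹ • z)).hasFDerivAt.comp_hasDerivAt r (h1.smul_const z)
  refine ((h1.pow n).mul h2).congr_deriv ?_
  simp only [dilate, map_smul, smul_eq_mul]
  -- The power rule produces the exponent `n - 1`, truncated when `n = 0`.
  rcases n with _ | m
  · simp
    field_simp
  · push_cast
    simp only [Pi.pow_apply, inv_pow]
    field_simp
    ring

theorem fderiv_dilate {ρ : E n → ℝ} (hρ : ContDiff ℝ ∞ ρ) (r : ℝ) (z v : E n) :
    fderiv ℝ (dilate ρ r) z v = r⁻¹ * dilate (fun w => fderiv ℝ ρ w v) r z := by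
  have h2 : HasFDerivAt (fun z : E n => ρ (r⁻¹ • z))
      ((fderiv ℝ ρ (r⁻¹ • z)).comp (r⁻¹ • ContinuousLinearMap.id ℝ (E n))) z :=
    ((hρ.differentiable (by simp)) (r⁻¹ • z)).hasFDerivAt.comp z
      ((hasFDerivAt_id z).const_smul r⁻¹)
  have h3 : HasFDerivAt (dilate ρ r) _ z := h2.const_mul ((r⁻¹) ^ n)
  rw [h3.fderiv]
  simp [dilate]
  ring

theorem contDiff_dilate {ρ : E n → ℝ} (hρ : ContDiff ℝ ∞ ρ) (r : ℝ) :
    ContDiff ℝ ∞ (dilate ρ r) :=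
  contDiff_const.mul (hρ.comp (contDiff_const_smul r⁻¹))

theorem dilate_eq_zero {ρ : E n → ℝ} (hρ : ∀ w, 1 < ‖w‖ → ρ w = 0) {r : ℝ} (hr : 0 < r) {z : E n}
    (hz : r < ‖z‖) : dilate ρ r z = 0 := by
  rw [dilate, hρ, mul_zero]
  rw [norm_smul, norm_inv, Real.norm_of_nonneg hr.le, ← div_eq_inv_mul]
  exact (one_lt_div hr).2 hz

theorem norm_dilate_le {ρ : E n → ℝ} {C : ℝ} (hC : ∀ w, ‖ρ w‖ ≤ C) {r : ℝ} (hr : 0 < r)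
    (z : E n) : ‖dilate ρ r z‖ ≤ (r⁻¹) ^ n * C := by
  rw [dilate, norm_mul, Real.norm_of_nonneg (by positivity)]
  exact mul_le_mul_of_nonneg_left (hC _) (by positivity)

theorem integral_dilate (ρ : E n → ℝ) {r : ℝ} (hr : 0 < r) :
    ∫ z, dilate ρ r z = ∫ z, ρ z := by
  simp only [dilate]
  rw [integral_const_mul, Measure.integral_comp_inv_smul_of_nonneg volume ρ hr.le,
    finrank_euclideanSpace_fin, smul_eq_mul, ← mul_assoc, ← mul_pow, inv_mul_cancel₀ hr.ne',
    one_pow, one_mul]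

/-- Lebesgue differentiation: the kernel lives on a ball of radius `r` and is at most a constant
over the volume of that ball. -/
theorem ae_tendsto_integral_dilate [CompleteSpace X] {ρ : E n → ℝ} {C : ℝ} (hC : ∀ w, ‖ρ w‖ ≤ C)
    (hρ : ∀ w, 1 < ‖w‖ → ρ w = 0) (hint : ∫ z, ρ z = 1) {f : E n → X} (hf : Integrable f) :
    ∀ᵐ x, Tendsto (fun r => ∫ y, dilate ρ r (y - x) • f y) (𝓝[>] 0) (𝓝 (f x)) := by
  filter_upwards [(Besicovitch.vitaliFamily volume).ae_tendsto_average_norm_sub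
    hf.locallyIntegrable] with x hx
  have h := hx.comp (Besicovitch.tendsto_filterAt volume x)
  refine tendsto_integral_smul_of_tendsto_average_norm_sub
    (C * volume.real (Metric.ball (0 : E n) 1)) h
    (Eventually.of_forall fun r => hf.integrableOn) ?_ ?_ ?_
  · refine tendsto_const_nhds.congr' ?_
    filter_upwards [self_mem_nhdsWithin] with r hr
    rw [integral_sub_right_eq_self (dilate ρ r), integral_dilate ρ hr, hint]
  · filter_upwards [self_mem_nhdsWithin] with r hr y hy
    by_contra hlt
    rw [Metric.mem_closedBall, dist_eq_norm, not_le] at hlt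
    exact hy (dilate_eq_zero hρ hr hlt)
  · filter_upwards [self_mem_nhdsWithin] with r hr y
    rw [mem_Ioi] at hr
    refine (norm_dilate_le hC hr _).trans (le_of_eq ?_)
    rw [Measure.addHaar_real_closedBall volume x hr.le, finrank_euclideanSpace_fin]
    have hb : volume.real (Metric.ball (0 : E n) 1) ≠ 0 :=
      (ENNReal.toReal_pos (Metric.measure_ball_pos volume _ one_pos).ne'
        measure_ball_lt_top.ne).ne'
    rw [inv_pow]
    field_simp

/-- Hölder on the ball of radius `r`: the factor `r^{-n}` of the kernel times `(r^n)^{1 - 1/p}`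
leaves `r^{-n/p}`, integrable at 0 exactly when `p > n`. -/
theorem norm_integral_dilate_smul_le {p : ℝ≥0∞} (hp : 1 ≤ p) {ρ : E n → ℝ} {C : ℝ}
    (hC : ∀ w, ‖ρ w‖ ≤ C) (hρ : ∀ w, 1 < ‖w‖ → ρ w = 0) {r : ℝ} (hr : 0 < r) {x : E n}
    {f : E n → X} (hf : Integrable f) {B : ℝ} (hB : 0 ≤ B)
    (h : eLpNorm f p volume ≤ ENNReal.ofReal B) :
    ‖∫ y, dilate ρ r (y - x) • f y‖ ≤
      C * volume.real (Metric.ball (0 : E n) 1) ^ (1 - 1 / p.toReal) * r ^ (-(n / p.toReal)) * B := by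
  have hC0 : 0 ≤ C := (norm_nonneg _).trans (hC 0)
  set s := Metric.closedBall x r with hs
  have h0 : ∀ y, y ∉ s → dilate ρ r (y - x) • f y = 0 := by
    intro y hy
    rw [hs, Metric.mem_closedBall, dist_eq_norm, not_le] at hy
    rw [dilate_eq_zero hρ hr hy, zero_smul]
  rw [← setIntegral_eq_integral_of_forall_compl_eq_zero h0]
  have h1 := setIntegral_norm_le_of_eLpNorm_le hp (s := s)
    measure_closedBall_lt_top.ne hf.aestronglyMeasurable.restrict hB
    ((eLpNorm_mono_measure f Measure.restrict_le_self).trans h)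
  calc ‖∫ y in s, dilate ρ r (y - x) • f y‖ ≤ ∫ y in s, (r⁻¹) ^ n * C * ‖f y‖ := by
        refine norm_integral_le_of_norm_le (hf.norm.integrableOn.const_mul _)
          (Eventually.of_forall fun y => ?_)
        rw [norm_smul]
        exact mul_le_mul_of_nonneg_right (norm_dilate_le hC hr _) (norm_nonneg _)
    _ = (r⁻¹) ^ n * C * ∫ y in s, ‖f y‖ := integral_const_mul _ _
    _ ≤ (r⁻¹) ^ n * C * (B * (volume.real s) ^ (1 - 1 / p.toReal)) := by gcongr
    _ = _ := by
        rw [hs, Measure.addHaar_real_closedBall volume x hr.le, finrank_euclideanSpace_fin,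
          Real.mul_rpow (by positivity) measureReal_nonneg, ← Real.rpow_natCast r n,
          ← Real.rpow_mul hr.le, ← Real.rpow_natCast r⁻¹ n, Real.inv_rpow hr.le,
          ← Real.rpow_neg hr.le]
        have : r ^ (-(n / p.toReal)) = r ^ (-(n : ℝ)) * r ^ ((n : ℝ) * (1 - 1 / p.toReal)) := by
          rw [← Real.rpow_add hr]
          congr 1
          ring
        rw [this]
        ring

/-- The integral of `u` against a dilated kernel has a derivative in terms of the weak derivatives
of `u`. -/
theorem hasDerivAt_integral_dilate_smul {Ω K : Set (E n)} (hKΩ : K ⊆ Ω) {u : E n → X}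
    {u' : Fin n → E n → X} (hu : ∀ a, HasWeakDeriv Ω (EuclideanSpace.single a 1) u (u' a))
    (hi : Integrable (K.indicator u)) {ρ : E n → ℝ} (hρ : ContDiff ℝ ∞ ρ)
    (hc : HasCompactSupport ρ) (h1 : ∀ w, 1 < ‖w‖ → ρ w = 0) {x : E n} {r : ℝ} (hr : 0 < r)
    (hx : Metric.closedBall x r ⊆ K) :
    HasDerivAt (fun r => ∫ y, dilate ρ r (y - x) • K.indicator u y)
      (∑ a, ∫ y, dilate (fun w => w a * ρ w) r (y - x) • K.indicator (u' a) y) r := by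
  set U := K.indicator u
  have hdρ : Continuous fun w => fderiv ℝ ρ w w :=
    (hρ.continuous_fderiv (by simp)).clm_apply continuous_id
  have hκ : Continuous fun w => n * ρ w + fderiv ℝ ρ w w := by
    have := hρ.continuous
    fun_prop
  have hκs : HasCompactSupport fun w => n * ρ w + fderiv ℝ ρ w w := by
    refine HasCompactSupport.of_support_subset_isCompact hc.isCompact fun w hw => ?_
    by_contra h
    apply hw
    have h2 : fderiv ℝ ρ w = 0 :=
      image_eq_zero_of_notMem_tsupport fun h' => h (tsupport_fderiv_subset ℝ h')
    simp [image_eq_zero_of_notMem_tsupport h, h2]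
  obtain ⟨D, hD⟩ := hκs.exists_bound_of_continuous hκ
  obtain ⟨C, hC⟩ := hc.exists_bound_of_continuous hρ.continuous
  have hD0 : 0 ≤ D := (norm_nonneg _).trans (hD 0)
  have hmeas : ∀ (θ : E n → ℝ), Continuous θ → ∀ r : ℝ,
      AEStronglyMeasurable (fun y => dilate θ r (y - x) • U y) volume := by
    intro θ hθ r
    have : Continuous fun y => dilate θ r (y - x) := by
      unfold dilate
      fun_prop
    exact this.aestronglyMeasurable.smul hi.aestronglyMeasurable
  -- Scales above `r / 2` give one dominating function for all the differentiated kernels.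
  have hnear : Ioi (r / 2) ∈ 𝓝 r := Ioi_mem_nhds (by linarith)
  have key := hasDerivAt_integral_of_dominated_loc_of_deriv_le (𝕜 := ℝ) (μ := (volume : Measure (E n)))
    (F := fun r y => dilate ρ r (y - x) • U y)
    (F' := fun r y => (-(r⁻¹ * dilate (fun w => n * ρ w + fderiv ℝ ρ w w) r (y - x))) • U y)
    (x₀ := r) (bound := fun y => (r / 2)⁻¹ * (((r / 2)⁻¹) ^ n * D) * ‖U y‖) hnear
    (Eventually.of_forall fun s => hmeas ρ hρ.continuous s) ?_ ?_ ?_ ?_ ?_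
  · refine key.2.congr_deriv ?_
    -- The divergence form: `n` copies of `ρ` and the Euler term `w·∇ρ` are the sum over `a` of
    -- `∂ₐ(wₐ ρ)`.
    have hdil : ∀ z, -(r⁻¹ * dilate (fun w => n * ρ w + fderiv ℝ ρ w w) r z) =
        -∑ a, fderiv ℝ (dilate (fun w => w a * ρ w) r) z (EuclideanSpace.single a 1) := by
      intro z
      have hs : ∀ a, fderiv ℝ (dilate (fun w : E n => w a * ρ w) r) z (EuclideanSpace.single a 1) =
          r⁻¹ * dilate (fun w => w a * fderiv ℝ ρ w (EuclideanSpace.single a 1) + ρ w) r z := by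
        intro a
        rw [fderiv_dilate (by
          exact (contDiff_piLp_apply (p := 2)).mul hρ)]
        congr 2
        funext w
        have hp : HasFDerivAt (fun w : E n => w a) (EuclideanSpace.proj a : E n →L[ℝ] ℝ) w :=
          (EuclideanSpace.proj a : E n →L[ℝ] ℝ).hasFDerivAt
        have := (hp.mul ((hρ.differentiable (by simp)) w).hasFDerivAt).fderiv
        have e : fderiv ℝ (fun w : E n => w a * ρ w) w = _ := this
        rw [e]
        simp
      simp_rw [hs, ← Finset.mul_sum]
      congr 2
      simp only [dilate, ← Finset.mul_sum, Finset.sum_add_distrib]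
      congr 1
      have hexp : ∀ w : E n, fderiv ℝ ρ w w =
          ∑ a, w a * fderiv ℝ ρ w (EuclideanSpace.single a 1) := by
        intro w
        have h2 : w = ∑ a, w a • EuclideanSpace.single a (1 : ℝ) := by
          ext b
          simp [Finset.sum_apply, Pi.single_apply]
        conv_lhs => rw [h2]
        rw [map_sum]
        simp only [map_smul, smul_eq_mul]
        rw [← h2]
      rw [hexp]
      simp [add_comm]
    have hsm : ∀ a : Fin n, ContDiff ℝ ∞ fun y => dilate (fun w => w a * ρ w) r (y - x) := fun a =>
      (contDiff_dilate ((contDiff_piLp_apply (p := 2)).mul hρ) r).comp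
        (contDiff_id.sub contDiff_const)
    have hts : ∀ a : Fin n, tsupport (fun y => dilate (fun w => w a * ρ w) r (y - x)) ⊆
        Metric.closedBall x r := by
      intro a
      refine closure_minimal (fun y hy => ?_) Metric.isClosed_closedBall
      by_contra hlt
      rw [Metric.mem_closedBall, dist_eq_norm, not_le] at hlt
      exact hy (dilate_eq_zero (fun w hw => by rw [h1 w hw, mul_zero]) hr hlt)
    have hcs : ∀ a : Fin n, HasCompactSupport fun y => dilate (fun w => w a * ρ w) r (y - x) :=
      fun a => HasCompactSupport.of_support_subset_isCompact (isCompact_closedBall x r)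
        ((subset_tsupport _).trans (hts a))
    have hfd : ∀ (a : Fin n) y, fderiv ℝ (dilate (fun w => w a * ρ w) r) (y - x)
        (EuclideanSpace.single a 1) =
        fderiv ℝ (fun y => dilate (fun w => w a * ρ w) r (y - x)) y (EuclideanSpace.single a 1) := by
      intro a y
      rw [fderiv_comp_sub (f := dilate (fun w : E n => w a * ρ w) r)]
    have hint : ∀ a : Fin n, Integrable fun y =>
        fderiv ℝ (fun y => dilate (fun w => w a * ρ w) r (y - x)) y (EuclideanSpace.single a 1) •
          U y := by
      intro a
      have hcont : Continuous fun y =>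
          fderiv ℝ (fun y => dilate (fun w => w a * ρ w) r (y - x)) y (EuclideanSpace.single a 1) :=
        ((hsm a).continuous_fderiv (by simp)).clm_apply continuous_const
      obtain ⟨C', hC'⟩ := ((hcs a).fderiv_apply (𝕜 := ℝ)
        (EuclideanSpace.single a 1)).exists_bound_of_continuous hcont
      exact integrable_bdd_smul hcont hC' hi
    simp_rw [hdil, hfd, neg_smul, Finset.sum_smul]
    rw [integral_neg, integral_finsetSum _ fun a _ => hint a, ← Finset.sum_neg_distrib]
    refine Finset.sum_congr rfl fun a _ => ?_
    rw [(hu a).integral_indicator_eq hKΩ (hsm a) (hcs a) ((hts a).trans hx), neg_neg]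
  · have hcont : Continuous fun y => dilate ρ r (y - x) := by
      have := hρ.continuous
      unfold dilate
      fun_prop
    exact integrable_bdd_smul hcont (fun z => norm_dilate_le hC hr _) hi
  · simp_rw [neg_smul, mul_smul]
    exact ((hmeas _ hκ r).const_smul r⁻¹).neg
  · refine Eventually.of_forall fun y s hs => ?_
    have hs' : r / 2 < s := hs
    have hs0 : 0 < s := by linarith
    rw [norm_smul, norm_neg, norm_mul, norm_inv, Real.norm_of_nonneg hs0.le]
    have h3 := norm_dilate_le hD hs0 (y - x)
    have h4 : s⁻¹ ≤ (r / 2)⁻¹ := inv_anti₀ (by linarith) hs'.le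
    have h5 : (s⁻¹) ^ n ≤ ((r / 2)⁻¹) ^ n := pow_le_pow_left₀ (by positivity) h4 n
    refine mul_le_mul_of_nonneg_right ?_ (norm_nonneg _)
    exact mul_le_mul h4 (h3.trans (mul_le_mul_of_nonneg_right h5 hD0)) (norm_nonneg _)
      (by positivity)
  · exact hi.norm.const_mul _
  · refine Eventually.of_forall fun y s hs => ?_
    have hs' : r / 2 < s := hs
    exact (hasDerivAt_dilate hρ (by linarith : (0 : ℝ) < s).ne' (y - x)).smul_const (U y)

/-- **Morrey's inequality**, local form. -/
theorem exists_morrey_bound (n : ℕ) {p : ℝ≥0∞} (hp1 : 1 ≤ p) (hp : (n : ℝ≥0∞) < p) (hpt : p ≠ ⊤)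
    {R : ℝ} (hR : 0 < R) : ∃ C : ℝ, 0 ≤ C ∧ ∀ {X : Type*} [NormedAddCommGroup X] [NormedSpace ℝ X]
      [CompleteSpace X] {Ω K : Set (E n)}, IsCompact K → Metric.cthickening R K ⊆ Ω →
      ∀ {u : E n → X} {u' : Fin n → E n → X},
      (∀ a, HasWeakDeriv Ω (EuclideanSpace.single a 1) u (u' a)) → LocallyIntegrableOn u Ω →
      ∀ B : ℝ, 0 ≤ B →
      eLpNorm u p (volume.restrict (Metric.cthickening R K)) ≤ ENNReal.ofReal B →
      (∀ a, eLpNorm (u' a) p (volume.restrict (Metric.cthickening R K)) ≤ ENNReal.ofReal B) →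
      ∀ᵐ x ∂volume.restrict K, ‖u x‖ ≤ C * B := by
  let φ : ContDiffBump (0 : E n) := ⟨1 / 2, 1, by norm_num, by norm_num⟩
  set ρ : E n → ℝ := φ.normed volume with hρdef
  have hρ : ContDiff ℝ ∞ ρ := φ.contDiff_normed
  have hc : HasCompactSupport ρ := φ.hasCompactSupport_normed
  have hint : ∫ z, ρ z = 1 := φ.integral_normed
  have h1 : ∀ w, 1 < ‖w‖ → ρ w = 0 := by
    intro w hw
    have : w ∉ Function.support ρ := by
      rw [hρdef, φ.support_normed_eq, mem_ball_zero_iff]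
      exact not_lt.2 hw.le
    simpa using this
  obtain ⟨C, hC⟩ := hc.exists_bound_of_continuous hρ.continuous
  have hC0 : 0 ≤ C := (norm_nonneg _).trans (hC 0)
  have hCa : ∀ (a : Fin n) (w : E n), ‖w a * ρ w‖ ≤ C := by
    intro a w
    rcases le_or_gt ‖w‖ 1 with hw | hw
    · rw [norm_mul]
      calc ‖w a‖ * ‖ρ w‖ ≤ 1 * C :=
            mul_le_mul ((PiLp.norm_apply_le w a).trans hw) (hC w) (norm_nonneg _) zero_le_one
        _ = C := one_mul C
    · rw [h1 w hw, mul_zero, norm_zero]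
      exact hC0
  have hpr : (n : ℝ) < p.toReal := by
    have := (ENNReal.toReal_lt_toReal (ENNReal.natCast_ne_top n) hpt).2 hp
    simpa using this
  have hpr0 : 0 < p.toReal := (Nat.cast_nonneg n).trans_lt hpr
  -- The Hölder exponent of Morrey's inequality. The scale derivative of the means is of order `r^{s
  -- - 1}`, and `s > 0` because `p > n`.
  set s : ℝ := 1 - n / p.toReal with hs
  have hs0 : 0 < s := by
    rw [hs, sub_pos]
    exact (div_lt_one hpr0).2 hpr
  set A : ℝ := C * volume.real (Metric.ball (0 : E n) 1) ^ (1 - 1 / p.toReal) with hA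
  have hA0 : 0 ≤ A := by positivity
  -- The first term bounds the weighted mean at scale `R`; the second is the integral of `n A r^{s -
  -- 1}` over `0 < r < R`.
  refine ⟨A * R ^ (-(n / p.toReal)) + n * A / s * R ^ s, by positivity, ?_⟩
  intro X _ _ _ Ω K hK hKΩ u u' hu hui B hB hBu hBu'
  set K' := Metric.cthickening R K
  have hK'c : IsCompact K' := hK.cthickening
  have hK'm : MeasurableSet K' := hK'c.measurableSet
  have hKK' : K ⊆ K' := Metric.self_subset_cthickening K
  have iU : Integrable (K'.indicator u) :=
    (hui.integrableOn_compact_subset hKΩ hK'c).integrable_indicator hK'm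
  have iU' : ∀ a, Integrable (K'.indicator (u' a)) := fun a =>
    ((hu a).2.integrableOn_compact_subset hKΩ hK'c).integrable_indicator hK'm
  have bU : eLpNorm (K'.indicator u) p volume ≤ ENNReal.ofReal B := by
    rwa [eLpNorm_indicator_eq_eLpNorm_restrict hK'm]
  have bU' : ∀ a, eLpNorm (K'.indicator (u' a)) p volume ≤ ENNReal.ofReal B := fun a => by
    rw [eLpNorm_indicator_eq_eLpNorm_restrict hK'm]
    exact hBu' a
  rw [ae_restrict_iff' hK.measurableSet]
  filter_upwards [ae_tendsto_integral_dilate hC h1 hint iU] with x hx hxK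
  rw [indicator_of_mem (hKK' hxK)] at hx
  set m : ℝ → X := fun r => ∫ y, dilate ρ r (y - x) • K'.indicator u y with hm
  have hball : ∀ r ≤ R, Metric.closedBall x r ⊆ K' := fun r hr =>
    (Metric.closedBall_subset_closedBall hr).trans (Metric.closedBall_subset_cthickening hxK R)
  have hd : ∀ r, 0 < r → r ≤ R → HasDerivAt m _ r := fun r hr hrR =>
    hasDerivAt_integral_dilate_smul hKΩ hu iU hρ hc h1 hr (hball r hrR)
  have hbd : ∀ r, 0 < r → ‖∑ a, ∫ y, dilate (fun w => w a * ρ w) r (y - x) •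
      K'.indicator (u' a) y‖ ≤ n * A * B * r ^ (s - 1) := by
    intro r hr
    refine (norm_sum_le _ _).trans ?_
    refine (Finset.sum_le_card_nsmul _ _ (A * r ^ (-(n / p.toReal)) * B) fun a _ =>
      norm_integral_dilate_smul_le hp1 (hCa a) (fun w hw => by rw [h1 w hw, mul_zero]) hr (iU' a) hB
        (bU' a)).trans (le_of_eq ?_)
    rw [Finset.card_univ, Fintype.card_fin, nsmul_eq_mul, hs]
    ring_nf
  have hmR : ‖m R‖ ≤ A * R ^ (-(n / p.toReal)) * B :=
    norm_integral_dilate_smul_le hp1 hC h1 hR iU hB bU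
  refine le_of_tendsto hx.norm ?_
  have hmem : Ioo (0 : ℝ) R ∈ 𝓝[>] (0 : ℝ) := Ioo_mem_nhdsGT hR
  filter_upwards [hmem] with ε hε
  have hε0 : 0 < ε := hε.1
  -- A mean value inequality bounds `m R - m ε` by an antiderivative of the bound for `m'`. At
  -- almost every `x` the means `m ε` tend to `u x`.
  have hfence := image_norm_le_of_norm_deriv_right_le_deriv_boundary' (a := ε) (b := R)
    (f := fun r => m r - m ε)
    (f' := fun r => ∑ a, ∫ y, dilate (fun w => w a * ρ w) r (y - x) • K'.indicator (u' a) y)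
    (B := fun r => n * A * B / s * (r ^ s - ε ^ s)) (B' := fun r => n * A * B * r ^ (s - 1))
    (fun r hr => ((hd r (hε0.trans_le hr.1) hr.2).sub_const _).continuousAt.continuousWithinAt)
    (fun r hr => ((hd r (hε0.trans_le hr.1) hr.2.le).sub_const _).hasDerivWithinAt)
    (by simp) ?_ ?_ (fun r hr => hbd r (hε0.trans_le hr.1)) (right_mem_Icc.2 hε.2.le)
  · have h6 : ‖m ε‖ ≤ ‖m R‖ + ‖m R - m ε‖ := by
      have := norm_sub_le (m R) (m R - m ε)
      simpa using this
    have h7 : n * A * B / s * (R ^ s - ε ^ s) ≤ n * A * B / s * R ^ s :=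
      mul_le_mul_of_nonneg_left (by have := Real.rpow_nonneg hε0.le s; linarith) (by positivity)
    calc ‖m ε‖ ≤ A * R ^ (-(n / p.toReal)) * B + n * A * B / s * R ^ s := by
          linarith [h6, hmR, hfence.trans h7]
      _ = _ := by ring
  · intro r hr
    have : ContinuousAt (fun r : ℝ => r ^ s) r :=
      Real.continuousAt_rpow_const r s (Or.inl (hε0.trans_le hr.1).ne')
    exact ((this.sub continuousAt_const).const_mul _).continuousWithinAt
  · intro r hr
    have := ((Real.hasDerivAt_rpow_const (x := r) (p := s)
      (Or.inl (hε0.trans_le hr.1).ne')).sub_const (ε ^ s)).const_mul (n * A * B / s)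
    refine (this.congr_deriv ?_).hasDerivWithinAt
    field_simp

end Morrey

end SpinGeom

namespace SpinGeom

/-! ### Unitarity of the spinor representation -/

/-- It suffices to look at vectors: the Clifford star sends `ι v` to `-ι v`, and `γ v` is
skew-adjoint. -/
theorem SpinorRep.rho_star {n : ℕ} {V : Type*} [NormedAddCommGroup V] [InnerProductSpace ℝ V]
    [CompleteSpace V] (κ : SpinorRep n V) (x : CliffordAlgebra (cliffordForm n)) :
    κ.ρ (star x) = star (κ.ρ x) := by
  induction x using CliffordAlgebra.induction with
  | algebraMap r =>
    rw [CliffordAlgebra.star_algebraMap, AlgHom.commutes, ← algebraMap_star_comm]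
    simp
  | ι v =>
    rw [CliffordAlgebra.star_ι, map_neg, SpinorRep.ρ, CliffordAlgebra.lift_ι_apply]
    refine ((ContinuousLinearMap.eq_adjoint_iff _ _).2 fun ψ φ => ?_)
    have := κ.skew v ψ φ
    simp only [neg_apply, inner_neg_left, this, neg_neg]
  | mul a b ha hb => rw [star_mul, map_mul, ha, hb, map_mul, star_mul]
  | add a b ha hb => rw [star_add, map_add, ha, hb, map_add, star_add]

/-- Elements of the spin group satisfy `star s * s = 1`, so they act isometrically, and the
C*-identity gives the bound. -/
theorem SpinorRep.norm_rho_le {n : ℕ} {V : Type*} [NormedAddCommGroup V] [InnerProductSpace ℝ V]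
    [CompleteSpace V] (κ : SpinorRep n V) (s : spinGroup (cliffordForm n)) :
    ‖κ.ρ (s : CliffordAlgebra (cliffordForm n))‖ ≤ 1 := by
  have h : star (κ.ρ (s : CliffordAlgebra (cliffordForm n))) * κ.ρ (s : CliffordAlgebra _) = 1 := by
    rw [← κ.rho_star, ← map_mul, spinGroup.star_mul_self_of_mem s.2, map_one]
  have h2 : ‖κ.ρ (s : CliffordAlgebra (cliffordForm n))‖ * ‖κ.ρ (s : CliffordAlgebra _)‖ ≤ 1 := by
    rw [← CStarRing.norm_star_mul_self, h]
    exact ContinuousLinearMap.norm_id_le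
  nlinarith [norm_nonneg (κ.ρ (s : CliffordAlgebra (cliffordForm n)))]

/-! ### Isometric changes of frame and local geometric bounds. -/

section Geometry

variable {n : ℕ} {M : Type*} [TopologicalSpace M] [ChartedSpace (E n) M]
  [IsManifold (𝓡 n) ∞ M] {g : RMetric n M}

namespace SpinStructure

variable (σ : SpinStructure g) {V : Type*} [NormedAddCommGroup V]
  [InnerProductSpace ℝ V] (κ : SpinorRep n V)

theorem norm_coordChange_le [CompleteSpace V] (i j : ℕ) (x : M) :
    ‖(σ.spinorBundle κ).coordChange i j x‖ ≤ 1 :=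
  κ.norm_rho_le _

theorem coordChange_mul_coordChange {i j : ℕ} {x : M} (hi : x ∈ σ.U i) (hj : x ∈ σ.U j) :
    (σ.spinorBundle κ).coordChange i j x * (σ.spinorBundle κ).coordChange j i x = 1 := by
  ext v
  have h := (σ.spinorBundle κ).coordChange_comp j i j x ⟨⟨hj, hi⟩, hj⟩ v
  rw [mul_apply_eq_comp, h]
  exact (σ.spinorBundle κ).coordChange_self j x hj v

/-- A change of frame is a conjugation: the transition maps in its two directions are mutually
inverse. -/
theorem endRep_mul {i : ℕ} {x : M} (hx : x ∈ σ.U i) (B C : EndSpinor V) :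
    σ.endRep κ i x (B * C) = σ.endRep κ i x B * σ.endRep κ i x C := by
  have h := σ.coordChange_mul_coordChange κ hx (σ.mem_U_indexAt x)
  simp only [endRep]
  calc _ = (σ.spinorBundle κ).coordChange (σ.indexAt x) i x * B * 1 * C *
        (σ.spinorBundle κ).coordChange i (σ.indexAt x) x := by rw [mul_one]; simp only [mul_assoc]
    _ = _ := by
      rw [← h]
      simp only [mul_assoc]

theorem norm_endRep_le [CompleteSpace V] (i : ℕ) (x : M) (B : EndSpinor V) :
    ‖σ.endRep κ i x B‖ ≤ ‖B‖ := by
  calc ‖σ.endRep κ i x B‖ ≤ 1 * ‖B‖ * 1 := by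
        refine (norm_mul_le _ _).trans (mul_le_mul ((norm_mul_le _ _).trans ?_)
          (σ.norm_coordChange_le κ _ _ x) (norm_nonneg _) (by positivity))
        exact mul_le_mul_of_nonneg_right (σ.norm_coordChange_le κ _ _ x) (norm_nonneg _)
    _ = ‖B‖ := by ring

theorem le_norm_endRep [CompleteSpace V] {i : ℕ} {x : M} (hx : x ∈ σ.U i) (B : EndSpinor V) :
    ‖B‖ ≤ ‖σ.endRep κ i x B‖ := by
  have h := σ.coordChange_mul_coordChange κ hx (σ.mem_U_indexAt x)
  have hB : B = (σ.spinorBundle κ).coordChange i (σ.indexAt x) x * σ.endRep κ i x B *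
      (σ.spinorBundle κ).coordChange (σ.indexAt x) i x := by
    simp only [endRep]
    calc B = 1 * B * 1 := by simp
      _ = _ := by
        rw [← h]
        simp only [mul_assoc]
  calc ‖B‖ ≤ 1 * ‖σ.endRep κ i x B‖ * 1 := by
        conv_lhs => rw [hB]
        refine (norm_mul_le _ _).trans (mul_le_mul ((norm_mul_le _ _).trans ?_)
          (σ.norm_coordChange_le κ _ _ x) (norm_nonneg _) (by positivity))
        exact mul_le_mul_of_nonneg_right (σ.norm_coordChange_le κ _ _ x) (norm_nonneg _)
    _ = _ := by ring

/-! ### Local bounds for the metric and connection coefficients -/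

/-- Bessel's inequality for the orthonormal frame. -/
theorem norm_coord_sq_le {i : ℕ} {x : M} (hx : x ∈ σ.U i) (X : TangentSpace (𝓡 n) x) :
    ‖σ.coord i x X‖ ^ 2 ≤ g.inner x X X := by
  have hnn : ∀ Y : TangentSpace (𝓡 n) x, 0 ≤ g.inner x Y Y := by
    intro Y
    by_cases hY : Y = 0
    · simp [hY]
    · exact (g.pos x Y hY).le
  set c : Fin n → ℝ := fun a => g.inner x (σ.frame i a x) X with hc
  have h := hnn (X - ∑ a, c a • σ.frame i a x)
  have e1 : g.inner x X (∑ a, c a • σ.frame i a x) = ∑ a, c a ^ 2 := by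
    simp only [map_sum, map_smul, smul_eq_mul]
    refine Finset.sum_congr rfl fun a _ => ?_
    rw [g.symm, sq]
  have e2 : g.inner x (∑ a, c a • σ.frame i a x) X = ∑ a, c a ^ 2 := by
    rw [g.symm, e1]
  have e3 : g.inner x (∑ a, c a • σ.frame i a x) (∑ a, c a • σ.frame i a x) = ∑ a, c a ^ 2 := by
    simp only [map_sum, map_smul, sum_apply, smul_apply, smul_eq_mul, σ.orthonormal i x hx]
    refine Finset.sum_congr rfl fun a _ => ?_
    simp [sq]
  rw [map_sub, map_sub, sub_apply, sub_apply, e1, e2, e3] at h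
  rw [EuclideanSpace.norm_sq_eq]
  simp only [coord, Real.norm_eq_abs, sq_abs]
  linarith

theorem continuousOn_leviCivita (i : ℕ) (c a b : Fin n) :
    ContinuousOn (fun x => σ.leviCivita i x c a b) (σ.U i) := by
  let : RiemannianBundle (fun x : M => TangentSpace (𝓡 n) x) := ⟨g.toRiemannianMetric⟩
  have hf : ∀ a, ∀ x ∈ σ.U i, ContMDiffAt (𝓡 n) (𝓡 n).tangent ∞
      (fun x => (⟨x, σ.frame i a x⟩ : TangentBundle (𝓡 n) M)) x := fun a x hx =>
    (σ.smooth_frame i a).contMDiffAt ((σ.isOpen_U i).mem_nhds hx)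
  have hbr : ∀ a b c, ContinuousOn (fun x => g.inner x
      (VectorField.mlieBracket (𝓡 n) (σ.frame i a) (σ.frame i b) x) (σ.frame i c x)) (σ.U i) := by
    intro a b c x hx
    have : IsManifold (𝓡 n) (((⊤ : ℕ∞) : WithTop ℕ∞) + 1) M := by
      simpa using (inferInstance : IsManifold (𝓡 n) ∞ M)
    have : IsManifold (𝓡 n) (minSmoothness ℝ 2) M := by
      rw [minSmoothness_of_isRCLikeNormedField]
      exact IsManifold.of_le (n := ((⊤ : ℕ∞) : WithTop ℕ∞)) (WithTop.coe_le_coe.2 (le_top : (2 : ℕ∞) ≤ ⊤))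
    have h1 : ContMDiffAt (𝓡 n) (𝓡 n).tangent ((0 : ℕ∞) : WithTop ℕ∞) (fun x =>
        (⟨x, VectorField.mlieBracket (𝓡 n) (σ.frame i a) (σ.frame i b) x⟩ :
          TangentBundle (𝓡 n) M)) x :=
      ContMDiffAt.mlieBracket_vectorField (n := ⊤) (hf a x hx) (hf b x hx)
        (by simp [minSmoothness_of_isRCLikeNormedField])
    have h2 := (hf c x hx).of_le (show ((0 : ℕ∞) : WithTop ℕ∞) ≤ ((⊤ : ℕ∞) : WithTop ℕ∞) by simp)
    exact (h1.inner_bundle h2).continuousAt.continuousWithinAt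
  unfold leviCivita
  exact continuousOn_const.mul (((hbr c a b).sub (hbr a b c)).add (hbr b c a))

/-- The bound is uniform in the frame `j`, because `localDeriv` reads `G` in the frame `indexAt`,
which may jump from point to point. Bessel's inequality bounds every frame by `g(∂ᵥ, ∂ᵥ)`, which is
continuous. -/
theorem exists_norm_coord_le {φ : OpenPartialHomeomorph M (E n)} (hφ : φ ∈ atlas (E n) M)
    {K : Set (E n)} (hK : IsCompact K) (hKφ : K ⊆ φ.target) (v : E n) :
    ∃ C : ℝ, 0 ≤ C ∧ ∀ y ∈ K, ∀ j, φ.symm y ∈ σ.U j →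
      ‖σ.coord j (φ.symm y) (coordVec φ y v)‖ ≤ C := by
  obtain ⟨C, hC⟩ := hK.exists_bound_of_continuousOn ((continuousOn_gram g hφ v v).mono hKφ)
  refine ⟨√C, Real.sqrt_nonneg _, fun y hy j hj => ?_⟩
  refine Real.le_sqrt_of_sq_le ?_
  exact (σ.norm_coord_sq_le hj _).trans ((le_abs_self _).trans (hC y hy))

theorem exists_norm_connForm_le {i : ℕ} {φ : OpenPartialHomeomorph M (E n)}
    (hφ : φ ∈ atlas (E n) M) {K : Set (E n)} (hK : IsCompact K) (hKφ : K ⊆ σ.localDom i φ)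
    (v : E n) :
    ∃ C : ℝ, 0 ≤ C ∧ ∀ y ∈ K, ‖σ.connForm κ i (φ.symm y) (coordVec φ y v)‖ ≤ C := by
  obtain ⟨C₁, hC₁0, hC₁⟩ := σ.exists_norm_coord_le hφ hK (hKφ.trans inter_subset_left) v
  have hlc : ∀ c a b, ∃ D, ∀ y ∈ K, ‖σ.leviCivita i (φ.symm y) c a b‖ ≤ D := fun c a b =>
    hK.exists_bound_of_continuousOn ((σ.continuousOn_leviCivita i c a b).comp
      (φ.symm.continuousOn.mono (hKφ.trans inter_subset_left)) fun y hy => (hKφ hy).2)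
  choose D hD using hlc
  have hb : ∀ y ∈ K, ‖σ.connForm κ i (φ.symm y) (coordVec φ y v)‖ ≤
      ‖(1 / 4 : ℝ)‖ * ∑ a, ∑ b, (∑ c, C₁ * |D c a b|) *
        ‖κ.γ (EuclideanSpace.single a 1) * κ.γ (EuclideanSpace.single b 1)‖ := by
    intro y hy
    unfold connForm
    rw [norm_smul]
    refine mul_le_mul_of_nonneg_left ?_ (norm_nonneg _)
    refine (norm_sum_le _ _).trans (Finset.sum_le_sum fun a _ => ?_)
    refine (norm_sum_le _ _).trans (Finset.sum_le_sum fun b _ => ?_)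
    rw [norm_smul]
    refine mul_le_mul_of_nonneg_right ?_ (norm_nonneg _)
    refine (norm_sum_le _ _).trans (Finset.sum_le_sum fun c _ => ?_)
    rw [norm_mul]
    exact mul_le_mul ((PiLp.norm_apply_le _ c).trans (hC₁ y hy i (hKφ hy).2))
      ((hD c a b y hy).trans (le_abs_self _)) (norm_nonneg _) hC₁0
  exact ⟨_, by positivity, hb⟩

end SpinStructure

/-! ### The volume measure in charts -/

theorem continuousOn_volDensity (g : RMetric n M) {φ : OpenPartialHomeomorph M (E n)}
    (hφ : φ ∈ atlas (E n) M) : ContinuousOn (volDensity g φ) φ.target := by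
  refine Real.continuous_sqrt.comp_continuousOn ?_
  have hc : ContinuousOn (fun y => (Matrix.of fun a b : Fin n =>
      g.inner (φ.symm y) (coordVec φ y (EuclideanSpace.single a 1))
        (coordVec φ y (EuclideanSpace.single b 1)))) φ.target :=
    continuousOn_pi.2 fun a => continuousOn_pi.2 fun b => continuousOn_gram g hφ _ _
  exact (Continuous.matrix_det continuous_id).comp_continuousOn hc

variable [MeasurableSpace M] [BorelSpace M]

/-- On compact subsets of charts, Lebesgue measure is dominated by the Riemannian volume. -/
theorem exists_map_restrict_le_vol (g : RMetric n M) {φ : OpenPartialHomeomorph M (E n)}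
    (hφ : φ ∈ atlas (E n) M) {K : Set (E n)} (hK : IsCompact K) (hKφ : K ⊆ φ.target) :
    ∃ C : ℝ≥0∞, C ≠ ⊤ ∧ Measure.map φ.symm (volume.restrict K) ≤ C • vol g := by
  have hms : MeasurableSet φ.target := φ.open_target.measurableSet
  have hdc := continuousOn_volDensity g hφ
  -- The density has a positive minimum on the compact `K`; its inverse is the constant sought.
  obtain ⟨c, hc0, hc⟩ : ∃ c : ℝ, 0 < c ∧ ∀ y ∈ K, c ≤ volDensity g φ y := by
    rcases K.eq_empty_or_nonempty with rfl | hne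
    · exact ⟨1, one_pos, by simp⟩
    · obtain ⟨y₀, hy₀, hmin⟩ := hK.exists_isMinOn hne (hdc.mono hKφ)
      exact ⟨_, volDensity_pos g hφ (hKφ hy₀), hmin⟩
  set d : E n → ℝ≥0∞ := fun y => ENNReal.ofReal (volDensity g φ y) with hd
  set C : ℝ≥0∞ := (ENNReal.ofReal c)⁻¹ with hC
  have hc' : ENNReal.ofReal c ≠ 0 := by simpa using hc0
  have hle : volume.restrict K ≤ C • (volume.restrict φ.target).withDensity d := by
    refine Measure.le_iff.2 fun s hs => ?_
    rw [Measure.smul_apply, smul_eq_mul, withDensity_apply _ hs, Measure.restrict_restrict hs,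
      Measure.restrict_apply hs]
    have h1 : ENNReal.ofReal c * volume (s ∩ K) ≤ ∫⁻ y in s ∩ φ.target, d y := by
      calc ENNReal.ofReal c * volume (s ∩ K) = ∫⁻ _ in s ∩ K, ENNReal.ofReal c := by
            rw [setLIntegral_const]
        _ ≤ ∫⁻ y in s ∩ K, d y :=
            setLIntegral_mono' (hs.inter hK.measurableSet) fun y hy =>
              ENNReal.ofReal_le_ofReal (hc y hy.2)
        _ ≤ ∫⁻ y in s ∩ φ.target, d y :=
            lintegral_mono_set (inter_subset_inter_right s hKφ)
    calc volume (s ∩ K) = C * (ENNReal.ofReal c * volume (s ∩ K)) := by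
          rw [← mul_assoc, hC, ENNReal.inv_mul_cancel hc' ENNReal.ofReal_ne_top, one_mul]
      _ ≤ _ := by gcongr
  have hae : AEMeasurable φ.symm ((volume.restrict φ.target).withDensity d) :=
    (φ.symm.continuousOn.aemeasurable hms).mono_ac (withDensity_absolutelyContinuous _ _)
  refine ⟨C, ENNReal.inv_ne_top.2 hc', ?_⟩
  refine (Measure.map_mono_of_aemeasurable hle (hae.smul_measure C)).trans ?_
  rw [Measure.map_smul]
  refine Measure.le_iff.2 fun s hs => ?_
  simp only [Measure.smul_apply, smul_eq_mul]
  gcongr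
  exact le_iSup₂ (f := fun (φ : OpenPartialHomeomorph M (E n)) (_ : φ ∈ atlas (E n) M) =>
    Measure.map φ.symm ((volume.restrict φ.target).withDensity
      fun y => ENNReal.ofReal (volDensity g φ y))) φ hφ

/-- A set is null for the Riemannian volume if it is null in each of countably many charts that
cover the manifold. -/
theorem ae_vol_of_ae_charts (g : RMetric n M) {ι : Type*} [Countable ι]
    {φ : ι → OpenPartialHomeomorph M (E n)} (hφ : ∀ i, φ i ∈ atlas (E n) M) {K : ι → Set (E n)}
    (hK : ∀ i, MeasurableSet (K i))
    (hcov : ∀ x, ∃ i, x ∈ (φ i).source ∧ φ i x ∈ K i) {P : M → Prop}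
    (hP : ∀ i, ∀ᵐ y ∂(volume.restrict (K i)), P ((φ i).symm y)) : ∀ᵐ x ∂vol g, P x := by
  set N : Set M := {x | ¬ P x} with hN
  have hnull : ∀ i, volume (K i ∩ (φ i).symm ⁻¹' N) = 0 := by
    intro i
    have := (ae_restrict_iff' (hK i)).1 (hP i)
    rw [ae_iff] at this
    convert this using 2
    ext y
    simp [hN]
  -- The exceptional set need not be measurable, so it is enlarged to a measurable null set in each
  -- chart.
  set B : ι → Set (E n) := fun i => toMeasurable volume (K i ∩ (φ i).symm ⁻¹' N)
  have hB0 : ∀ i, volume (B i) = 0 := fun i => by rw [measure_toMeasurable, hnull i]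
  set N' : Set M := ⋃ i, (φ i).source ∩ φ i ⁻¹' B i with hN'
  have hNN' : N ⊆ N' := by
    intro x hx
    obtain ⟨i, hi, hiK⟩ := hcov x
    refine mem_iUnion.2 ⟨i, hi, subset_toMeasurable _ _ ⟨hiK, ?_⟩⟩
    rwa [mem_preimage, (φ i).left_inv hi]
  have hN'm : MeasurableSet N' := by
    refine MeasurableSet.iUnion fun i => ?_
    have h1 : MeasurableSet ((φ i).source.domRestrict (φ i) ⁻¹' B i) :=
      (continuousOn_iff_continuous_domRestrict.1 (φ i).continuousOn).measurable
        (measurableSet_toMeasurable _ _)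
    have h2 := (φ i).open_source.measurableSet.subtype_image h1
    convert h2 using 1
    ext x
    simp [Set.domRestrict, and_comm]
  -- The volume is a supremum over the whole atlas, so nullity has to be carried to every chart `ψ`;
  -- differentiable transition maps send null sets to null sets.
  have hnull' : ∀ ψ ∈ atlas (E n) M, volume (ψ.target ∩ ψ.symm ⁻¹' N') = 0 := by
    intro ψ hψ
    have hsub : ψ.target ∩ ψ.symm ⁻¹' N' ⊆ ⋃ i, ((φ i).symm.trans ψ) ''
        (B i ∩ ((φ i).symm.trans ψ).source) := by
      rintro z ⟨hz, hzN⟩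
      obtain ⟨i, hi, hiB⟩ := mem_iUnion.1 hzN
      refine mem_iUnion.2 ⟨i, φ i (ψ.symm z), ⟨hiB, ?_⟩, ?_⟩
      · rw [OpenPartialHomeomorph.trans_source]
        refine ⟨(φ i).map_source hi, ?_⟩
        rw [mem_preimage, (φ i).left_inv hi]
        exact ψ.map_target hz
      · simp [(φ i).left_inv hi, ψ.right_inv hz]
    refine measure_mono_null hsub (measure_iUnion_null fun i => ?_)
    refine addHaar_image_eq_zero_of_differentiableOn_of_addHaar_eq_zero volume ?_
      (measure_mono_null inter_subset_left (hB0 i))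
    have hc : ((φ i).symm.trans ψ) ∈ contDiffGroupoid ∞ (𝓡 n) :=
      HasGroupoid.compatible (hφ i) hψ
    rw [contDiffGroupoid, mem_groupoid_of_pregroupoid] at hc
    have hd : ContDiffOn ℝ ∞ ((φ i).symm.trans ψ) ((φ i).symm.trans ψ).source := by
      simpa [contDiffPregroupoid] using hc.1
    exact (hd.differentiableOn (by simp)).mono inter_subset_right
  -- A supremum of measures is not computed set by set. It is instead compared with an upper bound:
  -- the measure that is infinite on nonempty measurable sets off `N'` and vanishes on `N'`
  -- dominates every chart measure.
  have hle : vol g ≤ (⊤ : ℝ≥0∞) • Measure.count.restrict N'ᶜ := by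
    refine iSup₂_le fun ψ hψ => Measure.le_iff.2 fun s hs => ?_
    have hms : MeasurableSet ψ.target := ψ.open_target.measurableSet
    rcases (s ∩ N'ᶜ).eq_empty_or_nonempty with h | h
    · have hsN : s ⊆ N' := fun x hx => by
        by_contra hxN
        exact h.subset ⟨hx, hxN⟩
      refine (measure_mono hsN).trans ?_
      have hae : AEMeasurable ψ.symm ((volume.restrict ψ.target).withDensity
          fun y => ENNReal.ofReal (volDensity g ψ y)) :=
        (ψ.symm.continuousOn.aemeasurable hms).mono_ac (withDensity_absolutelyContinuous _ _)
      rw [Measure.map_apply_of_aemeasurable hae hN'm]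
      refine le_of_eq_of_le (withDensity_absolutelyContinuous _ _ ?_) zero_le
      rw [Measure.restrict_apply' hms, inter_comm]
      exact hnull' ψ hψ
    · rw [Measure.smul_apply, Measure.restrict_apply hs, Measure.count_apply (hs.inter hN'm.compl),
        smul_eq_mul, ENNReal.top_mul]
      · exact le_top
      · simpa using h.ne_empty
  refine measure_mono_null hNN' (le_antisymm ((hle N').trans ?_) zero_le)
  rw [Measure.smul_apply, Measure.restrict_apply hN'm, inter_compl_self, measure_empty, smul_zero]

end Geometry

end SpinGeom

/-! ### Sobolev sections in charts, and their boundedness. -/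

namespace SpinGeom

namespace SpinStructure

section Sobolev

variable {n : ℕ} {M : Type*} [TopologicalSpace M] [ChartedSpace (E n) M]
  [IsManifold (𝓡 n) ∞ M] {g : RMetric n M} (σ : SpinStructure g) {V : Type*}
  [NormedAddCommGroup V] [InnerProductSpace ℝ V] (κ : SpinorRep n V)

theorem hasWeakCovDeriv_iff {F : M → EndSpinor V} {G : M → (E n →L[ℝ] EndSpinor V)} :
    σ.HasWeakCovDeriv κ F G ↔ ∀ i, ∀ φ ∈ atlas (E n) M, ∀ v,
      HasWeakDeriv (σ.localDom i φ) v (σ.localSec κ i φ F) (σ.localDeriv κ i φ v F G) :=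
  ⟨fun h i φ hφ v => ⟨(h i φ hφ v).1, (h i φ hφ v).2.1, (h i φ hφ v).2.2⟩,
    fun h i φ hφ v => ⟨(h i φ hφ v).1, (h i φ hφ v).2, (h i φ hφ v).3⟩⟩

variable [CompleteSpace V]

/-- Pointwise bound for the local expression of the weak derivative. -/
theorem exists_norm_localDeriv_le {i : ℕ} {φ : OpenPartialHomeomorph M (E n)}
    (hφ : φ ∈ atlas (E n) M) {K : Set (E n)} (hK : IsCompact K) (hKφ : K ⊆ σ.localDom i φ)
    (v : E n) : ∃ C : ℝ, 0 ≤ C ∧ ∀ (F : M → EndSpinor V) (G : M → (E n →L[ℝ] EndSpinor V)),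
      ∀ y ∈ K, ‖σ.localDeriv κ i φ v F G y‖ ≤ C * (‖F (φ.symm y)‖ + ‖G (φ.symm y)‖) := by
  obtain ⟨C₁, hC₁0, hC₁⟩ := σ.exists_norm_coord_le hφ hK (hKφ.trans inter_subset_left) v
  obtain ⟨C₂, hC₂0, hC₂⟩ := σ.exists_norm_connForm_le κ hφ hK hKφ v
  refine ⟨C₁ + 2 * C₂, by positivity, fun F G y hy => ?_⟩
  set x := φ.symm y
  have h1 : ‖σ.endRep κ i x (G x (σ.coord (σ.indexAt x) x (coordVec φ y v)))‖ ≤ C₁ * ‖G x‖ := by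
    refine (σ.norm_endRep_le κ i x _).trans ((ContinuousLinearMap.le_opNorm _ _).trans ?_)
    rw [mul_comm]
    exact mul_le_mul_of_nonneg_right (hC₁ y hy _ (σ.mem_U_indexAt _)) (norm_nonneg _)
  have h2 : ‖σ.localSec κ i φ F y‖ ≤ ‖F x‖ := σ.norm_endRep_le κ i x _
  have h3 := hC₂ y hy
  have h4 : ‖σ.connForm κ i x (coordVec φ y v) * σ.localSec κ i φ F y‖ ≤ C₂ * ‖F x‖ :=
    (norm_mul_le _ _).trans (mul_le_mul h3 h2 (norm_nonneg _) hC₂0)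
  have h5 : ‖σ.localSec κ i φ F y * σ.connForm κ i x (coordVec φ y v)‖ ≤ C₂ * ‖F x‖ := by
    rw [mul_comm C₂]
    exact (norm_mul_le _ _).trans (mul_le_mul h2 h3 (norm_nonneg _) (norm_nonneg _))
  calc ‖σ.localDeriv κ i φ v F G y‖ ≤ C₁ * ‖G x‖ + (C₂ * ‖F x‖ + C₂ * ‖F x‖) :=
        (norm_sub_le _ _).trans (add_le_add h1 ((norm_sub_le _ _).trans (add_le_add h4 h5)))
    _ ≤ _ := by
        nlinarith [mul_nonneg hC₁0 (norm_nonneg (F x)), mul_nonneg hC₂0 (norm_nonneg (G x))]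

variable [MeasurableSpace M] [BorelSpace M]

/-- A domination of measures with factor `C` becomes a domination of `L^p` norms with factor
`C^{1/p}`. -/
theorem exists_eLpNorm_comp_symm_le (g : RMetric n M) (p : ℝ≥0∞) (hpt : p ≠ ⊤)
    {φ : OpenPartialHomeomorph M (E n)} (hφ : φ ∈ atlas (E n) M) {K : Set (E n)}
    (hK : IsCompact K) (hKφ : K ⊆ φ.target) :
    ∃ C : ℝ, 0 ≤ C ∧ ∀ f : M → ℝ, AEStronglyMeasurable f (vol g) →
      eLpNorm (fun y => f (φ.symm y)) p (volume.restrict K) ≤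
        ENNReal.ofReal C * eLpNorm f p (vol g) := by
  obtain ⟨C, hC, hle⟩ := exists_map_restrict_le_vol g hφ hK hKφ
  have hm : AEMeasurable φ.symm (volume.restrict K) :=
    (φ.symm.continuousOn.mono hKφ).aemeasurable hK.measurableSet
  have hCp : C ^ (1 / p).toReal ≠ ⊤ := ENNReal.rpow_ne_top_of_nonneg ENNReal.toReal_nonneg hC
  refine ⟨(C ^ (1 / p).toReal).toReal, ENNReal.toReal_nonneg, fun f hf => ?_⟩
  rw [ENNReal.ofReal_toReal hCp]
  have hf' : AEStronglyMeasurable f (Measure.map φ.symm (volume.restrict K)) :=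
    (hf.smul_measure C).mono_measure hle
  calc eLpNorm (fun y => f (φ.symm y)) p (volume.restrict K)
      = eLpNorm f p (Measure.map φ.symm (volume.restrict K)) := (eLpNorm_map_measure hf' hm).symm
    _ ≤ eLpNorm f p (C • vol g) := eLpNorm_mono_measure f hle
    _ = C ^ (1 / p).toReal * eLpNorm f p (vol g) := by
        rw [eLpNorm_smul_measure_of_ne_top hpt, smul_eq_mul]

variable (p : ℝ≥0∞) [Fact (1 ≤ p)]

/-- Local `L^p` bounds of the local expressions by the global norm. -/
theorem exists_eLpNorm_local_le (hpt : p ≠ ⊤) {i : ℕ} {φ : OpenPartialHomeomorph M (E n)}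
    (hφ : φ ∈ atlas (E n) M) {K : Set (E n)} (hK : IsCompact K) (hKφ : K ⊆ σ.localDom i φ)
    (v : E n) : ∃ C : ℝ, 0 ≤ C ∧
      ∀ u : WithLp 1 (Lp (EndSpinor V) p (vol g) × Lp (E n →L[ℝ] EndSpinor V) p (vol g)),
        eLpNorm (σ.localSec κ i φ u.fst) p (volume.restrict K) ≤ ENNReal.ofReal (C * ‖u‖) ∧
        eLpNorm (σ.localDeriv κ i φ v u.fst u.snd) p (volume.restrict K) ≤
          ENNReal.ofReal (C * ‖u‖) := by
  obtain ⟨C₁, hC₁0, hC₁⟩ := exists_eLpNorm_comp_symm_le g p hpt hφ hK (hKφ.trans inter_subset_left)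
  obtain ⟨C₂, hC₂0, hC₂⟩ := σ.exists_norm_localDeriv_le κ hφ hK hKφ v
  refine ⟨(1 + C₂) * C₁, by positivity, fun u => ?_⟩
  have hp1 : 1 ≤ p := Fact.out
  have mF : AEStronglyMeasurable (fun x => ‖u.fst x‖) (vol g) := (Lp.aestronglyMeasurable _).norm
  have mG : AEStronglyMeasurable (fun x => ‖u.snd x‖) (vol g) := (Lp.aestronglyMeasurable _).norm
  have hsum : eLpNorm (fun x => ‖u.fst x‖ + ‖u.snd x‖) p (vol g) ≤ ENNReal.ofReal ‖u‖ := by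
    refine (eLpNorm_add_le mF mG hp1).trans (le_of_eq ?_)
    rw [eLpNorm_norm, eLpNorm_norm, WithLp.prod_norm_eq_of_L1,
      ENNReal.ofReal_add (norm_nonneg _) (norm_nonneg _), Lp.norm_def, Lp.norm_def,
      ENNReal.ofReal_toReal (Lp.eLpNorm_ne_top _), ENNReal.ofReal_toReal (Lp.eLpNorm_ne_top _)]
  have hmain := (hC₁ _ (mF.add mG)).trans (mul_le_mul_right hsum _)
  rw [← ENNReal.ofReal_mul hC₁0] at hmain
  have hnn : 0 ≤ C₁ * ‖u‖ := by positivity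
  constructor
  · have h1 : eLpNorm (σ.localSec κ i φ u.fst) p (volume.restrict K) ≤
        eLpNorm (fun y => ‖u.fst (φ.symm y)‖ + ‖u.snd (φ.symm y)‖) p (volume.restrict K) :=
      eLpNorm_mono_real fun y =>
        (σ.norm_endRep_le κ i _ _).trans (le_add_of_nonneg_right (norm_nonneg _))
    refine (h1.trans hmain).trans (ENNReal.ofReal_le_ofReal ?_)
    nlinarith
  · have h1 : eLpNorm (σ.localDeriv κ i φ v u.fst u.snd) p (volume.restrict K) ≤
        eLpNorm (fun y => C₂ • (‖u.fst (φ.symm y)‖ + ‖u.snd (φ.symm y)‖)) p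
          (volume.restrict K) := by
      refine eLpNorm_mono_ae_real ?_
      filter_upwards [ae_restrict_mem hK.measurableSet] with y hy
      exact hC₂ _ _ y hy
    have h2 : eLpNorm (fun y => C₂ • (‖u.fst (φ.symm y)‖ + ‖u.snd (φ.symm y)‖)) p
        (volume.restrict K) ≤ ENNReal.ofReal C₂ * ENNReal.ofReal (C₁ * ‖u‖) := by
      refine (eLpNorm_const_smul_le (c := C₂)
        (f := fun y => ‖u.fst (φ.symm y)‖ + ‖u.snd (φ.symm y)‖)).trans ?_
      rw [Real.enorm_of_nonneg hC₂0]
      exact mul_le_mul_right hmain _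
    refine (h1.trans h2).trans ?_
    rw [← ENNReal.ofReal_mul hC₂0]
    refine ENNReal.ofReal_le_ofReal ?_
    nlinarith

/-- **Morrey's inequality** on a closed manifold: sections of class `W^{1,p}`, `p > n`, are
bounded. -/
theorem exists_norm_sec_le [CompactSpace M] (hp : (n : ℝ≥0∞) < p) (hpt : p ≠ ⊤) :
    ∃ C : ℝ, 0 ≤ C ∧ ∀ u : σ.W1p κ p, ∀ᵐ x ∂vol g, ‖sec u x‖ ≤ C * ‖u‖ := by
  have hp1 : 1 ≤ p := Fact.out
  have hloc : ∀ x : M, ∃ (K : Set (E n)) (C : ℝ), IsCompact K ∧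
      {z | z ∈ (chartAt (E n) x).source ∧ chartAt (E n) x z ∈ K} ∈ 𝓝 x ∧ 0 ≤ C ∧
      ∀ u : σ.W1p κ p, ∀ᵐ y ∂volume.restrict K,
        ‖sec u ((chartAt (E n) x).symm y)‖ ≤ C * ‖u‖ := by
    intro x
    set φ := chartAt (E n) x with hφdef
    have hφ : φ ∈ atlas (E n) M := chart_mem_atlas _ x
    have hxs : x ∈ φ.source := mem_chart_source _ x
    set i := σ.indexAt x
    have hopen := σ.isOpen_localDom i φ
    have hy : φ x ∈ σ.localDom i φ := by
      refine ⟨φ.map_source hxs, ?_⟩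
      rw [mem_preimage, φ.left_inv hxs]
      exact σ.mem_U_indexAt x
    obtain ⟨r, hr, hrs⟩ := Metric.nhds_basis_closedBall.mem_iff.1 (hopen.mem_nhds hy)
    have hKc : IsCompact (Metric.closedBall (φ x) r) := isCompact_closedBall _ _
    obtain ⟨R, hR, hRs⟩ := hKc.exists_cthickening_subset_open hopen hrs
    have hK'c : IsCompact (Metric.cthickening R (Metric.closedBall (φ x) r)) := hKc.cthickening
    obtain ⟨C₁, hC₁0, hC₁⟩ := exists_morrey_bound n hp1 hp hpt hR
    choose C₂ hC₂0 hC₂ using fun v => σ.exists_eLpNorm_local_le κ p hpt hφ hK'c hRs v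
    -- One constant for the section and all its partial derivatives. The bound for the section does
    -- not involve a direction, so `v = 0` supplies it, also when `n = 0`.
    set D : ℝ := C₂ 0 + ∑ a : Fin n, C₂ (EuclideanSpace.single a 1) with hD
    have hD0 : 0 ≤ D := add_nonneg (hC₂0 0) (Finset.sum_nonneg fun a _ => hC₂0 _)
    refine ⟨Metric.closedBall (φ x) r, C₁ * D, hKc, ?_, by positivity, fun u => ?_⟩
    · exact inter_mem (φ.open_source.mem_nhds hxs)
        ((φ.continuousAt hxs).preimage_mem_nhds (Metric.closedBall_mem_nhds _ hr))
    · have hu := (σ.hasWeakCovDeriv_iff κ).1 u.2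
      have h1 := hC₁ hKc hRs (u := σ.localSec κ i φ u.1.fst)
        (u' := fun a => σ.localDeriv κ i φ (EuclideanSpace.single a 1) u.1.fst u.1.snd)
        (fun a => hu i φ hφ _) (hu i φ hφ 0).1 (D * ‖u‖) (by positivity)
        (((hC₂ 0 u.1).1).trans (ENNReal.ofReal_le_ofReal (mul_le_mul_of_nonneg_right
          (le_add_of_nonneg_right (Finset.sum_nonneg fun a _ => hC₂0 _)) (norm_nonneg _))))
        (fun a => ((hC₂ _ u.1).2).trans (ENNReal.ofReal_le_ofReal (mul_le_mul_of_nonneg_right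
          ((Finset.single_le_sum (f := fun a : Fin n => C₂ (EuclideanSpace.single a 1))
            (fun a _ => hC₂0 _) (Finset.mem_univ a)).trans
            (le_add_of_nonneg_left (hC₂0 0))) (norm_nonneg _))))
      filter_upwards [h1, ae_restrict_mem hKc.measurableSet] with y hy1 hy2
      refine (σ.le_norm_endRep κ (hrs hy2).2 _).trans (hy1.trans (le_of_eq ?_))
      ring
  choose K C hK hnhds hC0 hC using hloc
  -- Compactness leaves finitely many charts, hence one constant and a union of finitely many null
  -- sets.
  obtain ⟨t, ht⟩ := CompactSpace.elim_nhds_subcover _ hnhds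
  refine ⟨∑ x ∈ t, C x, Finset.sum_nonneg fun x _ => hC0 x, fun u => ?_⟩
  refine ae_vol_of_ae_charts g (ι := t) (φ := fun x => chartAt (E n) (x : M))
    (fun x => chart_mem_atlas _ _) (K := fun x => K x) (fun x => (hK x).measurableSet) ?_ ?_
  · intro z
    have hz : z ∈ ⋃ x ∈ t, {z | z ∈ (chartAt (E n) x).source ∧ chartAt (E n) x z ∈ K x} := by
      rw [ht]
      trivial
    obtain ⟨x, hx, hzx⟩ := mem_iUnion₂.1 hz
    exact ⟨⟨x, hx⟩, hzx⟩
  · intro x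
    have h0 : 0 ≤ ‖u‖ := norm_nonneg u
    have hle : C x ≤ ∑ x ∈ t, C x := Finset.single_le_sum (f := C) (fun x _ => hC0 x) x.2
    filter_upwards [hC x u] with y hy
    exact hy.trans (mul_le_mul_of_nonneg_right hle h0)

end Sobolev

end SpinStructure

end SpinGeom

/-! ### Completeness of the Sobolev space. -/

namespace SpinGeom

/-- On the compact support of `ζ`, Hölder turns `L^p` convergence into `L¹` convergence, with factor
`|K|^{1 - 1/p}`. -/
theorem tendsto_setIntegral_smul_of_eLpNorm {n : ℕ} {X : Type*} [NormedAddCommGroup X]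
    [NormedSpace ℝ X] {p : ℝ≥0∞} (hp : 1 ≤ p) {Ω : Set (E n)} {ζ : E n → ℝ} (hζ : Continuous ζ)
    (hc : HasCompactSupport ζ) (hs : tsupport ζ ⊆ Ω) {f : E n → X} {F : ℕ → E n → X}
    (hf : LocallyIntegrableOn f Ω) (hF : ∀ k, LocallyIntegrableOn (F k) Ω)
    (hlim : Tendsto (fun k => eLpNorm (F k - f) p (volume.restrict (tsupport ζ))) atTop (𝓝 0)) :
    Tendsto (fun k => ∫ y in Ω, ζ y • F k y) atTop (𝓝 (∫ y in Ω, ζ y • f y)) := by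
  set K := tsupport ζ
  have hK : IsCompact K := hc
  have hΩK : ∀ h : E n → X, ∫ y in Ω, ζ y • h y = ∫ y in K, ζ y • h y := by
    intro h
    rw [setIntegral_eq_integral_of_forall_compl_eq_zero fun y hy => by
        rw [image_eq_zero_of_notMem_tsupport fun h => hy (hs h), zero_smul],
      setIntegral_eq_integral_of_forall_compl_eq_zero fun y hy => by
        rw [image_eq_zero_of_notMem_tsupport hy, zero_smul]]
  obtain ⟨D, hD⟩ := hc.exists_bound_of_continuous hζ
  have hint : ∀ h : E n → X, LocallyIntegrableOn h Ω → IntegrableOn (fun y => ζ y • h y) K :=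
    fun h hh => (hh.integrableOn_compact_subset hs hK).continuousOn_smul hζ.continuousOn hK
  simp_rw [hΩK]
  refine tendsto_integral_of_L1' _ (hint f hf).aestronglyMeasurable (Eventually.of_forall fun k => hint _ (hF k)) ?_
  have hmeas : ∀ k, AEStronglyMeasurable (F k - f) (volume.restrict K) := fun k =>
    ((hF k).integrableOn_compact_subset hs hK).aestronglyMeasurable.sub
      (hf.integrableOn_compact_subset hs hK).aestronglyMeasurable
  set c : ℝ≥0∞ := volume K ^ (1 / (1 : ℝ≥0∞).toReal - 1 / p.toReal)
  have hc : c ≠ ⊤ := by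
    refine ENNReal.rpow_ne_top_of_nonneg ?_ hK.measure_lt_top.ne
    rcases eq_or_ne p ⊤ with rfl | hpt
    · simp
    · have h1 : 1 ≤ p.toReal := by simpa using ENNReal.toReal_mono hpt hp
      rw [ENNReal.toReal_one, div_one, sub_nonneg]
      exact (div_le_one (by linarith)).2 h1
  have hbound : ∀ k, eLpNorm (fun y => ζ y • F k y - ζ y • f y) 1 (volume.restrict K) ≤
      ENNReal.ofReal D * (eLpNorm (F k - f) p (volume.restrict K) * c) := by
    intro k
    have h1 : eLpNorm (fun y => ζ y • F k y - ζ y • f y) 1 (volume.restrict K) ≤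
        ENNReal.ofReal D * eLpNorm (F k - f) 1 (volume.restrict K) := by
      refine eLpNorm_le_mul_eLpNorm_of_ae_le_mul (Eventually.of_forall fun y => ?_) 1
      rw [← smul_sub, norm_smul]
      exact mul_le_mul_of_nonneg_right (hD y) (norm_nonneg _)
    refine h1.trans ?_
    gcongr
    have h2 := eLpNorm_le_eLpNorm_mul_rpow_measure_univ hp (hmeas k)
    rwa [Measure.restrict_apply_univ] at h2
  refine tendsto_of_tendsto_of_tendsto_of_le_of_le tendsto_const_nhds ?_ (fun _ => zero_le)
    hbound
  have h3 := ENNReal.Tendsto.const_mul (a := ENNReal.ofReal D)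
    (ENNReal.Tendsto.mul_const (b := c) hlim (Or.inr hc)) (Or.inr ENNReal.ofReal_ne_top)
  simpa using h3

namespace SpinStructure

section Complete

variable {n : ℕ} {M : Type*} [TopologicalSpace M] [ChartedSpace (E n) M]
  [IsManifold (𝓡 n) ∞ M] {g : RMetric n M} (σ : SpinStructure g) {V : Type*}
  [NormedAddCommGroup V] [InnerProductSpace ℝ V] (κ : SpinorRep n V)

theorem endRep_sub (i : ℕ) (x : M) (B C : EndSpinor V) :
    σ.endRep κ i x (B - C) = σ.endRep κ i x B - σ.endRep κ i x C := by
  simp only [endRep, mul_sub, sub_mul]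

theorem continuous_endRep (i : ℕ) (x : M) : Continuous (σ.endRep κ i x) := by
  unfold endRep
  fun_prop

theorem localSec_sub (i : ℕ) (φ : OpenPartialHomeomorph M (E n)) (F F' : M → EndSpinor V) :
    σ.localSec κ i φ (F - F') = σ.localSec κ i φ F - σ.localSec κ i φ F' := by
  funext y
  simp [localSec, endRep_sub]

theorem localDeriv_sub (i : ℕ) (φ : OpenPartialHomeomorph M (E n)) (v : E n)
    (F F' : M → EndSpinor V) (G G' : M → (E n →L[ℝ] EndSpinor V)) :
    σ.localDeriv κ i φ v (F - F') (G - G') =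
      σ.localDeriv κ i φ v F G - σ.localDeriv κ i φ v F' G' := by
  funext y
  simp only [localDeriv, localSec_sub, Pi.sub_apply, sub_apply, endRep_sub, mul_sub, sub_mul]
  abel

variable [MeasurableSpace M] (p : ℝ≥0∞) [Fact (1 ≤ p)]

theorem exists_subseq_tendsto_ae
    {u : ℕ → WithLp 1 (Lp (EndSpinor V) p (vol g) × Lp (E n →L[ℝ] EndSpinor V) p (vol g))}
    {w : WithLp 1 (Lp (EndSpinor V) p (vol g) × Lp (E n →L[ℝ] EndSpinor V) p (vol g))}
    (h : Tendsto u atTop (𝓝 w)) : ∃ ns : ℕ → ℕ, ∀ᵐ x ∂vol g,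
      Tendsto (fun k => (u (ns k)).fst x) atTop (𝓝 (w.fst x)) ∧
      Tendsto (fun k => (u (ns k)).snd x) atTop (𝓝 (w.snd x)) := by
  have h1 : Tendsto (fun k => (u k).fst) atTop (𝓝 w.fst) :=
    ((WithLp.continuous_fst 1 _ _).tendsto w).comp h
  have h2 : Tendsto (fun k => (u k).snd) atTop (𝓝 w.snd) :=
    ((WithLp.continuous_snd 1 _ _).tendsto w).comp h
  obtain ⟨ns, hns, hae⟩ := (tendstoInMeasure_of_tendsto_Lp h1).exists_seq_tendsto_ae
  obtain ⟨ms, hms, hae'⟩ :=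
    (tendstoInMeasure_of_tendsto_Lp (h2.comp hns.tendsto_atTop)).exists_seq_tendsto_ae
  refine ⟨ns ∘ ms, ?_⟩
  filter_upwards [hae, hae'] with x hx hx'
  exact ⟨hx.comp hms.tendsto_atTop, hx'⟩

variable [BorelSpace M] [CompleteSpace V]

/-- Both sides of the integration by parts formula are continuous for local `L^p` convergence, which
the global norm controls by `exists_eLpNorm_local_le`. -/
theorem isClosed_W1p (hpt : p ≠ ⊤) : IsClosed (σ.W1p κ p : Set (WithLp 1
    (Lp (EndSpinor V) p (vol g) × Lp (E n →L[ℝ] EndSpinor V) p (vol g)))) := by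
  have hp1 : 1 ≤ p := Fact.out
  refine IsSeqClosed.isClosed fun u w hu hlim => ?_
  have hu' : ∀ k, _ := fun k => (σ.hasWeakCovDeriv_iff κ).1 (hu k)
  refine (σ.hasWeakCovDeriv_iff κ).2 fun i φ hφ v => ?_
  have hopen := σ.isOpen_localDom i φ
  obtain ⟨ns, hns⟩ := exists_subseq_tendsto_ae p hlim
  have hae := ae_restrict_of_ae_restrict_of_subset
    (inter_subset_left : σ.localDom i φ ⊆ φ.target) (ae_chart_of_ae_vol g hφ hns)
  -- Local expressions involve the choice `indexAt`; their measurability is inherited from the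
  -- approximating sections through an almost everywhere convergent subsequence.
  have mS : AEStronglyMeasurable (σ.localSec κ i φ w.fst) (volume.restrict (σ.localDom i φ)) := by
    refine aestronglyMeasurable_of_tendsto_ae atTop
      (f := fun k => σ.localSec κ i φ (u (ns k)).fst)
      (fun k => (hu' (ns k) i φ hφ v).1.aestronglyMeasurable) ?_
    filter_upwards [hae] with y hy
    exact ((σ.continuous_endRep κ i _).tendsto _).comp hy.1
  have mD : AEStronglyMeasurable (σ.localDeriv κ i φ v w.fst w.snd)
      (volume.restrict (σ.localDom i φ)) := by
    refine aestronglyMeasurable_of_tendsto_ae atTop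
      (f := fun k => σ.localDeriv κ i φ v (u (ns k)).fst (u (ns k)).snd)
      (fun k => (hu' (ns k) i φ hφ v).2.aestronglyMeasurable) ?_
    filter_upwards [hae] with y hy
    have h1 : Tendsto (fun k => σ.localSec κ i φ (u (ns k)).fst y) atTop
        (𝓝 (σ.localSec κ i φ w.fst y)) := ((σ.continuous_endRep κ i _).tendsto _).comp hy.1
    have h2 := (((σ.continuous_endRep κ i (φ.symm y)).tendsto _).comp
      (((ContinuousLinearMap.apply ℝ (EndSpinor V)
        (σ.coord (σ.indexAt (φ.symm y)) (φ.symm y) (coordVec φ y v))).continuous.tendsto _).comp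
          hy.2))
    exact h2.sub ((h1.const_mul _).sub (h1.mul_const _))
  have hint : ∀ f : E n → EndSpinor V,
      AEStronglyMeasurable f (volume.restrict (σ.localDom i φ)) →
      (∀ K ⊆ σ.localDom i φ, IsCompact K → eLpNorm f p (volume.restrict K) < ⊤) →
      LocallyIntegrableOn f (σ.localDom i φ) := by
    intro f hf hb
    refine (locallyIntegrableOn_iff hopen.isLocallyClosed).2 fun K hK hKc => ?_
    have : IsFiniteMeasure (volume.restrict K) := ⟨by simpa using hKc.measure_lt_top⟩
    exact MemLp.integrable hp1 ⟨hf.mono_set hK, hb K hK hKc⟩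
  have lS : LocallyIntegrableOn (σ.localSec κ i φ w.fst) (σ.localDom i φ) := by
    refine hint _ mS fun K hK hKc => ?_
    obtain ⟨C, -, hC⟩ := σ.exists_eLpNorm_local_le κ p hpt hφ hKc hK v
    exact (hC w).1.trans_lt ENNReal.ofReal_lt_top
  have lD : LocallyIntegrableOn (σ.localDeriv κ i φ v w.fst w.snd) (σ.localDom i φ) := by
    refine hint _ mD fun K hK hKc => ?_
    obtain ⟨C, -, hC⟩ := σ.exists_eLpNorm_local_le κ p hpt hφ hKc hK v
    exact (hC w).2.trans_lt ENNReal.ofReal_lt_top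
  refine ⟨lS, lD, fun η hη hc hs => ?_⟩
  have key : ∀ ζ : E n → ℝ, HasCompactSupport ζ → tsupport ζ ⊆ σ.localDom i φ →
      Tendsto (fun k => eLpNorm (σ.localSec κ i φ (u k).fst - σ.localSec κ i φ w.fst) p
        (volume.restrict (tsupport ζ))) atTop (𝓝 0) ∧
      Tendsto (fun k => eLpNorm (σ.localDeriv κ i φ v (u k).fst (u k).snd -
        σ.localDeriv κ i φ v w.fst w.snd) p (volume.restrict (tsupport ζ))) atTop (𝓝 0) := by
    intro ζ hζ hζs
    obtain ⟨C, -, hC⟩ := σ.exists_eLpNorm_local_le κ p hpt hφ hζ hζs v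
    have h0 : Tendsto (fun k => ENNReal.ofReal (C * ‖u k - w‖)) atTop (𝓝 0) := by
      have h1 : Tendsto (fun k => C * ‖u k - w‖) atTop (𝓝 (C * 0)) :=
        ((tendsto_iff_norm_sub_tendsto_zero.1 hlim)).const_mul C
      have h2 := (ENNReal.continuous_ofReal.tendsto _).comp h1
      simpa [Function.comp_def] using h2
    -- Subtraction in `Lp` is pointwise only almost everywhere on `M`, and this null set must be
    -- transported to the chart.
    have hsubae : ∀ k, ∀ᵐ y ∂volume.restrict (tsupport ζ),
        (u k - w).fst (φ.symm y) = ((u k).fst - w.fst : M → EndSpinor V) (φ.symm y) ∧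
        (u k - w).snd (φ.symm y) = ((u k).snd - w.snd : M → (E n →L[ℝ] EndSpinor V))
          (φ.symm y) := by
      intro k
      refine ae_restrict_of_ae_restrict_of_subset (hζs.trans inter_subset_left)
        (ae_chart_of_ae_vol g hφ (P := fun x => (u k - w).fst x =
          ((u k).fst - w.fst : M → EndSpinor V) x ∧ (u k - w).snd x =
          ((u k).snd - w.snd : M → (E n →L[ℝ] EndSpinor V)) x) ?_)
      exact (Lp.coeFn_sub (u k).fst w.fst).and (Lp.coeFn_sub (u k).snd w.snd)
    constructor
    · refine tendsto_of_tendsto_of_tendsto_of_le_of_le tendsto_const_nhds h0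
        (fun _ => zero_le) fun k => ?_
      refine le_trans (le_of_eq ?_) (hC (u k - w)).1
      rw [← localSec_sub]
      refine eLpNorm_congr_ae ?_
      filter_upwards [hsubae k] with y hy
      simp only [localSec, hy.1]
    · refine tendsto_of_tendsto_of_tendsto_of_le_of_le tendsto_const_nhds h0
        (fun _ => zero_le) fun k => ?_
      refine le_trans (le_of_eq ?_) (hC (u k - w)).2
      rw [← localDeriv_sub]
      refine eLpNorm_congr_ae ?_
      filter_upwards [hsubae k] with y hy
      simp only [localDeriv, localSec, hy.1, hy.2]
  have hdc : Continuous fun y => fderiv ℝ η y v :=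
    (hη.continuous_fderiv (by simp)).clm_apply continuous_const
  have hds : tsupport (fun y => fderiv ℝ η y v) ⊆ σ.localDom i φ :=
    (tsupport_fderiv_apply_subset ℝ v).trans hs
  have T1 := tendsto_setIntegral_smul_of_eLpNorm hp1 hdc (hc.fderiv_apply (𝕜 := ℝ) v) hds lS
    (fun k => (hu' k i φ hφ v).1) (key _ (hc.fderiv_apply (𝕜 := ℝ) v) hds).1
  have T2 := tendsto_setIntegral_smul_of_eLpNorm hp1 hη.continuous hc hs lD
    (fun k => (hu' k i φ hφ v).2) (key _ hc hs).2
  exact tendsto_nhds_unique T1 (T2.neg.congr fun k => ((hu' k i φ hφ v).3 η hη hc hs).symm)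

theorem completeSpace_W1p (hpt : p ≠ ⊤) : CompleteSpace (σ.W1p κ p) :=
  (σ.isClosed_W1p κ p hpt).completeSpace_coe

end Complete

end SpinStructure

end SpinGeom

/-! ### The Leibniz rule for weak covariant derivatives. -/

namespace SpinGeom

theorem HasWeakDeriv.congr {n : ℕ} {X : Type*} [NormedAddCommGroup X] [NormedSpace ℝ X]
    {Ω : Set (E n)} (hΩ : MeasurableSet Ω) {v : E n} {u u' w w' : E n → X}
    (h : HasWeakDeriv Ω v u u') (hu : EqOn u w Ω) (hu' : EqOn u' w' Ω) : HasWeakDeriv Ω v w w' := by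
  have e : u =ᵐ[volume.restrict Ω] w := by
    filter_upwards [ae_restrict_mem hΩ] with y hy using hu hy
  have e' : u' =ᵐ[volume.restrict Ω] w' := by
    filter_upwards [ae_restrict_mem hΩ] with y hy using hu' hy
  refine ⟨h.1.congr e, h.2.congr e', fun η hη hc hs => ?_⟩
  have := h.3 η hη hc hs
  rwa [setIntegral_congr_fun hΩ fun y hy => by rw [hu hy],
    setIntegral_congr_fun hΩ (f := fun y => η y • u' y) (g := fun y => η y • w' y)
      fun y hy => by simp only [hu' hy]] at this

/-- Multiplication of `End`-valued linear forms by endomorphisms from the left. -/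
noncomputable def formMulLeft (n : ℕ) (V : Type*) [NormedAddCommGroup V] [InnerProductSpace ℝ V] :
    EndSpinor V →L[ℝ] (E n →L[ℝ] EndSpinor V) →L[ℝ] (E n →L[ℝ] EndSpinor V) :=
  (ContinuousLinearMap.compL ℝ (E n) (EndSpinor V) (EndSpinor V)) ∘L
    (ContinuousLinearMap.mul ℝ (EndSpinor V))

/-- Multiplication of `End`-valued linear forms by endomorphisms from the right. -/
noncomputable def formMulRight (n : ℕ) (V : Type*) [NormedAddCommGroup V] [InnerProductSpace ℝ V] :
    EndSpinor V →L[ℝ] (E n →L[ℝ] EndSpinor V) →L[ℝ] (E n →L[ℝ] EndSpinor V) :=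
  (ContinuousLinearMap.compL ℝ (E n) (EndSpinor V) (EndSpinor V)) ∘L
    (ContinuousLinearMap.mul ℝ (EndSpinor V)).flip

section

variable {n : ℕ} {V : Type*} [NormedAddCommGroup V] [InnerProductSpace ℝ V]

@[simp] theorem formMulLeft_apply (B : EndSpinor V) (G : E n →L[ℝ] EndSpinor V) (v : E n) :
    formMulLeft n V B G v = B * G v := rfl

@[simp] theorem formMulRight_apply (B : EndSpinor V) (G : E n →L[ℝ] EndSpinor V) (v : E n) :
    formMulRight n V B G v = G v * B := rfl

theorem formMulLeft_one (G : E n →L[ℝ] EndSpinor V) : formMulLeft n V 1 G = G := by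
  ext1 v
  rw [formMulLeft_apply, one_mul]

theorem norm_formMulLeft_le (B : EndSpinor V) (G : E n →L[ℝ] EndSpinor V) :
    ‖formMulLeft n V B G‖ ≤ ‖B‖ * ‖G‖ := by
  refine ContinuousLinearMap.opNorm_le_bound _ (by positivity) fun v => ?_
  rw [formMulLeft_apply, mul_assoc]
  exact (norm_mul_le _ _).trans
    (mul_le_mul_of_nonneg_left (ContinuousLinearMap.le_opNorm _ _) (norm_nonneg _))

end

namespace SpinStructure

section Multiplication

variable {n : ℕ} {M : Type*} [TopologicalSpace M] [ChartedSpace (E n) M]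
  [IsManifold (𝓡 n) ∞ M] {g : RMetric n M} {σ : SpinStructure g} {V : Type*}
  [NormedAddCommGroup V] [InnerProductSpace ℝ V] {κ : SpinorRep n V}

/-- In a frame this is the Euclidean Leibniz rule, since passing to the frame is multiplicative and
the commutator with the connection form is a derivation. -/
theorem HasWeakCovDeriv.mul [CompleteSpace V] [MeasurableSpace M] [BorelSpace M]
    {F F' : M → EndSpinor V} {G G' : M → (E n →L[ℝ] EndSpinor V)}
    (h : σ.HasWeakCovDeriv κ F G) (h' : σ.HasWeakCovDeriv κ F' G') {C C' : ℝ}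
    (hC : ∀ᵐ x ∂vol g, ‖F x‖ ≤ C) (hC' : ∀ᵐ x ∂vol g, ‖F' x‖ ≤ C') :
    σ.HasWeakCovDeriv κ (fun x => F x * F' x)
      (fun x => formMulLeft n V (F x) (G' x) + formMulRight n V (F' x) (G x)) := by
  rw [hasWeakCovDeriv_iff] at h h' ⊢
  intro i φ hφ v
  have hopen := σ.isOpen_localDom i φ
  have hb : ∀ {F : M → EndSpinor V} {C : ℝ}, (∀ᵐ x ∂vol g, ‖F x‖ ≤ C) →
      ∀ᵐ y ∂volume.restrict (σ.localDom i φ), ‖σ.localSec κ i φ F y‖ ≤ C := by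
    intro F C hC
    filter_upwards [ae_restrict_of_ae_restrict_of_subset
      (inter_subset_left : σ.localDom i φ ⊆ φ.target) (ae_chart_of_ae_vol g hφ hC)] with y hy
    exact (σ.norm_endRep_le κ i _ _).trans hy
  refine ((h i φ hφ v).mul hopen (h' i φ hφ v) (hb hC) (hb hC')).congr hopen.measurableSet ?_ ?_
  · intro y hy
    exact (σ.endRep_mul κ hy.2 _ _).symm
  · intro y hy
    simp only [localDeriv, localSec, add_apply, formMulLeft_apply, formMulRight_apply, endRep_add,
      σ.endRep_mul κ hy.2]
    noncomm_ring

end Multiplication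

end SpinStructure

end SpinGeom

namespace SpinGeom

/-! ### Bounded pairs `(F, G)` of `L^p` functions, multiplied by the Leibniz rule -/

section PairAlgebra

variable {α : Type*} [MeasurableSpace α] {μ : Measure α} {p : ℝ≥0∞} [Fact (1 ≤ p)]
  {𝔸 Y : Type*} [NormedRing 𝔸] [NormedAlgebra ℝ 𝔸] [NormedAddCommGroup Y] [NormedSpace ℝ Y]
  {W : Submodule ℝ (WithLp 1 (Lp 𝔸 p μ × Lp Y p μ))} {C : ℝ}

/-- The inclusion of a space of bounded pairs into `L^∞`, as a linear map. -/
noncomputable def pairToLinftyₗ (hC : ∀ u : W, ∀ᵐ x ∂μ, ‖u.1.fst x‖ ≤ C * ‖u‖) :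
    W →ₗ[ℝ] Lp 𝔸 ∞ μ where
  toFun u := (memLp_top_of_bound (Lp.aestronglyMeasurable u.1.fst) _ (hC u)).toLp u.1.fst
  map_add' u w := by
    rw [← MemLp.toLp_add]
    exact MemLp.toLp_congr _ _ (Lp.coeFn_add u.1.fst w.1.fst)
  map_smul' c u := by
    rw [RingHom.id_apply, ← MemLp.toLp_const_smul]
    exact MemLp.toLp_congr _ _ (Lp.coeFn_smul c u.1.fst)

theorem norm_pairToLinftyₗ_le (hC0 : 0 ≤ C) (hC : ∀ u : W, ∀ᵐ x ∂μ, ‖u.1.fst x‖ ≤ C * ‖u‖)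
    (u : W) : ‖pairToLinftyₗ hC u‖ ≤ C * ‖u‖ := by
  have h1 : eLpNorm u.1.fst ∞ μ ≤ ENNReal.ofReal (C * ‖u‖) := by
    rw [eLpNorm_exponent_top]
    exact eLpNormEssSup_le_of_ae_bound (hC u)
  refine le_of_eq_of_le (Lp.norm_toLp _
    (memLp_top_of_bound (Lp.aestronglyMeasurable u.1.fst) _ (hC u)))
    (ENNReal.toReal_le_of_le_ofReal (mul_nonneg hC0 (norm_nonneg u)) h1)

/-- The inclusion of a space of bounded pairs into `L^∞`. -/
noncomputable def pairToLinfty (hC0 : 0 ≤ C) (hC : ∀ u : W, ∀ᵐ x ∂μ, ‖u.1.fst x‖ ≤ C * ‖u‖) :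
    W →L[ℝ] Lp 𝔸 ∞ μ :=
  (pairToLinftyₗ hC).mkContinuous C (norm_pairToLinftyₗ_le hC0 hC)

theorem pairToLinfty_ae (hC0 : 0 ≤ C) (hC : ∀ u : W, ∀ᵐ x ∂μ, ‖u.1.fst x‖ ≤ C * ‖u‖) (u : W) :
    pairToLinfty hC0 hC u =ᵐ[μ] u.1.fst :=
  MemLp.coeFn_toLp (memLp_top_of_bound (Lp.aestronglyMeasurable u.1.fst) _ (hC u))

/-- The product of two pairs. -/
noncomputable def pairMul (L R : 𝔸 →L[ℝ] Y →L[ℝ] Y) (ι : W →L[ℝ] Lp 𝔸 ∞ μ) (u w : W) :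
    WithLp 1 (Lp 𝔸 p μ × Lp Y p μ) :=
  -- Every product pairs a factor read through `ι` in `L^∞` with one in `L^p`.
  WithLp.toLp 1 ((ContinuousLinearMap.mul ℝ 𝔸).holder p (ι u) w.1.fst,
    L.holder p (ι u) w.1.snd + R.holder p (ι w) u.1.snd)

theorem norm_pair (u : W) : ‖u‖ = ‖u.1.fst‖ + ‖u.1.snd‖ := WithLp.prod_norm_eq_of_L1 _

theorem norm_fst_le (u : W) : ‖u.1.fst‖ ≤ ‖u‖ := by
  rw [norm_pair]
  exact le_add_of_nonneg_right (norm_nonneg _)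

theorem norm_snd_le (u : W) : ‖u.1.snd‖ ≤ ‖u‖ := by
  rw [norm_pair]
  exact le_add_of_nonneg_left (norm_nonneg _)

/-- The product of pairs as a bilinear map. -/
noncomputable def pairMulₗ (L R : 𝔸 →L[ℝ] Y →L[ℝ] Y) (ι : W →L[ℝ] Lp 𝔸 ∞ μ)
    (h : ∀ u w : W, pairMul L R ι u w ∈ W) : W →ₗ[ℝ] W →ₗ[ℝ] W :=
  LinearMap.mk₂ ℝ (fun u w => ⟨pairMul L R ι u w, h u w⟩)
    (fun u u' w => Subtype.ext <| (WithLp.ofLp_injective 1) <| Prod.ext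
      (by simp [pairMul, ContinuousLinearMap.holder_add_left])
      (by
        simp only [pairMul, map_add, Submodule.coe_add, WithLp.add_snd, WithLp.ofLp_add,
          Prod.snd_add, ContinuousLinearMap.holder_add_left, ContinuousLinearMap.holder_add_right]
        abel))
    (fun c u w => Subtype.ext <| (WithLp.ofLp_injective 1) <| Prod.ext
      (by simp [pairMul, ContinuousLinearMap.holder_smul_left])
      (by simp [pairMul, ContinuousLinearMap.holder_smul_left,
        ContinuousLinearMap.holder_smul_right]))
    (fun u w w' => Subtype.ext <| (WithLp.ofLp_injective 1) <| Prod.ext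
      (by simp [pairMul, ContinuousLinearMap.holder_add_right])
      (by
        simp only [pairMul, map_add, Submodule.coe_add, WithLp.add_snd, WithLp.ofLp_add,
          Prod.snd_add, ContinuousLinearMap.holder_add_left, ContinuousLinearMap.holder_add_right]
        abel))
    (fun c u w => Subtype.ext <| (WithLp.ofLp_injective 1) <| Prod.ext
      (by simp [pairMul, ContinuousLinearMap.holder_smul_right])
      (by simp [pairMul, ContinuousLinearMap.holder_smul_left,
        ContinuousLinearMap.holder_smul_right]))

theorem norm_pairMulₗ_le (L R : 𝔸 →L[ℝ] Y →L[ℝ] Y) (ι : W →L[ℝ] Lp 𝔸 ∞ μ)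
    (h : ∀ u w : W, pairMul L R ι u w ∈ W) (u w : W) :
    ‖pairMulₗ L R ι h u w‖ ≤ ((‖ContinuousLinearMap.mul ℝ 𝔸‖ + ‖L‖ + ‖R‖) * ‖ι‖) * ‖u‖ * ‖w‖ := by
  have h1 : ‖(pairMulₗ L R ι h u w).1.fst‖ ≤ ‖ContinuousLinearMap.mul ℝ 𝔸‖ *
      (‖ι‖ * ‖u‖) * ‖w‖ :=
    (ContinuousLinearMap.norm_holder_apply_apply_le _ (ι u) w.1.fst).trans
      (mul_le_mul (mul_le_mul_of_nonneg_left (ι.le_opNorm u) (norm_nonneg _)) (norm_fst_le w)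
        (norm_nonneg _) (by positivity))
  have h2 : ‖(pairMulₗ L R ι h u w).1.snd‖ ≤ ‖L‖ * (‖ι‖ * ‖u‖) * ‖w‖ +
      ‖R‖ * (‖ι‖ * ‖w‖) * ‖u‖ :=
    (norm_add_le (L.holder p (ι u) w.1.snd) (R.holder p (ι w) u.1.snd)).trans (add_le_add
      ((ContinuousLinearMap.norm_holder_apply_apply_le _ (ι u) w.1.snd).trans
        (mul_le_mul (mul_le_mul_of_nonneg_left (ι.le_opNorm u) (norm_nonneg _)) (norm_snd_le w)
          (norm_nonneg _) (by positivity)))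
      ((ContinuousLinearMap.norm_holder_apply_apply_le _ (ι w) u.1.snd).trans
        (mul_le_mul (mul_le_mul_of_nonneg_left (ι.le_opNorm w) (norm_nonneg _)) (norm_snd_le u)
          (norm_nonneg _) (by positivity))))
  rw [norm_pair]
  refine (add_le_add h1 h2).trans (le_of_eq ?_)
  ring

/-- The product of pairs as a continuous bilinear map. -/
noncomputable def pairMulL (L R : 𝔸 →L[ℝ] Y →L[ℝ] Y) (ι : W →L[ℝ] Lp 𝔸 ∞ μ)
    (h : ∀ u w : W, pairMul L R ι u w ∈ W) : W →L[ℝ] W →L[ℝ] W :=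
  LinearMap.mkContinuous₂ (pairMulₗ L R ι h) _ (norm_pairMulₗ_le L R ι h)

theorem fst_pairMul_ae (L R : 𝔸 →L[ℝ] Y →L[ℝ] Y) {ι : W →L[ℝ] Lp 𝔸 ∞ μ}
    (hι : ∀ u : W, ι u =ᵐ[μ] u.1.fst) (u w : W) :
    (pairMul L R ι u w).fst =ᵐ[μ] fun x => u.1.fst x * w.1.fst x := by
  filter_upwards [(ContinuousLinearMap.mul ℝ 𝔸).coeFn_holder (r := p) (ι u) w.1.fst, hι u]
    with x h1 h2
  refine h1.trans ?_
  rw [h2]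
  rfl

theorem snd_pairMul_ae (L R : 𝔸 →L[ℝ] Y →L[ℝ] Y) {ι : W →L[ℝ] Lp 𝔸 ∞ μ}
    (hι : ∀ u : W, ι u =ᵐ[μ] u.1.fst) (u w : W) :
    (pairMul L R ι u w).snd =ᵐ[μ]
      fun x => L (u.1.fst x) (w.1.snd x) + R (w.1.fst x) (u.1.snd x) := by
  filter_upwards [Lp.coeFn_add (L.holder p (ι u) w.1.snd) (R.holder p (ι w) u.1.snd),
    L.coeFn_holder (r := p) (ι u) w.1.snd, R.coeFn_holder (r := p) (ι w) u.1.snd, hι u, hι w]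
    with x h1 h2 h3 h4 h5
  refine h1.trans ?_
  rw [Pi.add_apply, h2, h3, h4, h5]

/-- If `A` is uniformly close to `c`, then so is multiplication by `A`, up to a multiple of the
`L^∞` norm. -/
theorem norm_pairMulL_sub_le (L R : 𝔸 →L[ℝ] Y →L[ℝ] Y)
    (hL : ∀ a y, ‖L a y‖ ≤ ‖a‖ * ‖y‖) (hL1 : ∀ y, L 1 y = y) {ι : W →L[ℝ] Lp 𝔸 ∞ μ}
    (hι : ∀ u : W, ι u =ᵐ[μ] u.1.fst) (h : ∀ u w : W, pairMul L R ι u w ∈ W) (A : W) {c q : ℝ}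
    (hq : ∀ᵐ x ∂μ, ‖A.1.fst x - c • (1 : 𝔸)‖ ≤ q) (u : W) :
    ‖pairMulL L R ι h A u - c • u‖ ≤ q * ‖u‖ + ‖R‖ * ‖A.1.snd‖ * ‖ι u‖ := by
  have h1 : ‖(pairMulL L R ι h A u - c • u).1.fst‖ ≤ q * ‖u.1.fst‖ := by
    refine Lp.norm_le_mul_norm_of_ae_le_mul ?_
    have e : (pairMulL L R ι h A u - c • u).1.fst = (pairMul L R ι A u).fst - c • u.1.fst := rfl
    rw [e]
    filter_upwards [hq, fst_pairMul_ae L R hι A u,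
      Lp.coeFn_sub (pairMul L R ι A u).fst (c • u.1.fst), Lp.coeFn_smul c u.1.fst]
      with x h1 h2 h3 h4
    rw [h3, Pi.sub_apply, h2, h4, Pi.smul_apply]
    have : A.1.fst x * u.1.fst x - c • u.1.fst x = (A.1.fst x - c • (1 : 𝔸)) * u.1.fst x := by
      rw [sub_mul, smul_mul_assoc, one_mul]
    rw [this]
    exact (norm_mul_le _ _).trans (mul_le_mul_of_nonneg_right h1 (norm_nonneg _))
  have h2 : ‖(pairMulL L R ι h A u - c • u).1.snd‖ ≤ q * ‖u.1.snd‖ +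
      ‖R‖ * ‖ι u‖ * ‖A.1.snd‖ := by
    -- The first summand is multiplication by `A - c`, hence small. The second carries the
    -- derivative of `A` and is controlled by the `L^∞` norm of `u` alone.
    have e : (pairMulL L R ι h A u - c • u).1.snd =
        (L.holder p (ι A) u.1.snd - c • u.1.snd) + R.holder p (ι u) A.1.snd := by
      have e' : (pairMulL L R ι h A u - c • u).1.snd =
          L.holder p (ι A) u.1.snd + R.holder p (ι u) A.1.snd - c • u.1.snd := rfl
      rw [e']
      abel
    rw [e]
    refine (norm_add_le _ _).trans (add_le_add ?_
      (ContinuousLinearMap.norm_holder_apply_apply_le _ _ _))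
    refine Lp.norm_le_mul_norm_of_ae_le_mul ?_
    filter_upwards [hq, hι A, L.coeFn_holder (r := p) (ι A) u.1.snd,
      Lp.coeFn_sub (L.holder p (ι A) u.1.snd) (c • u.1.snd),
      Lp.coeFn_smul c u.1.snd] with x h1 h2 h3 h4 h5
    rw [h4, Pi.sub_apply, h3, h2, h5, Pi.smul_apply]
    have : L (A.1.fst x) (u.1.snd x) - c • u.1.snd x =
        L (A.1.fst x - c • (1 : 𝔸)) (u.1.snd x) := by
      rw [map_sub, map_smul, sub_apply, smul_apply, hL1]
    rw [this]
    exact (hL _ _).trans (mul_le_mul_of_nonneg_right h1 (norm_nonneg _))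
  rw [norm_pair, norm_pair u]
  refine (add_le_add h1 h2).trans (le_of_eq ?_)
  ring

end PairAlgebra

end SpinGeom

namespace SpinGeom

/-! ### The binomial series in a Banach algebra -/

section Binomial

variable {𝔹 : Type*} [NormedRing 𝔹] [NormedAlgebra ℝ 𝔹]

/-- The binomial series `∑ (a choose k) Tᵏ`, that is, `(1 + T)ᵃ`. -/
noncomputable def binom (a : ℝ) (T : 𝔹) : 𝔹 := ∑' k : ℕ, Ring.choose a k • T ^ k

theorem summable_norm_choose_mul_pow (a : ℝ) {r : ℝ} (hr0 : 0 ≤ r) (hr : r < 1) :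
    Summable fun k : ℕ => ‖Ring.choose a k‖ * r ^ k := by
  lift r to NNReal using hr0
  have h : (r : ℝ≥0∞) < (binomialSeries ℝ a).radius :=
    lt_of_lt_of_le (by exact_mod_cast hr) binomialSeries_radius_ge_one
  have := (binomialSeries ℝ a).summable_norm_mul_pow h
  simpa [binomialSeries, FormalMultilinearSeries.ofScalars_norm] using this

theorem summable_norm_binom (a : ℝ) {T : 𝔹} (hT : ‖T‖ < 1) :
    Summable fun k : ℕ => ‖Ring.choose a k • T ^ k‖ := by
  -- The term `k = 0` is dropped because `‖1‖` may exceed 1, so `‖T ^ k‖ ≤ ‖T‖ ^ k` is available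
  -- only for `k > 0`.
  refine (summable_nat_add_iff 1).1 ?_
  refine Summable.of_nonneg_of_le (fun _ => norm_nonneg _) (fun k => ?_)
    ((summable_nat_add_iff 1).2 (summable_norm_choose_mul_pow a (norm_nonneg T) hT))
  rw [norm_smul]
  exact mul_le_mul_of_nonneg_left (norm_pow_le' T (Nat.succ_pos k)) (norm_nonneg _)

theorem hasSum_binom [CompleteSpace 𝔹] (a : ℝ) {T : 𝔹} (hT : ‖T‖ < 1) :
    HasSum (fun k : ℕ => Ring.choose a k • T ^ k) (binom a T) :=
  (summable_norm_binom a hT).of_norm.hasSum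

/-- The Cauchy product of the two series, with Vandermonde's identity for the coefficients. -/
theorem binom_mul_binom [CompleteSpace 𝔹] (a b : ℝ) {T : 𝔹} (hT : ‖T‖ < 1) :
    binom a T * binom b T = binom (a + b) T := by
  unfold binom
  rw [tsum_mul_tsum_eq_tsum_sum_antidiagonal_of_summable_norm (summable_norm_binom a hT)
    (summable_norm_binom b hT)]
  refine tsum_congr fun k => ?_
  rw [Ring.add_choose_eq k (Commute.all a b), Finset.sum_smul]
  refine Finset.sum_congr rfl fun ij hij => ?_
  rw [smul_mul_smul_comm, ← pow_add, Finset.HasAntidiagonal.mem_antidiagonal.1 hij]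

theorem binom_zero (T : 𝔹) : binom 0 T = 1 := by
  unfold binom
  rw [tsum_eq_single 0]
  · simp
  · intro k hk
    rw [Ring.choose_zero_pos _ (Nat.pos_of_ne_zero hk), zero_smul]

theorem binom_one (T : 𝔹) : binom 1 T = 1 + T := by
  unfold binom
  rw [tsum_eq_sum (s := Finset.range 2)]
  · simp [Finset.sum_range_succ]
  · intro k hk
    have hk2 : 1 < k := by simpa [Nat.lt_iff_add_one_le] using hk
    have : Ring.choose (1 : ℝ) k = 0 := by
      have h := Ring.choose_natCast (R := ℝ) 1 k
      rw [Nat.cast_one] at h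
      rw [h, Nat.choose_eq_zero_of_lt hk2, Nat.cast_zero]
    rw [this, zero_smul]

theorem contDiffAt_binom [CompleteSpace 𝔹] (a : ℝ) {T : 𝔹} (hT : ‖T‖ < 1) :
    ContDiffAt ℝ 1 (binom a : 𝔹 → 𝔹) T := by
  set P : FormalMultilinearSeries ℝ 𝔹 𝔹 := binomialSeries 𝔹 a with hP
  have hrad : 1 ≤ P.radius := by
    refine ENNReal.le_of_forall_nnreal_lt fun r hr => ?_
    refine P.le_radius_of_summable_norm ?_
    refine (summable_nat_add_iff 1).1 ?_
    refine Summable.of_nonneg_of_le (fun _ => by positivity) (fun k => ?_)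
      ((summable_nat_add_iff 1).2
        (summable_norm_choose_mul_pow a r.coe_nonneg (by exact_mod_cast hr)))
    refine mul_le_mul_of_nonneg_right ?_ (by positivity)
    exact FormalMultilinearSeries.ofScalars_norm_le _ _ _ (Nat.succ_pos k)
  have hfp := P.hasFPowerSeriesOnBall (lt_of_lt_of_le one_pos hrad)
  have hsum : P.sum = binom a := by
    funext x
    simp [FormalMultilinearSeries.sum, hP, binom]
  rw [hsum] at hfp
  refine (hfp.analyticAt_of_mem ?_).contDiffAt
  refine Metric.eball_subset_eball hrad ?_
  rw [Metric.mem_eball, edist_zero_right]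
  have : ‖T‖ₑ < ENNReal.ofReal 1 := by
    rw [← ofReal_norm]
    exact (ENNReal.ofReal_lt_ofReal_iff one_pos).2 hT
  simpa using this

end Binomial

/-! ### Operators that are contractions for an equivalent norm -/

section Renorm

variable {X Z : Type*} [NormedAddCommGroup X] [NormedSpace ℝ X] [CompleteSpace X]
  [NormedAddCommGroup Z] [NormedSpace ℝ Z]

/-- The norm `‖j x‖` is equivalent to the given one. Conjugation by `X ≃ range j` is a topological
algebra isomorphism that commutes with the series and turns `T` into a contraction. -/
theorem contDiffAt_binom_of_norm_comp_le (a : ℝ) (j : X →L[ℝ] Z) {c : ℝ} (hc : 0 < c)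
    (hj : ∀ x, c * ‖x‖ ≤ ‖j x‖) (T : X →L[ℝ] X) {r : ℝ} (hr0 : 0 ≤ r) (hr : r < 1)
    (hT : ∀ x, ‖j (T x)‖ ≤ r * ‖j x‖) :
    ContDiffAt ℝ 1 (binom a : (X →L[ℝ] X) → (X →L[ℝ] X)) T ∧
      HasSum (fun k : ℕ => Ring.choose a k • T ^ k) (binom a T) := by
  have hinj : Function.Injective (j : X →ₗ[ℝ] Z) := by
    rw [injective_iff_map_eq_zero]
    intro x hx
    have h := hj x
    rw [show j x = 0 from hx, norm_zero] at h
    exact norm_le_zero_iff.1 (by nlinarith [norm_nonneg x])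
  let Y := LinearMap.range (j : X →ₗ[ℝ] Z)
  let e₀ : X ≃ₗ[ℝ] Y := LinearEquiv.ofInjective (j : X →ₗ[ℝ] Z) hinj
  have he₀ : ∀ x, ‖e₀ x‖ = ‖j x‖ := fun x => rfl
  let e : X ≃L[ℝ] Y := e₀.toContinuousLinearEquivOfBounds ‖j‖ c⁻¹
    (fun x => by rw [he₀]; exact j.le_opNorm x)
    (fun y => by
      have h := hj (e₀.symm y)
      rw [← he₀, e₀.apply_symm_apply] at h
      rw [← div_eq_inv_mul, le_div_iff₀ hc, mul_comm]
      exact h)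
  have he : ∀ x, ‖e x‖ = ‖j x‖ := fun x => rfl
  have : CompleteSpace Y :=
    (completeSpace_congr (e := e.toEquiv) e.isUniformEmbedding).1 inferInstance
  let Φ := e.conjContinuousAlgEquiv
  have hΦ : ‖Φ T‖ < 1 := by
    refine lt_of_le_of_lt (ContinuousLinearMap.opNorm_le_bound _ hr0 fun y => ?_) hr
    obtain ⟨x, rfl⟩ := e.surjective y
    rw [ContinuousLinearEquiv.conjContinuousAlgEquiv_apply_apply, e.symm_apply_apply, he, he]
    exact hT x
  let Ψ : (X →L[ℝ] X) ≃L[ℝ] (Y →L[ℝ] Y) := Φ.toContinuousLinearEquiv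
  have hconj : ∀ T, Ψ (binom a T) = binom a (Φ T) := by
    intro T
    unfold binom
    rw [Ψ.map_tsum]
    refine tsum_congr fun k => ?_
    have : Ψ (Ring.choose a k • T ^ k) = Φ (Ring.choose a k • T ^ k) := rfl
    rw [this, map_smul, map_pow]
  have heq : (binom a : (X →L[ℝ] X) → (X →L[ℝ] X)) = fun T => Ψ.symm (binom a (Ψ T)) := by
    funext T
    rw [Ψ.eq_symm_apply, hconj]
    rfl
  constructor
  · rw [heq]
    exact Ψ.symm.contDiff.contDiffAt.comp T
      ((contDiffAt_binom a hΦ).comp T Ψ.contDiff.contDiffAt)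
  · have h := (hasSum_binom a hΦ).mapL (Ψ.symm : (Y →L[ℝ] Y) →L[ℝ] (X →L[ℝ] X))
    have e1 : Ψ.symm (binom a (Φ T)) = binom a T := by
      rw [← hconj, Ψ.symm_apply_apply]
    have e2 : ∀ k : ℕ, Ψ.symm (Ring.choose a k • Φ T ^ k) = Ring.choose a k • T ^ k := by
      intro k
      rw [Ψ.symm_apply_eq]
      have : Ψ (Ring.choose a k • T ^ k) = Φ (Ring.choose a k • T ^ k) := rfl
      rw [this, map_smul, map_pow]
    simpa only [ContinuousLinearEquiv.coe_coe, e1, e2] using h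

/-- An operator that contracts a seminorm `‖ι u‖` and contracts the norm up to a multiple of this
seminorm is in the domain of smoothness of the binomial series. -/
theorem contDiffAt_binom_of_contraction (a : ℝ) (ι : X →L[ℝ] Z) (T : X →L[ℝ] X) {q K : ℝ}
    (hq0 : 0 ≤ q) (hq : q < 1) (h1 : ∀ u, ‖ι (T u)‖ ≤ q * ‖ι u‖)
    (h2 : ∀ u, ‖T u‖ ≤ q * ‖u‖ + K * ‖ι u‖) :
    ContDiffAt ℝ 1 (binom a : (X →L[ℝ] X) → (X →L[ℝ] X)) T ∧
      HasSum (fun k : ℕ => Ring.choose a k • T ^ k) (binom a T) := by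
  -- Chosen so that `δ |K| ≤ (1 - q) / 2`. In the norm `max(‖ι u‖, δ ‖u‖)` the defect `K ‖ι u‖` then
  -- raises the contraction factor only from `q` to `(1 + q) / 2`.
  set δ : ℝ := (1 - q) / (2 * (|K| + 1)) with hδ
  have hδ0 : 0 < δ := div_pos (by linarith) (by positivity)
  have hδK : δ * |K| ≤ (1 - q) / 2 := by
    rw [hδ, div_mul_eq_mul_div, div_le_div_iff₀ (by positivity) two_pos]
    nlinarith [abs_nonneg K]
  refine contDiffAt_binom_of_norm_comp_le a (ι.prod (δ • ContinuousLinearMap.id ℝ X)) hδ0 ?_ T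
    (r := (1 + q) / 2) (by linarith) (by linarith) ?_
  · intro x
    refine le_trans (le_of_eq ?_) (le_max_right _ _)
    simp [norm_smul, abs_of_pos hδ0]
  · intro x
    set N := ‖(ι.prod (δ • ContinuousLinearMap.id ℝ X)) x‖ with hN
    have n1 : ‖ι x‖ ≤ N := le_max_left _ _
    have n2 : δ * ‖x‖ ≤ N := by
      refine le_trans (le_of_eq ?_) (le_max_right _ _)
      simp [norm_smul, abs_of_pos hδ0]
    have hN0 : 0 ≤ N := norm_nonneg _
    refine max_le ?_ ?_
    · have : ‖ι (T x)‖ ≤ (1 + q) / 2 * N := by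
        nlinarith [h1 x, mul_le_mul_of_nonneg_left n1 hq0]
      exact this
    · have e : ‖(δ • ContinuousLinearMap.id ℝ X) (T x)‖ = δ * ‖T x‖ := by
        simp [norm_smul, abs_of_pos hδ0]
      have h3 : K * ‖ι x‖ ≤ |K| * N :=
        mul_le_mul (le_abs_self K) n1 (norm_nonneg _) (abs_nonneg K)
      have h4 : δ * ‖T x‖ ≤ q * (δ * ‖x‖) + δ * (|K| * N) := by
        have := mul_le_mul_of_nonneg_left ((h2 x).trans (add_le_add_right h3 _)) hδ0.le
        nlinarith
      refine e.le.trans (h4.trans ?_)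
      nlinarith [mul_le_mul_of_nonneg_left n2 hq0, mul_le_mul_of_nonneg_right hδK hN0]

end Renorm

end SpinGeom

/-! ### Pointwise operator theory: square roots and the Sylvester equation. -/

namespace SpinGeom

section Pointwise

variable {V : Type*} [NormedAddCommGroup V] [InnerProductSpace ℝ V]

/-- A symmetric operator with numerical radius at most `c` has norm at most `c`. -/
theorem norm_le_of_isSymmetric {T : EndSpinor V} (hT : T.IsSymmetric) {c : ℝ} (hc : 0 ≤ c)
    (h : ∀ x, |inner ℝ (T x) x| ≤ c * ‖x‖ ^ 2) : ‖T‖ ≤ c := by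
  refine ContinuousLinearMap.opNorm_le_bound _ hc fun x => ?_
  by_cases hx : T x = 0
  · rw [hx, norm_zero]
    positivity
  have hTx : 0 < ‖T x‖ := norm_pos_iff.2 hx
  -- Polarization with `T x` rescaled to the length of `x` turns the bound on the quadratic form
  -- into a bound on `‖T x‖`.
  set y := (‖x‖ / ‖T x‖) • T x with hy
  have hyn : ‖y‖ = ‖x‖ := by
    rw [hy, norm_smul, Real.norm_of_nonneg (by positivity), div_mul_cancel₀ _ hTx.ne']
  have hpol : 4 * inner ℝ (T x) y =
      inner ℝ (T (x + y)) (x + y) - inner ℝ (T (x - y)) (x - y) := by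
    have hs : inner ℝ (T y) x = inner ℝ (T x) y := by
      have := hT y x
      simp only [ContinuousLinearMap.coe_coe] at this
      rw [this, real_inner_comm]
    simp only [map_add, map_sub, inner_add_left, inner_add_right, inner_sub_left, inner_sub_right,
      hs]
    ring
  have hpar : ‖x + y‖ ^ 2 + ‖x - y‖ ^ 2 = 2 * (‖x‖ ^ 2 + ‖y‖ ^ 2) := by
    have := parallelogram_law_with_norm ℝ x y
    nlinarith
  have h1 := (abs_le.1 (h (x + y))).2
  have h2 := (abs_le.1 (h (x - y))).1
  have h3 : inner ℝ (T x) y = ‖x‖ * ‖T x‖ := by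
    rw [hy, inner_smul_right, real_inner_self_eq_norm_sq]
    field_simp
  have h4 : ‖x‖ * ‖T x‖ ≤ c * ‖x‖ ^ 2 := by
    rw [hyn] at hpar
    nlinarith
  rcases (norm_nonneg x).eq_or_lt with h0 | h0
  · rw [norm_eq_zero.1 h0.symm] at hx
    exact absurd (map_zero T) hx
  · nlinarith

/-- The quadratic form of `B - Λ₂` lies between `-(Λ₂ - Λ₁)` and 0 on unit vectors. Centring at `Λ₂`
makes `B / Λ₂ - 1` strictly smaller than 1 in norm. -/
theorem norm_sub_smul_one_le {B : EndSpinor V} (hB : B.IsSymmetric) {Λ₁ Λ₂ : ℝ} (hΛ : Λ₁ ≤ Λ₂)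
    (h1 : Λ₁ • (1 : EndSpinor V) ≤ B) (h2 : B ≤ Λ₂ • (1 : EndSpinor V)) :
    ‖B - Λ₂ • (1 : EndSpinor V)‖ ≤ Λ₂ - Λ₁ := by
  have hsym : (B - Λ₂ • (1 : EndSpinor V)).IsSymmetric := by
    intro x y
    have := hB x y
    simp only [ContinuousLinearMap.coe_coe] at this
    simp [inner_sub_left, inner_sub_right, inner_smul_left, inner_smul_right, this]
  refine norm_le_of_isSymmetric hsym (by linarith) fun x => ?_
  have e1 := (ContinuousLinearMap.le_def _ _).1 h1 |>.inner_nonneg_left x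
  have e2 := (ContinuousLinearMap.le_def _ _).1 h2 |>.inner_nonneg_left x
  simp only [sub_apply, smul_apply, one_apply_eq_self, inner_sub_left, inner_smul_left,
    real_inner_self_eq_norm_sq, conj_trivial] at e1 e2 ⊢
  rw [abs_le]
  constructor <;> nlinarith

variable [CompleteSpace V]

theorem binom_commute (a : ℝ) {b Y : EndSpinor V} (hb : ‖b‖ < 1) (h : Commute b Y) :
    Commute (binom a b) Y := by
  have h1 := (hasSum_binom a hb).mul_right Y
  have h2 := (hasSum_binom a hb).mul_left Y
  refine h1.unique ?_
  convert h2 using 2 with k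
  rw [smul_mul_assoc, mul_smul_comm, (h.pow_left k).eq]

theorem isSelfAdjoint_binom (a : ℝ) {b : EndSpinor V} (hb : IsSelfAdjoint b) :
    IsSelfAdjoint (binom a b) := by
  rw [isSelfAdjoint_iff]
  unfold binom
  rw [tsum_star]
  refine tsum_congr fun k => ?_
  rw [star_smul, star_pow, hb.star_eq, star_trivial]

/-- The square root of a positive definite operator and its inverse, by the binomial series. -/
theorem sqrt_binom_properties {B : EndSpinor V} (hB : B.IsSymmetric) {Λ₁ Λ₂ : ℝ} (hΛ₁ : 0 < Λ₁)
    (hΛ : Λ₁ ≤ Λ₂) (h1 : Λ₁ • (1 : EndSpinor V) ≤ B) (h2 : B ≤ Λ₂ • (1 : EndSpinor V))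
    {b s r : EndSpinor V} (hb : b = Λ₂⁻¹ • B - 1)
    (hs : s = (√Λ₂)⁻¹ • (binom (-1 / 2) b * B))
    (hr : r = ((√Λ₂)⁻¹ * Λ₂⁻¹) • (binom (-3 / 2) b * B)) :
    s.IsPositive ∧ s * s = B ∧ r * s = 1 ∧ s * r = 1 ∧ r * B = s ∧
      ∀ Y : EndSpinor V, s * Y + Y * s = 0 → Y = 0 := by
  have hΛ₂ : 0 < Λ₂ := hΛ₁.trans_le hΛ
  have hq : √Λ₂ * √Λ₂ = Λ₂ := Real.mul_self_sqrt hΛ₂.le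
  have hq0 : 0 < √Λ₂ := Real.sqrt_pos.2 hΛ₂
  have hbn : ‖b‖ < 1 := by
    have e : b = Λ₂⁻¹ • (B - Λ₂ • (1 : EndSpinor V)) := by
      rw [hb, smul_sub, smul_smul, inv_mul_cancel₀ hΛ₂.ne', one_smul]
    rw [e, norm_smul, Real.norm_of_nonneg (by positivity), ← div_eq_inv_mul, div_lt_one hΛ₂]
    linarith [norm_sub_smul_one_le hB hΛ h1 h2]
  have hbsa : IsSelfAdjoint b := by
    rw [hb]
    refine IsSelfAdjoint.sub (IsSelfAdjoint.smul (IsSelfAdjoint.all _) ?_) (IsSelfAdjoint.one _)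
    exact ContinuousLinearMap.isSelfAdjoint_iff_isSymmetric.2 hB
  have hBb : B = Λ₂ • binom 1 b := by
    rw [binom_one, hb, add_sub_cancel, smul_smul, mul_inv_cancel₀ hΛ₂.ne', one_smul]
  -- As `B = Λ₂ (1 + b)`, the factor `B` in the definition raises the exponent by one.
  have hs' : s = √Λ₂ • binom (1 / 2) b := by
    rw [hs, hBb, mul_smul_comm, binom_mul_binom _ _ hbn, smul_smul]
    congr 1
    · field_simp
      rw [sq, hq]
    · norm_num
  have hr' : r = (√Λ₂)⁻¹ • binom (-1 / 2) b := by
    rw [hr, hBb, mul_smul_comm, binom_mul_binom _ _ hbn, smul_smul]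
    congr 1
    · field_simp
    · norm_num
  have hss : s * s = B := by
    rw [hs', smul_mul_smul_comm, hq, binom_mul_binom _ _ hbn, hBb]
    norm_num
  have hrs : r * s = 1 := by
    rw [hs', hr', smul_mul_smul_comm, inv_mul_cancel₀ hq0.ne', binom_mul_binom _ _ hbn, one_smul]
    norm_num [binom_zero]
  have hsr : s * r = 1 := by
    rw [hs', hr', smul_mul_smul_comm, mul_inv_cancel₀ hq0.ne', binom_mul_binom _ _ hbn, one_smul]
    norm_num [binom_zero]
  refine ⟨?_, hss, hrs, hsr, ?_, fun Y hY => ?_⟩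
  -- Positivity: `(1 + b)^{1/2}` is the square of the self-adjoint `(1 + b)^{1/4}`.
  · have h4 : binom (1 / 2) b = star (binom (1 / 4) b) * binom (1 / 4) b := by
      rw [(isSelfAdjoint_binom (1 / 4) hbsa).star_eq, binom_mul_binom _ _ hbn]
      norm_num
    rw [hs', h4]
    exact (ContinuousLinearMap.isPositive_adjoint_comp_self _).smul_of_nonneg hq0.le
  · rw [← hss, ← mul_assoc, hrs, one_mul]
  -- If `Y` anticommutes with `s`, it commutes with `s² = B`, thus with `b` and with `s`, a series
  -- in `b`; then `2 s Y = 0`.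
  · have hanti : s * Y = -(Y * s) := eq_neg_of_add_eq_zero_left hY
    have hc : Commute B Y := by
      change B * Y = Y * B
      rw [← hss, mul_assoc, hanti, mul_neg, ← mul_assoc, hanti, neg_mul, neg_neg, mul_assoc]
    have hcb : Commute b Y := by
      rw [hb]
      exact (hc.smul_left _).sub_left (Commute.one_left Y)
    have hcs : s * Y = Y * s := by
      rw [hs', smul_mul_assoc, mul_smul_comm, (binom_commute (1 / 2) hbn hcb).eq]
    have h2 : (2 : ℝ) • (s * Y) = 0 := by
      rw [two_smul]
      nth_rewrite 2 [hcs]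
      exact hY
    have h0 : s * Y = 0 := (smul_eq_zero.1 h2).resolve_left two_ne_zero
    calc Y = r * (s * Y) := by rw [← mul_assoc, hrs, one_mul]
      _ = 0 := by rw [h0, mul_zero]

end Pointwise

/-! ### Operator series evaluated pointwise. -/

section Abstract

variable {W : Type*} [NormedAddCommGroup W] [NormedSpace ℝ W]
  {α : Type*} [MeasurableSpace α] {μ : Measure α} {V : Type*} [NormedAddCommGroup V]
  [InnerProductSpace ℝ V] (ι : W →L[ℝ] Lp (EndSpinor V) ∞ μ)

theorem ae_sum_binom {T : W →L[ℝ] W} {b : α → EndSpinor V}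
    (hT : ∀ u, ι (T u) =ᵐ[μ] fun x => b x * ι u x) (a : ℝ) (u : W) (N : ℕ) :
    ι ((∑ k ∈ Finset.range N, Ring.choose a k • T ^ k) u) =ᵐ[μ]
      fun x => (∑ k ∈ Finset.range N, Ring.choose a k • b x ^ k) * ι u x := by
  have hpow : ∀ k : ℕ, ι ((T ^ k) u) =ᵐ[μ] fun x => b x ^ k * ι u x := by
    intro k
    induction k with
    | zero => exact Eventually.of_forall fun x => by simp
    | succ k ih =>
      rw [pow_succ']
      filter_upwards [ih, hT ((T ^ k) u)] with x h1 h2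
      rw [mul_apply_eq_comp, h2, h1, pow_succ', mul_assoc]
  induction N with
  | zero =>
    simp only [Finset.range_zero, Finset.sum_empty, zero_apply, map_zero, zero_mul]
    exact Lp.coeFn_zero _ _ _
  | succ N ih =>
    simp only [Finset.sum_range_succ, add_apply, smul_apply, map_add, map_smul]
    filter_upwards [ih, hpow N, Lp.coeFn_add
      (ι ((∑ k ∈ Finset.range N, Ring.choose a k • T ^ k) u))
      (Ring.choose a N • ι ((T ^ N) u)), Lp.coeFn_smul (Ring.choose a N) (ι ((T ^ N) u))]
      with x h1 h2 h3 h4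
    rw [h3, Pi.add_apply, h1, h4, Pi.smul_apply, h2, add_mul, smul_mul_assoc]

/-- The binomial series of an operator of multiplication is computed pointwise. -/
theorem ae_binom [CompleteSpace V] {T : W →L[ℝ] W} {b : α → EndSpinor V}
    (hb : ∀ᵐ x ∂μ, ‖b x‖ < 1) (hT : ∀ u, ι (T u) =ᵐ[μ] fun x => b x * ι u x) (a : ℝ) (u : W)
    (hsum : HasSum (fun k : ℕ => Ring.choose a k • T ^ k) (binom a T)) :
    ι (binom a T u) =ᵐ[μ] fun x => binom a (b x) * ι u x := by
  have h1 : Tendsto (fun N => ι ((∑ k ∈ Finset.range N, Ring.choose a k • T ^ k) u)) atTop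
      (𝓝 (ι (binom a T u))) :=
    (((ι ∘L ContinuousLinearMap.apply ℝ W u).continuous.tendsto _).comp hsum.tendsto_sum_nat)
  -- The partial sums converge in `L^∞`, hence almost everywhere along a subsequence, and pointwise
  -- they also converge to the binomial series of `b x`.
  obtain ⟨ns, hns, hae⟩ := (tendstoInMeasure_of_tendsto_Lp h1).exists_seq_tendsto_ae
  filter_upwards [hae, hb, ae_all_iff.2 fun N => ae_sum_binom ι hT a u N] with x hx hbx hN
  simp only [hN] at hx
  refine tendsto_nhds_unique hx ?_
  exact ((hasSum_binom a hbx).tendsto_sum_nat.comp hns.tendsto_atTop).mul_const _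

end Abstract

end SpinGeom

namespace SpinGeom

/-! ### The square root of a path of positive multipliers -/

section SqrtPath

variable {α : Type*} [MeasurableSpace α] {μ : Measure α}
  {V : Type*} [NormedAddCommGroup V] [InnerProductSpace ℝ V]
  {W : Type*} [NormedAddCommGroup W] [NormedSpace ℝ W]
  {ι : W →L[ℝ] Lp (EndSpinor V) ∞ μ} {m : W →L[ℝ] W →L[ℝ] W}

/-- The multiplication operator by `B / Λ - 1`. -/
noncomputable def relMul (m : W →L[ℝ] W →L[ℝ] W) (Λ : ℝ) (B : W) : W →L[ℝ] W := Λ⁻¹ • m B - 1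

theorem relMul_ae (hm : ∀ u w, ι (m u w) =ᵐ[μ] fun x => ι u x * ι w x) (Λ : ℝ) (B u : W) :
    ι (relMul m Λ B u) =ᵐ[μ] fun x => (Λ⁻¹ • ι B x - 1) * ι u x := by
  have e : ι (relMul m Λ B u) = Λ⁻¹ • ι (m B u) - ι u := by
    rw [relMul, sub_apply, smul_apply, one_apply_eq_self, map_sub, map_smul]
  rw [e]
  filter_upwards [hm B u, Lp.coeFn_sub (Λ⁻¹ • ι (m B u)) (ι u), Lp.coeFn_smul Λ⁻¹ (ι (m B u))]
    with x h1 h2 h3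
  rw [h2, Pi.sub_apply, h3, Pi.smul_apply, h1, sub_mul, one_mul, smul_mul_assoc]

/-- If `B` is bounded between positive constants, then the binomial series is smooth at the
multiplication operator by `B / Λ₂ - 1`. -/
theorem contDiffAt_binom_relMul [CompleteSpace W]
    (hm : ∀ u w, ι (m u w) =ᵐ[μ] fun x => ι u x * ι w x) {Λ₁ Λ₂ : ℝ} (hΛ₁ : 0 < Λ₁)
    (hΛ : Λ₁ ≤ Λ₂) {B : W} (hB : ∀ᵐ x ∂μ, ‖ι B x - Λ₂ • (1 : EndSpinor V)‖ ≤ Λ₂ - Λ₁) {K : ℝ}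
    (hK : ∀ u, ‖m B u - Λ₂ • u‖ ≤ (Λ₂ - Λ₁) * ‖u‖ + K * ‖ι u‖) (a : ℝ) :
    ContDiffAt ℝ 1 (binom a : (W →L[ℝ] W) → (W →L[ℝ] W)) (relMul m Λ₂ B) ∧
      HasSum (fun k : ℕ => Ring.choose a k • relMul m Λ₂ B ^ k) (binom a (relMul m Λ₂ B)) := by
  have hΛ₂ : 0 < Λ₂ := hΛ₁.trans_le hΛ
  refine contDiffAt_binom_of_contraction a ι (relMul m Λ₂ B) (q := Λ₂⁻¹ * (Λ₂ - Λ₁))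
    (K := Λ₂⁻¹ * K) (mul_nonneg (inv_nonneg.2 hΛ₂.le) (sub_nonneg.2 hΛ)) ?_ (fun u => ?_)
    fun u => ?_
  · rw [inv_mul_lt_iff₀ hΛ₂]
    linarith
  · refine Lp.norm_le_mul_norm_of_ae_le_mul ?_
    filter_upwards [relMul_ae hm Λ₂ B u, hB] with x h1 h2
    have e : Λ₂⁻¹ • ι B x - 1 = Λ₂⁻¹ • (ι B x - Λ₂ • (1 : EndSpinor V)) := by
      rw [smul_sub, smul_smul, inv_mul_cancel₀ hΛ₂.ne', one_smul]
    rw [h1, e]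
    refine (norm_mul_le _ _).trans (mul_le_mul_of_nonneg_right ?_ (norm_nonneg _))
    rw [norm_smul, Real.norm_of_nonneg (inv_nonneg.2 hΛ₂.le)]
    exact mul_le_mul_of_nonneg_left h2 (inv_nonneg.2 hΛ₂.le)
  · have e : relMul m Λ₂ B u = Λ₂⁻¹ • (m B u - Λ₂ • u) := by
      rw [relMul, smul_sub, smul_smul, inv_mul_cancel₀ hΛ₂.ne', one_smul]
      rfl
    rw [e, norm_smul, Real.norm_of_nonneg (inv_nonneg.2 hΛ₂.le)]
    refine (mul_le_mul_of_nonneg_left (hK u) (inv_nonneg.2 hΛ₂.le)).trans (le_of_eq ?_)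
    ring

theorem contDiffOn_binom_relMul [CompleteSpace W] {I : Set ℝ} {A : ℝ → W} {Λ a : ℝ} (c : ℝ)
    (hA : ContDiffOn ℝ 1 A I)
    (h : ∀ t ∈ I, ContDiffAt ℝ 1 (binom a : (W →L[ℝ] W) → (W →L[ℝ] W)) (relMul m Λ (A t))) :
    ContDiffOn ℝ 1 (fun t => c • binom a (relMul m Λ (A t)) (A t)) I := by
  intro t ht
  have h1 : ContDiffWithinAt ℝ 1 (fun t => relMul m Λ (A t)) I t :=
    ((m.contDiff.comp_contDiffWithinAt (hA t ht)).const_smul Λ⁻¹).sub contDiffWithinAt_const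
  exact (((h t ht).comp_contDiffWithinAt t h1).clm_apply (hA t ht)).const_smul c

/-- The product rule for paths of multipliers. -/
theorem derivWithin_mul_ae (hm : ∀ u w, ι (m u w) =ᵐ[μ] fun x => ι u x * ι w x) {I : Set ℝ}
    {F G H : ℝ → W} {t : ℝ} (ht : t ∈ I) (hF : DifferentiableWithinAt ℝ F I t)
    (hG : DifferentiableWithinAt ℝ G I t) (hH : DifferentiableWithinAt ℝ H I t)
    (h : ∀ t ∈ I, ι (m (F t) (G t)) = ι (H t)) :
    ι (derivWithin H I t) =ᵐ[μ]
      fun x => ι (F t) x * ι (derivWithin G I t) x + ι (derivWithin F I t) x * ι (G t) x := by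
  by_cases hu : UniqueDiffWithinAt ℝ I t
  · have h1 : HasDerivWithinAt (fun t => ι (m (F t) (G t)))
        (ι (m (F t) (derivWithin G I t) + m (derivWithin F I t) (G t))) I t :=
      ι.hasFDerivAt.comp_hasDerivWithinAt t
        (m.hasDerivWithinAt_of_bilinear hF.hasDerivWithinAt hG.hasDerivWithinAt)
    have h2 : HasDerivWithinAt (fun t => ι (H t)) (ι (derivWithin H I t)) I t :=
      ι.hasFDerivAt.comp_hasDerivWithinAt t hH.hasDerivWithinAt
    have e : ι (derivWithin H I t) =
        ι (m (F t) (derivWithin G I t)) + ι (m (derivWithin F I t) (G t)) := by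
      rw [← map_add]
      exact hu.eq_deriv _ h2 (h1.congr (fun s hs => (h s hs).symm) (h t ht).symm)
    rw [e]
    filter_upwards [Lp.coeFn_add (ι (m (F t) (derivWithin G I t)))
      (ι (m (derivWithin F I t) (G t))), hm (F t) (derivWithin G I t),
      hm (derivWithin F I t) (G t)] with x h1 h2 h3
    rw [h1, Pi.add_apply, h2, h3]
  -- Where `I` has no unique derivative, for instance when it is a single point, every `derivWithin`
  -- has the default value 0 and the identity is trivial.
  · simp only [derivWithin_zero_of_not_uniqueDiffWithinAt hu, map_zero]
    filter_upwards [Lp.coeFn_zero (EndSpinor V) ∞ μ] with x hx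
    rw [hx, Pi.zero_apply, mul_zero, zero_mul, add_zero]

/-- The square root of a `C¹` path of positive multipliers is a `C¹` path, as is its inverse. -/
theorem exists_sqrt_path [CompleteSpace V] [CompleteSpace W]
    (hm : ∀ u w, ι (m u w) =ᵐ[μ] fun x => ι u x * ι w x) {Λ₁ Λ₂ : ℝ} (hΛ₁ : 0 < Λ₁)
    (hΛ : Λ₁ ≤ Λ₂) {I : Set ℝ} {A : ℝ → W} (hA : ContDiffOn ℝ 1 A I)
    (hP : ∀ t ∈ I, ∀ᵐ x ∂μ, (ι (A t) x).IsSymmetric ∧ Λ₁ • (1 : EndSpinor V) ≤ ι (A t) x ∧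
      ι (A t) x ≤ Λ₂ • (1 : EndSpinor V))
    (hK : ∀ t ∈ I, ∃ K, ∀ u, ‖m (A t) u - Λ₂ • u‖ ≤ (Λ₂ - Λ₁) * ‖u‖ + K * ‖ι u‖) :
    ∃ S Q : ℝ → W,
      (∀ t ∈ I, (∀ᵐ x ∂μ, (ι (S t) x).IsPositive ∧ ι (S t) x * ι (S t) x = ι (A t) x) ∧
        ∀ᵐ x ∂μ, ι (Q t) x * ι (S t) x = 1 ∧ ι (S t) x * ι (Q t) x = 1) ∧
      ContDiffOn ℝ 1 S I ∧ ContDiffOn ℝ 1 Q I ∧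
      ∀ t ∈ I,
        (∀ᵐ x ∂μ, ∀ X : EndSpinor V,
          ι (S t) x * X + X * ι (S t) x = ι (derivWithin A I t) x ↔
            X = ι (derivWithin S I t) x) ∧
        (∀ᵐ x ∂μ, ι (derivWithin Q I t) x =
          -(ι (Q t) x * ι (derivWithin S I t) x * ι (Q t) x)) := by
  have hΛ₂ : 0 < Λ₂ := hΛ₁.trans_le hΛ
  have hB : ∀ t ∈ I, ∀ᵐ x ∂μ, ‖ι (A t) x - Λ₂ • (1 : EndSpinor V)‖ ≤ Λ₂ - Λ₁ := fun t ht => by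
    filter_upwards [hP t ht] with x hx using norm_sub_smul_one_le hx.1 hΛ hx.2.1 hx.2.2
  have hbin : ∀ a : ℝ, ∀ t ∈ I,
      ContDiffAt ℝ 1 (binom a : (W →L[ℝ] W) → (W →L[ℝ] W)) (relMul m Λ₂ (A t)) ∧
      HasSum (fun k : ℕ => Ring.choose a k • relMul m Λ₂ (A t) ^ k)
        (binom a (relMul m Λ₂ (A t))) := fun a t ht => by
    obtain ⟨K, hK⟩ := hK t ht
    exact contDiffAt_binom_relMul hm hΛ₁ hΛ (hB t ht) hK a
  have hval : ∀ c a : ℝ, ∀ t ∈ I, ι (c • binom a (relMul m Λ₂ (A t)) (A t)) =ᵐ[μ]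
      fun x => c • (binom a (Λ₂⁻¹ • ι (A t) x - 1) * ι (A t) x) := fun c a t ht => by
    have hb : ∀ᵐ x ∂μ, ‖Λ₂⁻¹ • ι (A t) x - 1‖ < 1 := by
      filter_upwards [hB t ht] with x hx
      have e : Λ₂⁻¹ • ι (A t) x - 1 = Λ₂⁻¹ • (ι (A t) x - Λ₂ • (1 : EndSpinor V)) := by
        rw [smul_sub, smul_smul, inv_mul_cancel₀ hΛ₂.ne', one_smul]
      rw [e, norm_smul, Real.norm_of_nonneg (inv_nonneg.2 hΛ₂.le), inv_mul_lt_iff₀ hΛ₂]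
      linarith
    rw [map_smul]
    filter_upwards [ae_binom ι hb (relMul_ae hm Λ₂ (A t)) a (A t) (hbin a t ht).2,
      Lp.coeFn_smul c (ι (binom a (relMul m Λ₂ (A t)) (A t)))] with x h1 h2
    rw [h2, Pi.smul_apply, h1]
  -- The operator series must act on an element of `W`. Acting on `A t`, with the exponent lowered
  -- by one, avoids requiring the identity section to belong to `W`.
  set S : ℝ → W := fun t => (√Λ₂)⁻¹ • binom (-1 / 2) (relMul m Λ₂ (A t)) (A t) with hS
  set Q : ℝ → W := fun t => ((√Λ₂)⁻¹ * Λ₂⁻¹) • binom (-3 / 2) (relMul m Λ₂ (A t)) (A t) with hQ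
  have hSC : ContDiffOn ℝ 1 S I :=
    contDiffOn_binom_relMul _ hA fun t ht => (hbin (-1 / 2) t ht).1
  have hQC : ContDiffOn ℝ 1 Q I :=
    contDiffOn_binom_relMul _ hA fun t ht => (hbin (-3 / 2) t ht).1
  have key : ∀ t ∈ I, ∀ᵐ x ∂μ, (ι (S t) x).IsPositive ∧ ι (S t) x * ι (S t) x = ι (A t) x ∧
      ι (Q t) x * ι (S t) x = 1 ∧ ι (S t) x * ι (Q t) x = 1 ∧ ι (Q t) x * ι (A t) x = ι (S t) x ∧
      ∀ Y : EndSpinor V, ι (S t) x * Y + Y * ι (S t) x = 0 → Y = 0 := fun t ht => by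
    filter_upwards [hP t ht, hval (√Λ₂)⁻¹ (-1 / 2) t ht, hval ((√Λ₂)⁻¹ * Λ₂⁻¹) (-3 / 2) t ht]
      with x h1 h2 h3
    exact sqrt_binom_properties h1.1 hΛ₁ hΛ h1.2.1 h1.2.2 rfl h2 h3
  have dS : ∀ t ∈ I, ι (derivWithin A I t) =ᵐ[μ] fun x =>
      ι (S t) x * ι (derivWithin S I t) x + ι (derivWithin S I t) x * ι (S t) x := fun t ht =>
    derivWithin_mul_ae hm ht (hSC.differentiableOn one_ne_zero t ht)
      (hSC.differentiableOn one_ne_zero t ht) (hA.differentiableOn one_ne_zero t ht) fun s hs => by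
        refine Lp.ext ?_
        filter_upwards [key s hs, hm (S s) (S s)] with x h1 h2
        rw [h2, h1.2.1]
  -- The relation `Q A = S` is differentiated rather than `Q S = 1`, since all its members lie in
  -- `W`.
  have dQ : ∀ t ∈ I, ι (derivWithin S I t) =ᵐ[μ] fun x =>
      ι (Q t) x * ι (derivWithin A I t) x + ι (derivWithin Q I t) x * ι (A t) x := fun t ht =>
    derivWithin_mul_ae hm ht (hQC.differentiableOn one_ne_zero t ht)
      (hA.differentiableOn one_ne_zero t ht) (hSC.differentiableOn one_ne_zero t ht) fun s hs => by
        refine Lp.ext ?_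
        filter_upwards [key s hs, hm (Q s) (A s)] with x h1 h2
        rw [h2, h1.2.2.2.2.1]
  refine ⟨S, Q, fun t ht => ⟨?_, ?_⟩, hSC, hQC, fun t ht => ⟨?_, ?_⟩⟩
  · filter_upwards [key t ht] with x h using ⟨h.1, h.2.1⟩
  · filter_upwards [key t ht] with x h using ⟨h.2.2.1, h.2.2.2.1⟩
  · filter_upwards [key t ht, dS t ht] with x h h1 X
    refine ⟨fun hX => sub_eq_zero.1 (h.2.2.2.2.2 _ ?_), fun hX => by rw [hX, h1]⟩
    rw [h1] at hX
    rw [mul_sub, sub_mul, sub_add_sub_comm, hX, sub_self]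
  · filter_upwards [key t ht, dS t ht, dQ t ht] with x h h1 h2
    obtain ⟨-, hss, hrs, hsr, -, -⟩ := h
    generalize ι (S t) x = s at *
    generalize ι (Q t) x = r at *
    generalize ι (A t) x = B at *
    generalize ι (derivWithin A I t) x = dA at *
    generalize ι (derivWithin S I t) x = ds at *
    generalize ι (derivWithin Q I t) x = dr at *
    subst hss h1
    -- Insert `B = s²` and `dA = s ds + ds s` into `ds = r dA + dr B`, and cancel `r s = 1`.
    -- Multiplying on the right by `r` twice then isolates `dr`.
    have e : dr * s * s = -(r * ds * s) := by
      have : ds = ds + r * ds * s + dr * s * s := by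
        calc ds = r * (s * ds + ds * s) + dr * (s * s) := h2
          _ = (r * s) * ds + r * ds * s + dr * s * s := by noncomm_ring
          _ = _ := by rw [hrs, one_mul]
      rw [add_assoc, left_eq_add] at this
      exact eq_neg_of_add_eq_zero_right this
    calc dr = dr * s * s * r * r := by
          rw [mul_assoc (dr * s), hsr, mul_one, mul_assoc, hsr, mul_one]
      _ = -(r * ds * r) := by rw [e, neg_mul, neg_mul, mul_assoc (r * ds), hsr, mul_one]

/-- `exists_sqrt_path`, expressed by representatives `f u` of `ι u`. -/
theorem exists_sqrt_path_of_ae [CompleteSpace V] [CompleteSpace W] {f : W → α → EndSpinor V}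
    (hι : ∀ u, ι u =ᵐ[μ] f u) (hm : ∀ u w, ι (m u w) =ᵐ[μ] fun x => f u x * f w x)
    (hK : ∀ (A : W) (c q : ℝ), (∀ᵐ x ∂μ, ‖f A x - c • (1 : EndSpinor V)‖ ≤ q) →
      ∃ K, ∀ u, ‖m A u - c • u‖ ≤ q * ‖u‖ + K * ‖ι u‖)
    {Λ₁ Λ₂ : ℝ} (hΛ₁ : 0 < Λ₁) (hΛ : Λ₁ ≤ Λ₂) {I : Set ℝ} {A : ℝ → W} (hA : ContDiffOn ℝ 1 A I)
    (hP : ∀ t ∈ I, ∀ᵐ x ∂μ, (f (A t) x).IsSymmetric ∧ Λ₁ • (1 : EndSpinor V) ≤ f (A t) x ∧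
      f (A t) x ≤ Λ₂ • (1 : EndSpinor V)) :
    ∃ S Q : ℝ → W,
      (∀ t ∈ I, (∀ᵐ x ∂μ, (f (S t) x).IsPositive ∧ f (S t) x * f (S t) x = f (A t) x) ∧
        ∀ᵐ x ∂μ, f (Q t) x * f (S t) x = 1 ∧ f (S t) x * f (Q t) x = 1) ∧
      ContDiffOn ℝ 1 S I ∧ ContDiffOn ℝ 1 Q I ∧
      ∀ t ∈ I,
        (∀ᵐ x ∂μ, ∀ X : EndSpinor V,
          f (S t) x * X + X * f (S t) x = f (derivWithin A I t) x ↔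
            X = f (derivWithin S I t) x) ∧
        (∀ᵐ x ∂μ, f (derivWithin Q I t) x =
          -(f (Q t) x * f (derivWithin S I t) x * f (Q t) x)) := by
  have hm' : ∀ u w, ι (m u w) =ᵐ[μ] fun x => ι u x * ι w x := fun u w => by
    filter_upwards [hm u w, hι u, hι w] with x h1 h2 h3
    rw [h1, h2, h3]
  obtain ⟨S, Q, h, hS, hQ, h'⟩ := exists_sqrt_path hm' hΛ₁ hΛ hA
    (fun t ht => by
      filter_upwards [hP t ht, hι (A t)] with x h1 h2
      rwa [h2])
    (fun t ht => hK (A t) Λ₂ (Λ₂ - Λ₁) (by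
      filter_upwards [hP t ht] with x hx using norm_sub_smul_one_le hx.1 hΛ hx.2.1 hx.2.2))
  refine ⟨S, Q, fun t ht => ⟨?_, ?_⟩, hS, hQ, fun t ht => ⟨?_, ?_⟩⟩
  · filter_upwards [(h t ht).1, hι (S t), hι (A t)] with x h1 h2 h3
    rwa [h2, h3] at h1
  · filter_upwards [(h t ht).2, hι (S t), hι (Q t)] with x h1 h2 h3
    rwa [h2, h3] at h1
  · filter_upwards [(h' t ht).1, hι (S t), hι (derivWithin A I t), hι (derivWithin S I t)]
      with x h1 h2 h3 h4
    rwa [h2, h3, h4] at h1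
  · filter_upwards [(h' t ht).2, hι (Q t), hι (derivWithin Q I t), hι (derivWithin S I t)]
      with x h1 h2 h3 h4
    rwa [h2, h3, h4] at h1

/-- `exists_sqrt_path` for a space of bounded pairs that is closed under the Leibniz product. -/
theorem exists_sqrt_path_pair [CompleteSpace V] {p : ℝ≥0∞} [Fact (1 ≤ p)] {Y : Type*}
    [NormedAddCommGroup Y] [NormedSpace ℝ Y]
    {W : Submodule ℝ (WithLp 1 (Lp (EndSpinor V) p μ × Lp Y p μ))} [CompleteSpace W]
    (L R : EndSpinor V →L[ℝ] Y →L[ℝ] Y) (hL : ∀ a y, ‖L a y‖ ≤ ‖a‖ * ‖y‖) (hL1 : ∀ y, L 1 y = y)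
    {C : ℝ} (hC0 : 0 ≤ C) (hC : ∀ u : W, ∀ᵐ x ∂μ, ‖u.1.fst x‖ ≤ C * ‖u‖)
    (hW : ∀ u w : W, ∀ z : WithLp 1 (Lp (EndSpinor V) p μ × Lp Y p μ),
      z.fst =ᵐ[μ] (fun x => u.1.fst x * w.1.fst x) →
      z.snd =ᵐ[μ] (fun x => L (u.1.fst x) (w.1.snd x) + R (w.1.fst x) (u.1.snd x)) → z ∈ W)
    {Λ₁ Λ₂ : ℝ} (hΛ₁ : 0 < Λ₁) (hΛ : Λ₁ ≤ Λ₂) {I : Set ℝ} {A : ℝ → W} (hA : ContDiffOn ℝ 1 A I)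
    (hP : ∀ t ∈ I, ∀ᵐ x ∂μ, ((A t).1.fst x).IsSymmetric ∧
      Λ₁ • (1 : EndSpinor V) ≤ (A t).1.fst x ∧ (A t).1.fst x ≤ Λ₂ • (1 : EndSpinor V)) :
    ∃ S Q : ℝ → W,
      (∀ t ∈ I, (∀ᵐ x ∂μ, ((S t).1.fst x).IsPositive ∧
          (S t).1.fst x * (S t).1.fst x = (A t).1.fst x) ∧
        ∀ᵐ x ∂μ, (Q t).1.fst x * (S t).1.fst x = 1 ∧ (S t).1.fst x * (Q t).1.fst x = 1) ∧
      ContDiffOn ℝ 1 S I ∧ ContDiffOn ℝ 1 Q I ∧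
      ∀ t ∈ I,
        (∀ᵐ x ∂μ, ∀ X : EndSpinor V,
          (S t).1.fst x * X + X * (S t).1.fst x = (derivWithin A I t).1.fst x ↔
            X = (derivWithin S I t).1.fst x) ∧
        (∀ᵐ x ∂μ, (derivWithin Q I t).1.fst x =
          -((Q t).1.fst x * (derivWithin S I t).1.fst x * (Q t).1.fst x)) := by
  have hι : ∀ u : W, pairToLinfty hC0 hC u =ᵐ[μ] u.1.fst := fun u => pairToLinfty_ae hC0 hC u
  have hmem : ∀ u w : W, pairMul L R (pairToLinfty hC0 hC) u w ∈ W := fun u w =>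
    hW u w _ (fst_pairMul_ae L R hι u w) (snd_pairMul_ae L R hι u w)
  have hm : ∀ u w : W, pairToLinfty hC0 hC (pairMulL L R (pairToLinfty hC0 hC) hmem u w) =ᵐ[μ]
      fun x => u.1.fst x * w.1.fst x := fun u w =>
    (hι (pairMulL L R (pairToLinfty hC0 hC) hmem u w)).trans (fst_pairMul_ae L R hι u w)
  have hK : ∀ (A : W) (c q : ℝ), (∀ᵐ x ∂μ, ‖A.1.fst x - c • (1 : EndSpinor V)‖ ≤ q) →
      ∃ K, ∀ u : W, ‖pairMulL L R (pairToLinfty hC0 hC) hmem A u - c • u‖ ≤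
        q * ‖u‖ + K * ‖pairToLinfty hC0 hC u‖ := fun A c q hq =>
    ⟨‖R‖ * ‖A.1.snd‖, fun u => norm_pairMulL_sub_le L R hL hL1 hι hmem A hq u⟩
  exact exists_sqrt_path_of_ae (W := W) (f := fun u : W => (u.1.fst : α → EndSpinor V))
    (ι := pairToLinfty hC0 hC) (m := pairMulL L R (pairToLinfty hC0 hC) hmem)
    hι hm hK hΛ₁ hΛ hA hP

end SqrtPath

end SpinGeom

/-! ### The theorem for Sobolev sections. -/

open SpinGeom SpinGeom.SpinStructure in
theorem mainTheorem6 {n : ℕ} {M : Type*} [TopologicalSpace M] [T2Space M] [CompactSpace M]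
    [ChartedSpace (E n) M] [IsManifold (𝓡 n) ∞ M] [MeasurableSpace M] [BorelSpace M]
    (g : RMetric n M) (σ : SpinStructure g)
    {V : Type*} [NormedAddCommGroup V] [InnerProductSpace ℝ V] (κ : SpinorRep n V)
    (p : ℝ≥0∞) [Fact (1 ≤ p)] (hp : (n : ℝ≥0∞) < p) (hp_top : p ≠ ⊤)
    (Λ₁ Λ₂ : ℝ) (hΛ₁ : 0 < Λ₁) (hΛ : Λ₁ ≤ Λ₂)
    (I : Set ℝ) (hI : I.OrdConnected)
    (A : ℝ → σ.W1p κ p) (hA : ContDiffOn ℝ 1 A I)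
    (hP : ∀ t ∈ I, A t ∈ σ.admissible κ p Λ₁ Λ₂) :
    ∃ S Q : ℝ → σ.W1p κ p,
      (∀ t ∈ I, IsSqrt (S t) (A t) ∧ IsInv (Q t) (S t)) ∧
      ContDiffOn ℝ 1 S I ∧ ContDiffOn ℝ 1 Q I ∧
      ∀ t ∈ I,
        (∀ᵐ x ∂vol g, ∀ X : EndSpinor V,
          sec (S t) x * X + X * sec (S t) x = sec (derivWithin A I t) x ↔
            X = sec (derivWithin S I t) x) ∧
        (∀ᵐ x ∂vol g, sec (derivWithin Q I t) x =
          -(sec (Q t) x * sec (derivWithin S I t) x * sec (Q t) x)) := by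
  have : FiniteDimensional ℝ V := Module.finite_of_finrank_pos (by rw [κ.finrank_eq]; positivity)
  have : CompleteSpace V := FiniteDimensional.complete ℝ V
  have : CompleteSpace (σ.W1p κ p) := σ.completeSpace_W1p κ p hp_top
  obtain ⟨C, hC0, hC⟩ := σ.exists_norm_sec_le κ p hp hp_top
  exact exists_sqrt_path_pair (W := σ.W1p κ p) (formMulLeft n V) (formMulRight n V)
    norm_formMulLeft_le formMulLeft_one hC0 hC
    -- Closure under products: Morrey's inequality supplies the essential bounds that the Leibniz
    -- rule needs.
    (fun u w z h1 h2 => (HasWeakCovDeriv.mul u.2 w.2 (hC u) (hC w)).congr h1.symm h2.symm)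
    hΛ₁ hΛ hA hP
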